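/- \textbf{Setting.} A (simple) \emph{polygon} in $\mathbb R^2$ is the closed bounded region enclosed by a simple closed polygonal curve; it need not be convex, and its faces are its vertices, its edges and itself. Let $K$ be a finite connected pure polygonal $2$-complex in $\mathbb R^2$: finitely many polygons with all their edges and vertices, such that any two distinct polygons are disjoint or meet in exactly one common vertex or in exactly one common edge, and the union $|K|$ is connected. The \emph{holes} of $K$ are the closures of the bounded components of $\mathbb R^2\setminus|K|$, and the \emph{outside} is the closure of the unbounded component. Assume: the holes are pairwise disjoint and disjoint from the outside; a polygon of $K$ and a hole share at most one edge; no two adjacent edges of a polygon of $K$ are both contained in the outside. \textbf{Offsets.} For a polygon $f$ and $t\ge 0$, let $f(t)$ be the closed curve obtained by translating every edge of $f$ inwards, perpendicular to itself, by the distance $t$; each vertex moves to the intersection of its two translated edge lines (along the common normal if its angle is flat). For each $f\in K$ let $t_f>0$ be such that $f(s)$ is a simple closed polygon for all $s\in[0,t_f]$ (no edge shrinks to a point and the polygon does not split: no combinatorial or topological changes), and let $\hat f$ be the polygon bounded by $f(t_f)$, the \emph{mitered offset} of $f$. Put $\hat f=f$ if $f$ is a hole or the outside. For a vertex $v$ of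 $f$, let $\hat v_f$ be the corresponding vertex of $\hat f$ (so $\hat v_f=v$ if $f$ is a hole or the outside). \textbf{Euler transformation.} $\hat K$ consists of the following cells. (1) For each polygon $f\in K$, the polygon $\hat f$. (2) For each edge $e=\{u,v\}$ of $K$, contained in exactly two polygons $f,f'$ among those of $K$, the holes and the outside, the $4$-gon $\hat f_e$ with edges $\{\hat u_f,\hat v_f\}$, $\{\hat v_f,\hat v_{f'}\}$, $\{\hat v_{f'},\hat u_{f'}\}$, $\{\hat u_{f'},\hat u_f\}$. (3) For each vertex $v$ of $K$, the polygon $\hat f_v$ whose edges are the segments $\{\hat v_f,\hat v_{f'}\}$ for all pairs $f\ne f'$ of polygons of $K$, holes or outside that share an edge of $K$ ending in $v$. If $v$ is an articulation vertex, there is instead one such polygon for each fan at $v$, i.e. for each class of polygons of $K$ at $v$ that can be linked through shared edges ending in $v$. The $1$-skeleton $\hat G$ of $\hat K$ is the graph formed by all vertices $\hat v_f$ and all edges of these cells. \textbf{Lemma.} $\hat G$ is a planar graph; more precisely, its vertices are distinct points, and its straight edges contain no vertices except their ends and meet one another only in common ends. Moreover: (a) each cell of $\hat K$ is bounded by a simple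 closed polygon; (b) any two distinct cells of $\hat K$ are disjoint, or meet in exactly one common vertex, or in exactly one common edge; (c) $\hat f\cap\hat g=\emptyset$ for any two distinct polygons $f,g\in K$; (d) for each edge $e$ of $K$, $\hat f_e$ is a convex trapezium (with at least one pair of parallel sides, namely $\{\hat u_f,\hat v_f\}$ and $\{\hat u_{f'},\hat v_{f'}\}$); (e) for any two distinct vertices $u,v$ of $K$, the polygons $\hat f_u$ and $\hat f_v$ are disjoint. -/

import Mathlib

open Set Filter Topology

namespace EulerTransform

/-! ### Simple polygons in the plane -/

/-- The Euclidean plane `ℝ²`. -/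
abbrev Plane : Type := EuclideanSpace ℝ (Fin 2)

/-- The straight segment spanned by an unordered pair of points. -/
noncomputable def seg (e : Sym2 Plane) : Set Plane :=
  Sym2.lift ⟨fun a b => affineSegment ℝ a b, fun a b => affineSegment_comm ℝ a b⟩ e

/-- A closed polygonal curve is simple: it has at least three vertices, they are distinct,
consecutive edges meet only in their common vertex, and other pairs of edges are disjoint. -/
def IsSimple {n : ℕ} (p : Polygon Plane n) : Prop :=
  3 ≤ n ∧ Function.Injective p.vertices ∧
  (∀ i, p.edgeSet ℝ i ∩ p.edgeSet ℝ (finRotate n i) = {p (finRotate n i)}) ∧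
  (∀ i j, j ≠ i → j ≠ finRotate n i → i ≠ finRotate n j →
    Disjoint (p.edgeSet ℝ i) (p.edgeSet ℝ j))

/-- A closed curve together with everything that it encloses: the points of `J`, and the points
that lie in a bounded connected component of the complement of `J`. -/
def fill (J : Set Plane) : Set Plane :=
  J ∪ {x | x ∉ J ∧ Bornology.IsBounded (connectedComponentIn Jᶜ x)}

/-- The closed region bounded by a polygonal curve. -/
def region {n : ℕ} (p : Polygon Plane n) : Set Plane := fill (p.boundary ℝ)

/-- Counterclockwise rotation by a right angle. -/
noncomputable def rot (v : Plane) : Plane := !₂[-(v 1), v 0]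

/-- The unit normal of the `i`-th edge, pointing to the left of the edge. -/
noncomputable def normal {n : ℕ} (p : Polygon Plane n) (i : Fin n) : Plane :=
  ‖p (finRotate n i) - p i‖⁻¹ • rot (p (finRotate n i) - p i)

/-- The vertices are listed counterclockwise: along each edge, the region lies immediately to the
left of the edge and its complement immediately to the right. -/
def IsCounterclockwise {n : ℕ} (p : Polygon Plane n) : Prop :=
  ∀ i, ∀ x ∈ p.edgeSet ℝ i, x ≠ p i → x ≠ p (finRotate n i) →
    ∀ᶠ ε in 𝓝[>] (0 : ℝ), x + ε • normal p i ∈ region p ∧ x - ε • normal p i ∉ region p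

/-- A simple polygon in the plane, not necessarily convex, with its vertices listed
counterclockwise. -/
structure SimplePolygon where
  n : ℕ
  poly : Polygon Plane n
  simple : IsSimple poly
  ccw : IsCounterclockwise poly

namespace SimplePolygon

/-- The closed region occupied by the polygon. -/
def carrier (P : SimplePolygon) : Set Plane := region P.poly

def vertices (P : SimplePolygon) : Set Plane := Set.range P.poly.vertices

/-- The edges (facets) of the polygon, as unordered pairs of consecutive vertices. -/
def edges (P : SimplePolygon) : Set (Sym2 Plane) :=
  Set.range fun i => s(P.poly i, P.poly (finRotate P.n i))

end SimplePolygon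

/-! ### Mitered offsets -/

/-- The curve obtained by moving every edge of `p` inwards, parallel to itself, by the distance `t`.
The `i`-th vertex is the point in which the translated lines of its two edges meet; when these
two lines coincide (flat angle), it is the translate of the vertex along their normal. -/
noncomputable def offset {n : ℕ} (p : Polygon Plane n) (t : ℝ) : Polygon Plane n where
  vertices i :=
    p i + (t / (1 + inner ℝ (normal p ((finRotate n).symm i)) (normal p i))) •
      (normal p ((finRotate n).symm i) + normal p i)

/-- `t` is the distance of an inward mitered offset without combinatorial or topological changes:
while the edges move from distance `0` to distance `t`, the curve stays a simple polygon, i.e. no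
edge shrinks to a point and the polygon does not split. -/
def IsMiteredOffset (P : SimplePolygon) (t : ℝ) : Prop :=
  0 < t ∧ ∀ s ∈ Set.Icc 0 t, IsSimple (offset P.poly s)

/-! ### Polygonal complexes, holes and the outside -/

/-- A pure polygonal 2-complex in the plane, given by its polygons: any two distinct polygons
are disjoint, or meet in exactly one common vertex, or in exactly one common edge.  The cells are
the polygons with all their edges and vertices. -/
structure PolygonalComplex (ι : Type*) where
  face : ι → SimplePolygon
  inter_face : ∀ f g, f ≠ g →
    (face f).carrier ∩ (face g).carrier = ∅ ∨
    (∃ v ∈ (face f).vertices, v ∈ (face g).vertices ∧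
      (face f).carrier ∩ (face g).carrier = {v}) ∨
    (∃ e ∈ (face f).edges, e ∈ (face g).edges ∧
      (face f).carrier ∩ (face g).carrier = seg e)

variable {ι : Type*}

namespace PolygonalComplex

/-- The underlying space of the complex. -/
def space (K : PolygonalComplex ι) : Set Plane := ⋃ f, (K.face f).carrier

def vertices (K : PolygonalComplex ι) : Set Plane := ⋃ f, (K.face f).vertices

def edges (K : PolygonalComplex ι) : Set (Sym2 Plane) := ⋃ f, (K.face f).edges

/-- The complementary polygons: closures of the connected components of the complement of the
underlying space.  The bounded ones are the holes, the unbounded one is the outside. -/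
def ComplPolygon (K : PolygonalComplex ι) : Type :=
  {C : Set Plane // ∃ x ∉ K.space, C = closure (connectedComponentIn K.spaceᶜ x)}

/-- The set of points of a complementary polygon. -/
def ComplPolygon.carrier {K : PolygonalComplex ι} (C : K.ComplPolygon) : Set Plane := C.1

def ComplPolygon.IsHole {K : PolygonalComplex ι} (C : K.ComplPolygon) : Prop :=
  Bornology.IsBounded C.carrier

def ComplPolygon.IsOutside {K : PolygonalComplex ι} (C : K.ComplPolygon) : Prop :=
  ¬ Bornology.IsBounded C.carrier

/-- The complex, the holes and the outside cover the plane. -/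
theorem space_union_compl (K : PolygonalComplex ι) :
    K.space ∪ ⋃ C : K.ComplPolygon, C.carrier = Set.univ := by
  ext x
  simp only [Set.mem_union, Set.mem_iUnion, Set.mem_univ, iff_true]
  by_cases hx : x ∈ K.space
  · exact Or.inl hx
  · exact Or.inr ⟨⟨_, x, hx, rfl⟩, subset_closure (mem_connectedComponentIn hx)⟩

/-- The conditions on the input of the Euler transformation. -/
structure IsEulerInput (K : PolygonalComplex ι) : Prop where
  /-- The complex is connected. -/
  connected : IsConnected K.space
  /-- The holes and the outside are pairwise disjoint. -/
  disjoint : ∀ C D : K.ComplPolygon, C ≠ D → Disjoint C.carrier D.carrier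
  /-- A polygon and a hole share at most one edge. -/
  hole : ∀ (f : ι) (C : K.ComplPolygon), C.IsHole →
    ∀ e ∈ (K.face f).edges, ∀ e' ∈ (K.face f).edges,
      seg e ⊆ C.carrier → seg e' ⊆ C.carrier → e = e'
  /-- No two adjacent edges of a polygon are shared with the outside. -/
  outside : ∀ (f : ι) (C : K.ComplPolygon), C.IsOutside → ∀ i,
    ¬ ((K.face f).poly.edgeSet ℝ i ⊆ C.carrier ∧
       (K.face f).poly.edgeSet ℝ (finRotate (K.face f).n i) ⊆ C.carrier)

/-! ### The Euler transformation -/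

/-- A vertex of the Euler transformation: a copy of the `i`-th vertex of a polygon `f` of the
complex, or the (unchanged) copy of a vertex `v` in a hole or the outside. -/
inductive HatVertex (K : PolygonalComplex ι) where
  | ofFace (f : ι) (i : Fin (K.face f).n)
  | ofCompl (C : K.ComplPolygon) (v : Plane) (hv : v ∈ K.vertices) (hC : v ∈ C.carrier)

/-- The polygon (in the complex, a hole, or the outside) in whose duplicate the vertex lies. -/
def HatVertex.owner {K : PolygonalComplex ι} : K.HatVertex → ι ⊕ K.ComplPolygon
  | .ofFace f _ => Sum.inl f
  | .ofCompl C _ _ _ => Sum.inr C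

/-- The vertex of the complex of which this is a copy. -/
def HatVertex.base {K : PolygonalComplex ι} : K.HatVertex → Plane
  | .ofFace f i => (K.face f).poly i
  | .ofCompl _ v _ _ => v

/-- The position of a vertex when the polygon `f` is offset by `t f`; holes and the outside are
not changed. -/
noncomputable def HatVertex.pos {K : PolygonalComplex ι} (t : ι → ℝ) : K.HatVertex → Plane
  | .ofFace f i => offset (K.face f).poly (t f) i
  | .ofCompl _ v _ _ => v

/-- The edges of the complex that belong to a given polygon, hole or the outside. -/
def edgesOf (K : PolygonalComplex ι) : ι ⊕ K.ComplPolygon → Set (Sym2 Plane)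
  | Sum.inl f => (K.face f).edges
  | Sum.inr C => {e | e ∈ K.edges ∧ seg e ⊆ C.carrier}

/-- The polygons `f` and `g` share an edge that ends in `v`. -/
def ShareEdgeAt (K : PolygonalComplex ι) (v : Plane) (f g : ι) : Prop :=
  ∃ e ∈ (K.face f).edges, e ∈ (K.face g).edges ∧ v ∈ e

/-- The fans at `v`: the classes of polygons containing `v` that can be connected through shared
edges ending in `v`.  Unless `v` is an articulation vertex, there is exactly one fan at `v`,
consisting of all polygons containing `v`; at an articulation vertex there is one fan for each of
the parts that meet there. -/
def fans (K : PolygonalComplex ι) (v : Plane) : Set (Set ι) :=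
  {c | ∃ f, v ∈ (K.face f).vertices ∧ c = {g | Relation.EqvGen (K.ShareEdgeAt v) f g}}

/-- The polygons of the Euler transformation: one for each polygon, one for each edge and one for
each vertex of the complex (for an articulation vertex, one for each fan). -/
inductive HatCell (K : PolygonalComplex ι) where
  | ofFace (f : ι)
  | ofEdge (e : Sym2 Plane) (he : e ∈ K.edges)
  | ofVertex (v : Plane) (c : Set ι) (hc : c ∈ K.fans v)

/-- The facets (edges) of the polygons of the Euler transformation.
* `ofFace f`: the copies of the edges of `f`.
* `ofEdge e`: the copies of `e` in the two polygons containing it, and for each end of `e` the new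
  edge that joins the two copies of this end in these two polygons.
* `ofVertex v c`: the new edges that join the copies of `v` in two polygons that share an edge
  ending in `v`, at least one of them being a polygon of the fan `c`. -/
def HatCell.facets {K : PolygonalComplex ι} : K.HatCell → Set (Sym2 K.HatVertex)
  | .ofFace f =>
      {ε | ∃ i, ε = s(HatVertex.ofFace f i, HatVertex.ofFace f (finRotate (K.face f).n i))}
  | .ofEdge e _ =>
      {ε | ∃ x y : K.HatVertex, ε = s(x, y) ∧ x.owner = y.owner ∧ s(x.base, y.base) = e ∧
        e ∈ K.edgesOf x.owner} ∪
      {ε | ∃ x y : K.HatVertex, ε = s(x, y) ∧ x.owner ≠ y.owner ∧ x.base = y.base ∧ x.base ∈ e ∧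
        e ∈ K.edgesOf x.owner ∧ e ∈ K.edgesOf y.owner}
  | .ofVertex v c _ =>
      {ε | ∃ x y : K.HatVertex, ε = s(x, y) ∧ x.owner ≠ y.owner ∧ x.base = v ∧ y.base = v ∧
        (∃ f ∈ c, x.owner = Sum.inl f) ∧
        ∃ e : Sym2 Plane, v ∈ e ∧ e ∈ K.edgesOf x.owner ∧ e ∈ K.edgesOf y.owner}

/-- The graph that is the 1-skeleton of the Euler transformation. -/
def hatGraph (K : PolygonalComplex ι) : SimpleGraph K.HatVertex :=
  SimpleGraph.fromEdgeSet (⋃ c : K.HatCell, c.facets)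

/-- The straight segment that realizes an edge of the Euler transformation. -/
noncomputable def hatSeg (K : PolygonalComplex ι) (t : ι → ℝ) (ε : Sym2 K.HatVertex) : Set Plane :=
  seg (ε.map (HatVertex.pos t))

/-- The closed region that realizes a polygon of the Euler transformation: the union of its
facets, filled in. -/
noncomputable def HatCell.region {K : PolygonalComplex ι} (t : ι → ℝ) (c : K.HatCell) :
    Set Plane :=
  fill (⋃ ε ∈ c.facets, K.hatSeg t ε)

/-- The facets of the cell form a simple closed polygon in the plane. -/
def HatCell.IsSimpleClosedPolygon {K : PolygonalComplex ι} (t : ι → ℝ) (c : K.HatCell) : Prop :=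
  ∃ (n : ℕ) (w : Fin n → K.HatVertex),
    c.facets = Set.range (fun i => s(w i, w (finRotate n i))) ∧
    IsSimple (⟨fun i => (w i).pos t⟩ : Polygon Plane n)

/-- Two cells meet properly: they are disjoint, or meet in exactly one common vertex, or in
exactly one common edge. -/
def HatCell.MeetProperly {K : PolygonalComplex ι} (t : ι → ℝ) (c d : K.HatCell) : Prop :=
  c.region t ∩ d.region t = ∅ ∨
  (∃ x : K.HatVertex, (∃ ε ∈ c.facets, x ∈ ε) ∧ (∃ ε ∈ d.facets, x ∈ ε) ∧
    c.region t ∩ d.region t = {x.pos t}) ∨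
  (∃ ε ∈ c.facets, ε ∈ d.facets ∧ c.region t ∩ d.region t = K.hatSeg t ε)

end PolygonalComplex

/-- `abcd` is a convex trapezium: a simple closed 4-gon that bounds a convex region and whose
opposite sides `ab` and `dc` are parallel (parallelograms are included). -/
def IsConvexTrapezium (a b c d : Plane) : Prop :=
  IsSimple (⟨![a, b, c, d]⟩ : Polygon Plane 4) ∧
  Convex ℝ (region (⟨![a, b, c, d]⟩ : Polygon Plane 4)) ∧
  ∃ r : ℝ, 0 < r ∧ b - a = r • (c - d)

/-! ### Planar graphs -/

/-- A graph is planar: it can be drawn in the plane with distinct points as vertices and simple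
arcs as edges, such that an arc contains no vertices but its two ends and two arcs
meet only in common ends. -/
def IsPlanar {V : Type*} (G : SimpleGraph V) : Prop :=
  ∃ (p : V → Plane) (γ : G.edgeSet → unitInterval → Plane),
    Function.Injective p ∧
    (∀ e, Continuous (γ e) ∧ Function.Injective (γ e) ∧ s(γ e 0, γ e 1) = e.1.map p) ∧
    (∀ e v, p v ∈ Set.range (γ e) → v ∈ e.1) ∧
    (∀ e e', e ≠ e' → Set.range (γ e) ∩ Set.range (γ e') ⊆ p '' {v | v ∈ e.1 ∧ v ∈ e'.1})

/-- The placement `p` of the vertices is a plane drawing with straight edges: vertices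
are distinct points, an edge contains no vertices but its two ends, and two distinct edges
meet only in common ends. -/
def IsStraightPlaneDrawing {V : Type*} (G : SimpleGraph V) (p : V → Plane) : Prop :=
  Function.Injective p ∧
  (∀ e ∈ G.edgeSet, ∀ v, p v ∈ seg (e.map p) → v ∈ e) ∧
  (∀ e ∈ G.edgeSet, ∀ e' ∈ G.edgeSet, e ≠ e' →
    seg (e.map p) ∩ seg (e'.map p) ⊆ p '' {v | v ∈ e ∧ v ∈ e'})

end EulerTransform

open EulerTransform

namespace EulerTransform

/-! ### Vectors of the plane -/

/-! Let the edges of a polygon `f` move inwards with unit speed up to time `t f`. The core is that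
the moving curve passes through each point of the plane at most once (`InwardMotion.time_unique`).
To see this, consider the total angle under which the curve is seen from a fixed point x. It is a
multiple of 2π and stays constant while the curve avoids x. When an edge runs over x, the point
changes from its left to its right side, and the angle is 2π just before and 0 just after
(`InwardMotion.eventually_of_mem`). Between two consecutive passages it would have to be both 0 and
2π. The same angle shows that later curves stay in the polygon (`mem_fill_zero`) and that the region
enclosed by a later curve avoids the earlier ones (`notMem_fill`). Hence the bands swept by the
edges lie in the polygon, overlap only along bisectors at common ends (`band_inter_band`), and meet
the offset polygon only at height `t f`.

The cells of edges and vertices are made of pieces of bands. Take a flag (polygon, edge, end v of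
it) and write κ for the cotangent of half the interior angle at v. The new edge between the copies
of v on two sides of an inner edge crosses that edge at distance μ = t t' / (t + t') (κ + κ') from
v. Here κ + κ' > 0, because the two polygons do not overlap and have only one edge in common
(`Twin.κ_add_pos`). Since both offset edges have positive length, the crossings near the two ends of
the edge are in the right order (`μ_add_lt`). On an edge that lies on one polygon only, μ = 0 and
the new edge is the bisector. So each band is cut by two segments `half` into pieces `tri` at its
ends and a piece `mid` between. The possible intersections of bands (`band_cases`) yield those of
the pieces (`tri_inter_tri`, `mid_inter_tri`, `mid_inter_mid`). The union of the pieces of a cell is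
star-shaped and contains the facets of the cell, hence also its region
(`fill_subset_of_starConvex`). This gives the plane drawing and (b) and (e). Part (c) holds because
each offset polygon lies in the interior of its original.

The conditions on holes and the outside enter through `not_outer_mate`: consecutive edges of a
polygon never both lie on this polygon only. Otherwise the polygon would be a fan by itself, and its
vertex cell would degenerate to a segment. As complementary polygons are disjoint, a vertex has at
most one copy in them.

For (a), stepping from one polygon to the next around a vertex is injective on finitely many flags,
so the new edges form a cycle. If the fan does not surround the vertex, the cycle is closed by the
copy in the hole or the outside. A connectedness argument in a punctured disc
(`iUnion_mem_nhds_of_twins`) provides the required outer edges. For (d), the two copies of an edge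
have the same direction and lie at different heights. -/

theorem inner_eq (x y : Plane) : inner ℝ x y = x 0 * y 0 + x 1 * y 1 := by
  rw [PiLp.inner_apply]
  simp [Fin.sum_univ_two, mul_comm]

theorem plane_ext {x y : Plane} (h0 : x 0 = y 0) (h1 : x 1 = y 1) : x = y := by
  ext i
  fin_cases i <;> assumption

@[simp] theorem rot_zero_coord (v : Plane) : rot v 0 = -(v 1) := by simp [rot]
@[simp] theorem rot_one_coord (v : Plane) : rot v 1 = v 0 := by simp [rot]

theorem rot_smul (r : ℝ) (v : Plane) : rot (r • v) = r • rot v := by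
  apply plane_ext <;> simp

theorem rot_neg (v : Plane) : rot (-v) = -rot v := by
  apply plane_ext <;> simp

theorem rot_rot (v : Plane) : rot (rot v) = -v := by
  apply plane_ext <;> simp

theorem inner_rot_self (v : Plane) : inner ℝ (rot v) v = 0 := by
  rw [inner_eq]; simp; ring

theorem inner_rot_rot (v w : Plane) : inner ℝ (rot v) (rot w) = inner ℝ v w := by
  simp only [inner_eq, rot_zero_coord, rot_one_coord]; ring

theorem norm_rot (v : Plane) : ‖rot v‖ = ‖v‖ := by
  rw [@norm_eq_sqrt_real_inner _ _ _ (rot v), inner_rot_rot, ← norm_eq_sqrt_real_inner]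

/-- `d` and `n` are orthogonal unit vectors. -/
structure IsFrame (d n : Plane) : Prop where
  dd : inner ℝ d d = 1
  nn : inner ℝ n n = 1
  dn : inner ℝ d n = 0

namespace IsFrame

variable {d n : Plane}

theorem nd (h : IsFrame d n) : inner ℝ n d = 0 := by rw [real_inner_comm]; exact h.dn

theorem neg_left (h : IsFrame d n) : IsFrame (-d) n :=
  ⟨by simpa using h.dd, h.nn, by simpa using h.dn⟩

theorem eq_rot (h : IsFrame d n) : n = rot d ∨ n = -rot d := by
  obtain ⟨h1, h2, h3⟩ := h
  simp only [inner_eq] at h1 h2 h3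
  -- Lagrange's identity: the squared determinant of `d` and `n` is their Gram determinant, so the
  -- determinant is ±1.
  have key : (d 0 * n 1 - d 1 * n 0) ^ 2 = 1 := by
    have : (d 0 * n 1 - d 1 * n 0) ^ 2 = (d 0 * d 0 + d 1 * d 1) * (n 0 * n 0 + n 1 * n 1)
      - (d 0 * n 0 + d 1 * n 1) ^ 2 := by ring
    rw [this, h1, h2, h3]; norm_num
  have e0 : n 0 = -(d 0 * n 1 - d 1 * n 0) * d 1 := by
    linear_combination (-n 0) * h1 + d 0 * h3
  have e1 : n 1 = (d 0 * n 1 - d 1 * n 0) * d 0 := by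
    linear_combination (-n 1) * h1 + d 1 * h3
  rcases mul_self_eq_one_iff.1 ((sq _).symm.trans key) with h | h
  · left; rw [h] at e0 e1
    apply plane_ext <;> simp <;> linarith
  · right; rw [h] at e0 e1
    apply plane_ext <;> simp <;> linarith

theorem expand (h : IsFrame d n) (x : Plane) :
    x = (inner ℝ d x : ℝ) • d + (inner ℝ n x : ℝ) • n := by
  have h1 := h.dd
  rw [inner_eq] at h1
  rcases h.eq_rot with rfl | rfl <;>
  · apply plane_ext <;> simp [inner_eq] <;> ring_nf
    · linear_combination (-x 0) * h1
    · linear_combination (-x 1) * h1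

theorem ext (h : IsFrame d n) {x y : Plane} (h1 : inner ℝ d x = (inner ℝ d y : ℝ))
    (h2 : inner ℝ n x = (inner ℝ n y : ℝ)) : x = y := by
  rw [h.expand x, h.expand y, h1, h2]

end IsFrame

theorem isFrame_rot {d : Plane} (h : ‖d‖ = 1) : IsFrame d (rot d) :=
  ⟨by rw [real_inner_self_eq_norm_sq, h]; norm_num,
   by rw [real_inner_self_eq_norm_sq, norm_rot, h]; norm_num,
   by rw [real_inner_comm]; exact inner_rot_self d⟩

/-! ### Filling a set -/

theorem subset_fill (J : Set Plane) : J ⊆ fill J := subset_union_left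

theorem mem_fill_iff_of_notMem {J : Set Plane} {x : Plane} (hx : x ∉ J) :
    x ∈ fill J ↔ Bornology.IsBounded (connectedComponentIn Jᶜ x) := by
  simp [fill, hx]

/-- Off `J`, membership in `fill J` depends only on the component of the complement, so it is
carried along connected sets that avoid `J`. -/
theorem mem_fill_of_isPreconnected {J S : Set Plane} (hS : IsPreconnected S) (hJ : Disjoint S J)
    {x y : Plane} (hx : x ∈ S) (hy : y ∈ S) (h : x ∈ fill J) : y ∈ fill J := by
  have hxJ : x ∉ J := fun h' => hJ.le_bot ⟨hx, h'⟩
  have hyJ : y ∉ J := fun h' => hJ.le_bot ⟨hy, h'⟩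
  rw [mem_fill_iff_of_notMem hxJ] at h
  rw [mem_fill_iff_of_notMem hyJ]
  have : y ∈ connectedComponentIn Jᶜ x :=
    hS.subset_connectedComponentIn hx (fun z hz hzJ => hJ.le_bot ⟨hz, hzJ⟩) hy
  rwa [← connectedComponentIn_eq this]

/-- The component of a point outside `fill J'` consists of such points, so it avoids `J` as well;
being unbounded, it makes the component in the complement of `J` unbounded. -/
theorem fill_subset_fill {J J' : Set Plane} (h : J ⊆ fill J') : fill J ⊆ fill J' := by
  intro x hx
  by_contra hx'
  have hxJ' : x ∉ J' := fun h' => hx' (subset_fill _ h')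
  have hdis : Disjoint (connectedComponentIn J'ᶜ x) J := by
    rw [Set.disjoint_left]
    intro y hy hyJ
    apply hx'
    refine mem_fill_of_isPreconnected isPreconnected_connectedComponentIn ?_ hy
      (mem_connectedComponentIn hxJ') (h hyJ)
    exact Set.disjoint_left.2 fun z hz => connectedComponentIn_subset _ _ hz
  have hxJ : x ∉ J := fun h' => hx' (h h')
  rw [mem_fill_iff_of_notMem hxJ] at hx
  rw [mem_fill_iff_of_notMem hxJ'] at hx'
  exact hx' (hx.subset (isPreconnected_connectedComponentIn.subset_connectedComponentIn
    (mem_connectedComponentIn hxJ') fun z hz hzJ => hdis.le_bot ⟨hz, hzJ⟩))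

theorem isOpen_fill_diff {J : Set Plane} (hJ : IsClosed J) : IsOpen (fill J \ J) := by
  rw [isOpen_iff_mem_nhds]
  rintro x ⟨hx, hxJ⟩
  have := (hJ.isOpen_compl.connectedComponentIn (x := x)).mem_nhds (mem_connectedComponentIn hxJ)
  filter_upwards [this] with y hy
  refine ⟨?_, connectedComponentIn_subset _ _ hy⟩
  exact mem_fill_of_isPreconnected isPreconnected_connectedComponentIn
    (Set.disjoint_left.2 fun z hz => connectedComponentIn_subset _ _ hz)
    (mem_connectedComponentIn hxJ) hy hx

theorem isClosed_fill {J : Set Plane} (hJ : IsClosed J) : IsClosed (fill J) := by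
  rw [← isOpen_compl_iff, isOpen_iff_mem_nhds]
  intro x hx
  have hxJ : x ∉ J := fun h' => hx (subset_fill _ h')
  have := (hJ.isOpen_compl.connectedComponentIn (x := x)).mem_nhds (mem_connectedComponentIn hxJ)
  filter_upwards [this] with y hy hyf
  exact hx (mem_fill_of_isPreconnected isPreconnected_connectedComponentIn
    (Set.disjoint_left.2 fun z hz => connectedComponentIn_subset _ _ hz)
    hy (mem_connectedComponentIn hxJ) hyf)

/-- From a point outside `S`, the ray pointing away from the centre `v` never enters `S`. It is a
connected unbounded set that avoids `J`. This confines the region of a cell without any knowledge of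
how its facets close up. -/
theorem fill_subset_of_starConvex {J S : Set Plane} {v : Plane} (hS : StarConvex ℝ v S)
    (hv : v ∈ S) (hJ : J ⊆ S) : fill J ⊆ S := by
  intro x hx
  by_contra hxS
  have hxJ : x ∉ J := fun h => hxS (hJ h)
  rw [mem_fill_iff_of_notMem hxJ] at hx
  have hne : x - v ≠ 0 := by
    intro h
    rw [sub_eq_zero] at h
    exact hxS (h ▸ hv)
  set R : Set Plane := (fun r : ℝ => v + r • (x - v)) '' Ici 1 with hR
  have hRc : IsPreconnected R :=
    isPreconnected_Ici.image _ (by fun_prop)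
  have hxR : x ∈ R := ⟨1, by simp, by simp⟩
  have hRJ : R ⊆ Jᶜ := by
    rintro _ ⟨r, hr, rfl⟩ hJr
    have hr1 : (1:ℝ) ≤ r := hr
    have hr0 : 0 < r := by linarith
    have := hS (hJ hJr) (a := 1 - r⁻¹) (b := r⁻¹) (by
      rw [sub_nonneg]; exact inv_le_one_of_one_le₀ hr1) (by positivity) (by ring)
    apply hxS
    convert this using 1
    simp only [smul_add, smul_smul, inv_mul_cancel₀ hr0.ne']
    module
  have hb := hx.subset (hRc.subset_connectedComponentIn hxR hRJ)
  obtain ⟨M, hM⟩ := hb.exists_norm_le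
  have hpos : 0 < ‖x - v‖ := norm_pos_iff.2 hne
  set r : ℝ := max 1 ((M + ‖v‖ + 1) / ‖x - v‖)
  have h1 := hM _ ⟨r, show (1:ℝ) ≤ r from le_max_left _ _, rfl⟩
  have h2 : (M + ‖v‖ + 1) ≤ r * ‖x - v‖ := by
    rw [← div_le_iff₀ hpos]; exact le_max_right _ _
  have h3 : ‖r • (x - v)‖ ≤ ‖v + r • (x - v)‖ + ‖v‖ := by
    calc ‖r • (x - v)‖ = ‖(v + r • (x - v)) - v‖ := by rw [add_sub_cancel_left]
      _ ≤ _ := norm_sub_le _ _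
  rw [norm_smul, Real.norm_of_nonneg (le_trans zero_le_one (le_max_left _ _))] at h3
  linarith

end EulerTransform

namespace EulerTransform

/-! ### Simple closed curves -/

theorem finRotate_ne {n : ℕ} (h : 3 ≤ n) (i : Fin n) : finRotate n i ≠ i := by
  obtain ⟨m, rfl⟩ : ∃ m, n = m + 1 := ⟨n - 1, by omega⟩
  rw [Ne, Fin.ext_iff, coe_finRotate]
  have := i.2
  split_ifs with h'
  · rw [h']; simp only [Fin.val_last]; omega
  · omega

theorem val_finRotate {m : ℕ} (i : Fin (m + 1)) :
    (i.val = m ∧ (finRotate (m + 1) i).val = 0) ∨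
      (i.val ≠ m ∧ (finRotate (m + 1) i).val = i.val + 1) := by
  rw [coe_finRotate]
  by_cases h : i = Fin.last m
  · left; simp [h]
  · right; rw [if_neg h]; exact ⟨fun h' => h (Fin.ext h'), rfl⟩

theorem finRotate_finRotate_ne {n : ℕ} (h : 3 ≤ n) (i : Fin n) :
    finRotate n (finRotate n i) ≠ i := by
  obtain ⟨m, rfl⟩ : ∃ m, n = m + 1 := ⟨n - 1, by omega⟩
  rw [Ne, Fin.ext_iff]
  have h1 := val_finRotate i
  have h2 := val_finRotate (finRotate (m + 1) i)
  omega

theorem seg_mk (a b : Plane) : seg s(a, b) = segment ℝ a b := affineSegment_eq_segment ℝ a b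

theorem edgeSet_eq {n : ℕ} (p : Polygon Plane n) (i : Fin n) :
    p.edgeSet ℝ i = segment ℝ (p i) (p (finRotate n i)) := affineSegment_eq_segment ℝ _ _

namespace IsSimple

variable {n : ℕ} {p : Polygon Plane n}

theorem inj (h : IsSimple p) {i j : Fin n} (e : p i = p j) : i = j := h.2.1 e

theorem ne (h : IsSimple p) (i : Fin n) : p i ≠ p (finRotate n i) :=
  fun e => finRotate_ne h.1 i (h.inj e).symm

theorem eq_of_mem (h : IsSimple p) {i j : Fin n} (hij : i ≠ j) {x : Plane}
    (hi : x ∈ segment ℝ (p i) (p (finRotate n i)))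
    (hj : x ∈ segment ℝ (p j) (p (finRotate n j))) :
    (j = finRotate n i ∧ x = p j) ∨ (i = finRotate n j ∧ x = p i) := by
  rw [← edgeSet_eq] at hi hj
  by_cases h1 : j = finRotate n i
  · left
    refine ⟨h1, ?_⟩
    have : x ∈ ({p (finRotate n i)} : Set Plane) := by
      rw [← h.2.2.1 i]; exact ⟨hi, h1 ▸ hj⟩
    rw [h1]; exact this
  by_cases h2 : i = finRotate n j
  · right
    refine ⟨h2, ?_⟩
    have : x ∈ ({p (finRotate n j)} : Set Plane) := by
      rw [← h.2.2.1 j]; exact ⟨hj, h2 ▸ hi⟩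
    rw [h2]; exact this
  exact absurd hj (Set.disjoint_left.1 (h.2.2.2 i j hij.symm h1 h2) hi)

theorem eq_of_vertex_mem (h : IsSimple p) {j k : Fin n}
    (hj : p k ∈ segment ℝ (p j) (p (finRotate n j))) : j = k ∨ finRotate n j = k := by
  by_cases hjk : j = k
  · exact Or.inl hjk
  · rcases h.eq_of_mem hjk hj (left_mem_segment _ _ _) with h1 | h1
    · exact Or.inr h1.1.symm
    · exact Or.inl (h.inj h1.2).symm

theorem notMem_of_openSegment (h : IsSimple p) {i j : Fin n} (hij : i ≠ j) {x : Plane}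
    (hi : x ∈ openSegment ℝ (p i) (p (finRotate n i))) :
    x ∉ segment ℝ (p j) (p (finRotate n j)) := by
  intro hj
  have hend : x ≠ p i ∧ x ≠ p (finRotate n i) := by
    constructor
    · rintro rfl
      exact h.ne i (left_mem_openSegment_iff.1 hi)
    · rintro rfl
      exact h.ne i (right_mem_openSegment_iff.1 hi)
  rcases h.eq_of_mem hij (openSegment_subset_segment _ _ _ hi) hj with h1 | h1
  · exact hend.2 (h1.1 ▸ h1.2)
  · exact hend.1 h1.2

/-- Consecutive edges do not point in opposite directions. -/
theorem zero_notMem_segment (h : IsSimple p) (i : Fin n) :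
    (0 : Plane) ∉ segment ℝ (p (finRotate n i) - p i)
      (p (finRotate n (finRotate n i)) - p (finRotate n i)) := by
  set k := finRotate n i with hk
  set e : Plane := p k - p i with he
  set e' : Plane := p (finRotate n k) - p k with he'
  have hik : i ≠ k := (finRotate_ne h.1 i).symm
  have he0 : e ≠ 0 := sub_ne_zero.2 (h.ne i).symm
  have he'0 : e' ≠ 0 := sub_ne_zero.2 (h.ne k).symm
  rintro ⟨α, β, hα, hβ, hαβ, h0⟩
  -- If α e + β e' = 0, then p k + β e' = p k − α e lies on both edges, so it is their common
  -- vertex.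
  have hmk : p k + β • e' ∈ segment ℝ (p k) (p (finRotate n k)) := by
    refine ⟨1 - β, β, by linarith, hβ, by ring, ?_⟩
    rw [he']; module
  have hmi : p k + β • e' ∈ segment ℝ (p i) (p (finRotate n i)) := by
    refine ⟨α, 1 - α, hα, by linarith, by ring, ?_⟩
    rw [← sub_eq_zero, ← neg_eq_zero, ← h0, ← hk, he]
    module
  have hβ0 : β = 0 := by
    rcases h.eq_of_mem hik hmi hmk with h1 | h1
    · have h3 : β • e' = 0 := by simpa using h1.2
      exact (smul_eq_zero.1 h3).resolve_right he'0
    · exact absurd h1.1.symm (finRotate_finRotate_ne h.1 i)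
  have hα1 : α = 1 := by linarith
  rw [hβ0, hα1, one_smul, zero_smul, add_zero] at h0
  exact he0 h0

end IsSimple

theorem boundary_eq {n : ℕ} (p : Polygon Plane n) :
    p.boundary ℝ = ⋃ i, segment ℝ (p i) (p (finRotate n i)) := by
  simp only [Polygon.boundary, edgeSet_eq]

theorem mem_boundary {n : ℕ} {p : Polygon Plane n} {x : Plane} :
    x ∈ p.boundary ℝ ↔ ∃ i, x ∈ segment ℝ (p i) (p (finRotate n i)) := by
  rw [boundary_eq, mem_iUnion]

theorem isCompact_segment (a b : Plane) : IsCompact (segment ℝ a b) := by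
  rw [segment_eq_image_lineMap]
  exact isCompact_Icc.image (by fun_prop)

theorem isClosed_segment (a b : Plane) : IsClosed (segment ℝ a b) := (isCompact_segment a b).isClosed

theorem isClosed_boundary {n : ℕ} (p : Polygon Plane n) : IsClosed (p.boundary ℝ) := by
  rw [boundary_eq]
  exact isClosed_iUnion_of_finite fun i => isClosed_segment _ _

/-! ### The angle under which a segment is seen -/

/-- The plane as the complex plane. -/
def toC (x : Plane) : ℂ := ⟨x 0, x 1⟩

theorem toC_sub (x y : Plane) : toC (x - y) = toC x - toC y := by
  apply Complex.ext <;> simp [toC]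

theorem toC_smul (r : ℝ) (x : Plane) : toC (r • x) = r * toC x := by
  apply Complex.ext <;> simp [toC]

theorem toC_eq_zero {x : Plane} : toC x = 0 ↔ x = 0 := by
  constructor
  · intro h
    apply plane_ext
    · exact congrArg Complex.re h
    · exact congrArg Complex.im h
  · rintro rfl
    apply Complex.ext <;> simp [toC]

theorem continuous_toC : Continuous toC := by
  have : toC = fun x : Plane => (x 0 : ℂ) + (x 1 : ℂ) * Complex.I := by
    funext x
    apply Complex.ext <;> simp [toC]
  rw [this]
  fun_prop

/-- The oriented angle, in `(-π, π]`, under which the segment from `a` to `b` is seen from `x`. -/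
noncomputable def ang (a b x : Plane) : ℝ := Complex.arg (toC (b - x) / toC (a - x))

/-- The quotient is a real number ≤ 0 only if `a` and `b` lie in opposite directions from `x`, or `x
= b`; the case `x = a` is excluded beforehand. -/
theorem ratio_mem_slitPlane {a b x : Plane} (h : x ∉ segment ℝ a b) :
    toC (b - x) / toC (a - x) ∈ Complex.slitPlane := by
  by_contra hn
  rw [Complex.mem_slitPlane_iff] at hn
  push Not at hn
  have hax : toC (a - x) ≠ 0 := by
    rw [Ne, toC_eq_zero, sub_eq_zero]
    rintro rfl
    exact h (left_mem_segment _ _ _)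
  set r := -(toC (b - x) / toC (a - x)).re with hr
  have hr0 : 0 ≤ r := by linarith [hn.1]
  have hz : toC (b - x) / toC (a - x) = ((-r : ℝ) : ℂ) := by
    apply Complex.ext
    · simp [hr]
    · simpa using hn.2
  rw [div_eq_iff hax, ← toC_smul, ← sub_eq_zero, ← toC_sub, toC_eq_zero] at hz
  apply h
  have h1 : 0 < 1 + r := by linarith
  refine ⟨r / (1 + r), 1 / (1 + r), by positivity, by positivity, by field_simp; ring, ?_⟩
  have : (1 + r) • x = r • a + b := by
    rw [← sub_eq_zero, ← neg_eq_zero, ← hz]; module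
  calc (r / (1 + r)) • a + (1 / (1 + r)) • b = (1 / (1 + r)) • (r • a + b) := by module
    _ = x := by rw [← this, smul_smul, one_div_mul_cancel h1.ne', one_smul]

theorem ratio_im (a b x : Plane) : (toC (b - x) / toC (a - x)).im =
    inner ℝ (rot (b - a)) (x - a) / Complex.normSq (toC (a - x)) := by
  rw [Complex.div_im, inner_eq, ← sub_div]
  congr 1
  simp [toC]; ring

theorem ang_mem_Ioo_of_left {a b x : Plane} (h : 0 < inner ℝ (rot (b - a)) (x - a)) :
    ang a b x ∈ Ioo 0 Real.pi := by
  have hax : toC (a - x) ≠ 0 := by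
    rw [Ne, toC_eq_zero, sub_eq_zero]
    rintro rfl
    simp at h
  have him : 0 < (toC (b - x) / toC (a - x)).im := by
    rw [ratio_im]
    exact div_pos h (Complex.normSq_pos.2 hax)
  refine ⟨lt_of_le_of_ne (Complex.arg_nonneg_iff.2 him.le) ?_,
    lt_of_le_of_ne (Complex.arg_le_pi _) ?_⟩
  · intro h0
    exact him.ne' (Complex.arg_eq_zero_iff.1 h0.symm).2
  · intro h0
    exact him.ne' (Complex.arg_eq_pi_iff.1 h0).2

theorem ang_mem_Ioo_of_right {a b x : Plane} (h : inner ℝ (rot (b - a)) (x - a) < 0) :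
    ang a b x ∈ Ioo (-Real.pi) 0 := by
  have hax : toC (a - x) ≠ 0 := by
    rw [Ne, toC_eq_zero, sub_eq_zero]
    rintro rfl
    simp at h
  refine ⟨Complex.neg_pi_lt_arg _, Complex.arg_neg_iff.2 ?_⟩
  rw [ratio_im]
  exact div_neg_of_neg_of_pos h (Complex.normSq_pos.2 hax)

theorem ang_eq_pi {a b x : Plane} (hab : a ≠ b) (h : x ∈ openSegment ℝ a b) :
    ang a b x = Real.pi := by
  obtain ⟨r, s, hr, hs, hrs, rfl⟩ := h
  have h1 : b - (r • a + s • b) = r • (b - a) := by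
    rw [← eq_sub_iff_add_eq] at hrs; subst hrs; module
  have h2 : a - (r • a + s • b) = (-s) • (b - a) := by
    rw [← eq_sub_iff_add_eq] at hrs; subst hrs; module
  have h3 : toC (b - a) ≠ 0 := by
    rw [Ne, toC_eq_zero, sub_eq_zero]; exact hab.symm
  rw [ang, h1, h2, toC_smul, toC_smul, mul_div_mul_right _ _ h3, ← Complex.ofReal_div]
  exact Complex.arg_ofReal_of_neg (div_neg_of_pos_of_neg hr (by linarith))

theorem coe_ang {a b x : Plane} (ha : x ≠ a) (hb : x ≠ b) :
    (ang a b x : Real.Angle) = Complex.arg (toC (b - x)) - Complex.arg (toC (a - x)) := by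
  apply Complex.arg_div_coe_angle <;> rw [Ne, toC_eq_zero, sub_eq_zero]
  exacts [hb.symm, ha.symm]

/-- Off the segment the quotient stays away from the cut of `arg`. Both ends and the viewpoint may
vary, since later either the curve or the observer moves. -/
theorem tendsto_ang {X : Type*} {l : Filter X} {A B Y : X → Plane} {a b x : Plane}
    (hA : Tendsto A l (𝓝 a)) (hB : Tendsto B l (𝓝 b)) (hY : Tendsto Y l (𝓝 x))
    (h : x ∉ segment ℝ a b) : Tendsto (fun z => ang (A z) (B z) (Y z)) l (𝓝 (ang a b x)) := by
  have hax : toC (a - x) ≠ 0 := by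
    rw [Ne, toC_eq_zero, sub_eq_zero]
    rintro rfl
    exact h (left_mem_segment _ _ _)
  refine (Complex.continuousAt_arg (ratio_mem_slitPlane h)).tendsto.comp ?_
  exact ((continuous_toC.tendsto _).comp (hB.sub hY)).div
    ((continuous_toC.tendsto _).comp (hA.sub hY)) hax

/-! ### The winding angle of a closed polygonal curve -/

/-- The total angle by which a closed polygonal curve turns around `x`. -/
noncomputable def winding {n : ℕ} (p : Fin n → Plane) (x : Plane) : ℝ :=
  ∑ j, ang (p j) (p (finRotate n j)) x

/-- Modulo 2π each angle is a difference of two arguments, and these differences cancel around the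
closed curve. -/
theorem coe_winding {n : ℕ} {p : Fin n → Plane} {x : Plane} (h : ∀ j, x ≠ p j) :
    (winding p x : Real.Angle) = 0 := by
  have : (winding p x : Real.Angle) = ∑ j, (ang (p j) (p (finRotate n j)) x : Real.Angle) :=
    map_sum Real.Angle.coeHom _ _
  rw [this, Finset.sum_congr rfl fun j _ => coe_ang (h j) (h _), Finset.sum_sub_distrib,
    Equiv.sum_comp (finRotate n) fun j => ((Complex.arg (toC (p j - x)) : ℝ) : Real.Angle), sub_self]

/-- Real numbers that agree modulo `2π` and differ by less than `2π` are equal. -/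
theorem eq_of_coe_angle_eq {a b : ℝ} (h : (a : Real.Angle) = b) (h1 : |a - b| < 2 * Real.pi) :
    a = b := by
  obtain ⟨k, hk⟩ := Real.Angle.angle_eq_iff_two_pi_dvd_sub.1 h
  have hp := Real.pi_pos
  rw [hk, abs_mul, abs_of_pos (by positivity)] at h1
  have hk1 : |(k : ℝ)| < 1 := by
    by_contra hc
    push Not at hc
    nlinarith
  have : k = 0 := by
    rw [← Int.cast_abs] at hk1
    exact Int.abs_lt_one_iff.1 (by exact_mod_cast hk1)
  rw [this] at hk
  simp at hk
  linarith

/-- A continuous function with values in one class modulo `2π` is constant on connected sets. -/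
theorem eq_of_isPreconnected {X : Type*} [TopologicalSpace X] {S : Set X} (hS : IsPreconnected S)
    {F : X → ℝ} (hF : ContinuousOn F S) {θ : Real.Angle} (hθ : ∀ x ∈ S, (F x : Real.Angle) = θ)
    {x y : X} (hx : x ∈ S) (hy : y ∈ S) : F x = F y := by
  have hp := Real.pi_pos
  wlog hxy : F x ≤ F y generalizing x y
  · exact (this hy hx (le_of_not_ge hxy)).symm
  by_contra hne
  have hlt : F x < F y := lt_of_le_of_ne hxy hne
  -- `c` is a value of `F` that exceeds `F x` by at most π; being congruent to `F x` modulo 2π, it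
  -- would have to equal it.
  set c := min (F y) (F x + Real.pi) with hc
  have hcm : c ∈ Icc (F x) (F y) := ⟨le_min hxy (by linarith), min_le_left _ _⟩
  obtain ⟨z, hz, hzc⟩ := hS.intermediate_value hx hy hF hcm
  have h1 : F z = F x := by
    apply eq_of_coe_angle_eq ((hθ z hz).trans (hθ x hx).symm)
    rw [hzc, abs_of_nonneg (by linarith [hcm.1])]
    linarith [min_le_right (F y) (F x + Real.pi)]
  have : F x < c := lt_min hlt (by linarith)
  linarith

/-- The winding angle is constant on the unbounded component of `x`, and it tends to 0 at infinity
because every edge is then seen under a vanishing angle. -/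
theorem winding_eq_zero_of_notMem_fill {n : ℕ} {p : Polygon Plane n} {x : Plane}
    (hx : x ∉ fill (p.boundary ℝ)) : winding p.vertices x = 0 := by
  have hxJ : x ∉ p.boundary ℝ := fun h => hx (subset_fill _ h)
  rw [mem_fill_iff_of_notMem hxJ] at hx
  set U := connectedComponentIn (p.boundary ℝ)ᶜ x
  have hU : ∀ y ∈ U, ∀ j, y ∉ segment ℝ (p j) (p (finRotate n j)) := fun y hy j hj =>
    connectedComponentIn_subset _ _ hy (mem_boundary.2 ⟨j, hj⟩)
  have hcont : ContinuousOn (winding p.vertices) U := by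
    intro y hy
    refine (tendsto_finsetSum _ fun j _ => ?_).mono_left nhdsWithin_le_nhds
    exact tendsto_ang tendsto_const_nhds tendsto_const_nhds tendsto_id (hU y hy j)
  have hang : ∀ y ∈ U, (winding p.vertices y : Real.Angle) = 0 := fun y hy =>
    coe_winding fun j hj => hU y hy j (hj ▸ left_mem_segment _ _ _)
  have hlim : Tendsto (winding p.vertices) (Bornology.cobounded Plane) (𝓝 0) := by
    have : (0 : ℝ) = ∑ j : Fin n, (0 : ℝ) := by simp
    rw [this]
    refine tendsto_finsetSum _ fun j _ => ?_
    have hre : Tendsto (fun y => toC (p (finRotate n j) - y) / toC (p j - y))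
        (Bornology.cobounded Plane) (𝓝 1) := by
      have hinf : Tendsto (fun y => toC (p j - y)) (Bornology.cobounded Plane)
          (Bornology.cobounded ℂ) := by
        rw [← tendsto_norm_atTop_iff_cobounded]
        have hnorm : ∀ y, ‖toC y‖ = ‖y‖ := by
          intro y
          rw [Complex.norm_def, Complex.normSq_apply, EuclideanSpace.norm_eq, Fin.sum_univ_two]
          simp [toC, sq]
        simp only [hnorm]
        refine tendsto_atTop_mono (f := fun y : Plane => ‖y‖ - ‖p j‖) (fun y => ?_)
          (tendsto_atTop_add_const_right _ _ tendsto_norm_cobounded_atTop)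
        rw [norm_sub_rev]
        exact norm_sub_norm_le _ _
      -- For an edge from a to b the quotient is 1 + (b − a)/(a − y).
      have h1 : Tendsto (fun y => 1 + toC (p (finRotate n j) - p j) * (toC (p j - y))⁻¹)
          (Bornology.cobounded Plane) (𝓝 (1 + toC (p (finRotate n j) - p j) * 0)) :=
        tendsto_const_nhds.add (tendsto_const_nhds.mul (tendsto_inv₀_cobounded.comp hinf))
      rw [mul_zero, add_zero] at h1
      refine h1.congr' ?_
      filter_upwards [hinf.eventually (Bornology.eventually_ne_cobounded 0)] with y hy
      rw [eq_div_iff hy, add_mul, mul_assoc, inv_mul_cancel₀ hy, toC_sub, toC_sub, toC_sub]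
      ring
    have h2 := (Complex.continuousAt_arg (x := 1) (by simp)).tendsto.comp hre
    rw [Complex.arg_one] at h2
    exact h2
  have hev : ∀ᶠ y in Bornology.cobounded Plane, |winding p.vertices y| < 2 * Real.pi := by
    have := hlim.abs
    rw [abs_zero] at this
    exact this.eventually (gt_mem_nhds (by positivity))
  have hfreq : ∃ y ∈ U, |winding p.vertices y| < 2 * Real.pi := by
    by_contra hcon
    push Not at hcon
    apply hx
    rw [Bornology.isBounded_def]
    filter_upwards [hev] with y hy hyU
    linarith [hcon y hyU]
  obtain ⟨y, hyU, hy⟩ := hfreq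
  rw [eq_of_isPreconnected isPreconnected_connectedComponentIn hcont hang
    (mem_connectedComponentIn hxJ) hyU]
  exact eq_of_coe_angle_eq (by rw [hang y hyU, Real.Angle.coe_zero]) (by simpa using hy)

end EulerTransform

namespace EulerTransform

/-! ### Inward motions of a simple closed curve -/

/-- The set is the projection of a closed set along the compact unit interval. -/
theorem isClosed_setOf_mem_segment {X : Type*} [TopologicalSpace X] {A B : X → Plane}
    (hA : Continuous A) (hB : Continuous B) (x : Plane) :
    IsClosed {s | x ∈ segment ℝ (A s) (B s)} := by
  have : {s | x ∈ segment ℝ (A s) (B s)} = Prod.snd ''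
      {z : unitInterval × X | AffineMap.lineMap (A z.2) (B z.2) (z.1 : ℝ) = x} := by
    ext s
    simp only [segment_eq_image_lineMap, mem_ofPred_eq, mem_image]
    constructor
    · rintro ⟨r, hr, h⟩
      exact ⟨(⟨r, hr⟩, s), h, rfl⟩
    · rintro ⟨⟨r, s'⟩, h, rfl⟩
      exact ⟨r, r.2, h⟩
  rw [this]
  refine isClosedMap_snd_of_compactSpace _ (isClosed_eq ?_ continuous_const)
  simp only [AffineMap.lineMap_apply_module]
  fun_prop

/-- A moving closed polygonal curve that stays simple, whose edges move parallel to themselves to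
the left, and that has the exterior on the right of its edges at the beginning. -/
structure InwardMotion {n : ℕ} (p : ℝ → Fin n → Plane) (T : ℝ) : Prop where
  cont : ∀ i, Continuous fun s => p s i
  simple : ∀ s ∈ Icc 0 T, IsSimple ⟨p s⟩
  left : ∀ i, ∀ s ∈ Icc 0 T, ∀ s₀ ∈ Icc 0 T, ∀ x ∈ segment ℝ (p s₀ i) (p s₀ (finRotate n i)),
    s < s₀ → 0 < (inner ℝ (rot (p s (finRotate n i) - p s i)) (x - p s i) : ℝ)
  right : ∀ i, ∀ s ∈ Icc 0 T, ∀ s₀ ∈ Icc 0 T, ∀ x ∈ segment ℝ (p s₀ i) (p s₀ (finRotate n i)),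
    s₀ < s → (inner ℝ (rot (p s (finRotate n i) - p s i)) (x - p s i) : ℝ) < 0
  outer : ∀ i, ∀ x ∈ openSegment ℝ (p 0 i) (p 0 (finRotate n i)),
    ∃ᶠ y in 𝓝 x, y ∉ fill ((⟨p 0⟩ : Polygon Plane n).boundary ℝ) ∧
      (inner ℝ (rot (p 0 (finRotate n i) - p 0 i)) (y - p 0 i) : ℝ) < 0

namespace InwardMotion

variable {n : ℕ} {p : ℝ → Fin n → Plane} {T : ℝ}

theorem notMem_of_openSegment (h : InwardMotion p T) {s : ℝ} (hs : s ∈ Icc 0 T) {i j : Fin n}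
    (hij : i ≠ j) {x : Plane} (hx : x ∈ openSegment ℝ (p s i) (p s (finRotate n i))) :
    x ∉ segment ℝ (p s j) (p s (finRotate n j)) :=
  (h.simple s hs).notMem_of_openSegment hij hx

theorem ne_vertex_of_openSegment (h : InwardMotion p T) {s : ℝ} (hs : s ∈ Icc 0 T) {i : Fin n}
    {x : Plane} (hx : x ∈ openSegment ℝ (p s i) (p s (finRotate n i))) (j : Fin n) : x ≠ p s j := by
  rintro rfl
  by_cases hij : i = j
  · subst hij
    exact (h.simple s hs).ne _ (left_mem_openSegment_iff.1 hx)
  · exact h.notMem_of_openSegment hs hij hx (left_mem_segment _ _ _)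

/-- The total angle is a multiple of 2π, and the edge through `x` itself is seen under the angle π.
-/
theorem coe_sum_ang_edge (h : InwardMotion p T) {s : ℝ} (hs : s ∈ Icc 0 T) {i : Fin n}
    {x : Plane} (hx : x ∈ openSegment ℝ (p s i) (p s (finRotate n i))) :
    ((∑ j ∈ Finset.univ.erase i, ang (p s j) (p s (finRotate n j)) x : ℝ) : Real.Angle)
      = Real.pi := by
  have h1 := coe_winding (h.ne_vertex_of_openSegment hs hx)
  rw [winding, ← Finset.add_sum_erase _ _ (Finset.mem_univ i),
    ang_eq_pi ((h.simple s hs).ne i) hx, Real.Angle.coe_add] at h1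
  rw [← neg_eq_of_add_eq_zero_right h1, Real.Angle.neg_coe_pi]

/-- The angle of the other edges is congruent to π modulo 2π and continuous in the time and the
position on the edge, hence constant. It is evaluated at time 0 in the midpoint: exterior points
nearby on the right have total angle 0 and see the edge under an angle in (−π, 0), so the limit lies
in [0, π]. -/
theorem sum_ang_edge (h : InwardMotion p T) {s : ℝ} (hs : s ∈ Icc 0 T) {i : Fin n}
    {x : Plane} (hx : x ∈ openSegment ℝ (p s i) (p s (finRotate n i))) :
    ∑ j ∈ Finset.univ.erase i, ang (p s j) (p s (finRotate n j)) x = Real.pi := by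
  have hpi := Real.pi_pos
  have h0 : (0 : ℝ) ∈ Icc 0 T := ⟨le_rfl, hs.1.trans hs.2⟩
  set F : ℝ × ℝ → ℝ := fun z => ∑ j ∈ Finset.univ.erase i, ang (p z.1 j) (p z.1 (finRotate n j))
    (AffineMap.lineMap (p z.1 i) (p z.1 (finRotate n i)) z.2) with hF
  have hmem : ∀ z ∈ Icc 0 T ×ˢ Ioo (0 : ℝ) 1,
      AffineMap.lineMap (p z.1 i) (p z.1 (finRotate n i)) z.2
        ∈ openSegment ℝ (p z.1 i) (p z.1 (finRotate n i)) := by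
    rintro ⟨s, r⟩ ⟨_, hr⟩
    rw [openSegment_eq_image_lineMap]
    exact ⟨r, hr, rfl⟩
  have hcont : ContinuousOn F (Icc 0 T ×ˢ Ioo (0 : ℝ) 1) := by
    intro z hz
    refine (tendsto_finsetSum _ fun j hj => ?_).mono_left nhdsWithin_le_nhds
    refine tendsto_ang (((h.cont _).comp continuous_fst).tendsto z)
      (((h.cont _).comp continuous_fst).tendsto z) (Continuous.tendsto ?_ z)
      (h.notMem_of_openSegment hz.1 (Finset.ne_of_mem_erase hj).symm (hmem z hz))
    have h1 := h.cont i
    have h2 := h.cont (finRotate n i)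
    simp only [AffineMap.lineMap_apply_module]
    fun_prop
  have hpre : IsPreconnected (Icc 0 T ×ˢ Ioo (0 : ℝ) 1) := isPreconnected_Icc.prod isPreconnected_Ioo
  have hang : ∀ z ∈ Icc 0 T ×ˢ Ioo (0 : ℝ) 1, (F z : Real.Angle) = Real.pi := fun z hz =>
    h.coe_sum_ang_edge hz.1 (hmem z hz)
  obtain ⟨r, hr, hrx⟩ : ∃ r ∈ Ioo (0 : ℝ) 1,
      AffineMap.lineMap (p s i) (p s (finRotate n i)) r = x := by
    rw [openSegment_eq_image_lineMap] at hx
    exact hx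
  have hz : ((s, r) : ℝ × ℝ) ∈ Icc 0 T ×ˢ Ioo (0 : ℝ) 1 := ⟨hs, hr⟩
  have hz0 : ((0, 1 / 2) : ℝ × ℝ) ∈ Icc 0 T ×ˢ Ioo (0 : ℝ) 1 := ⟨h0, by norm_num, by norm_num⟩
  have hFx : F (s, r) = ∑ j ∈ Finset.univ.erase i, ang (p s j) (p s (finRotate n j)) x := by
    simp only [hF, hrx]
  rw [← hFx, eq_of_isPreconnected hpre hcont hang hz hz0]
  set x₀ : Plane := AffineMap.lineMap (p 0 i) (p 0 (finRotate n i)) (1 / 2 : ℝ) with hx₀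
  have hx₀m := hmem _ hz0
  have hlim : Tendsto (fun y => ∑ j ∈ Finset.univ.erase i, ang (p 0 j) (p 0 (finRotate n j)) y)
      (𝓝 x₀) (𝓝 (F (0, 1 / 2))) := by
    refine tendsto_finsetSum _ fun j hj => ?_
    exact tendsto_ang tendsto_const_nhds tendsto_const_nhds tendsto_id
      (h.notMem_of_openSegment h0 (Finset.ne_of_mem_erase hj).symm hx₀m)
  have hfr := h.outer i x₀ hx₀m
  have hIcc : F (0, 1 / 2) ∈ Icc 0 Real.pi := by
    refine isClosed_Icc.mem_of_frequently_of_tendsto (hfr.mono ?_) hlim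
    rintro y ⟨hy, hyr⟩
    have h1 : winding (p 0) y = 0 := winding_eq_zero_of_notMem_fill (p := ⟨p 0⟩) hy
    rw [winding, ← Finset.add_sum_erase _ _ (Finset.mem_univ i)] at h1
    have h2 := ang_mem_Ioo_of_right hyr
    constructor <;> linarith [h2.1, h2.2]
  refine eq_of_coe_angle_eq (hang _ hz0) ?_
  rw [abs_lt]
  constructor <;> linarith [hIcc.1, hIcc.2]

/-- Approach the vertex along its second edge. There all other edges together are seen under π, and
the first edge under an angle that tends to one in (−π, π), because the curve does not fold back.
The difference is the angle of the remaining edges. -/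
theorem sum_ang_vertex (h : InwardMotion p T) {s : ℝ} (hs : s ∈ Icc 0 T) (i : Fin n) :
    ∑ j ∈ (Finset.univ.erase (finRotate n i)).erase i,
      ang (p s j) (p s (finRotate n j)) (p s (finRotate n i)) ∈ Ioo 0 (2 * Real.pi) := by
  have hpi := Real.pi_pos
  have hsim := h.simple s hs
  set k := finRotate n i with hk
  have hik : i ≠ k := (finRotate_ne hsim.1 i).symm
  set e : Plane := p s k - p s i with he
  set e' : Plane := p s (finRotate n k) - p s k with he'
  have hslit : (0 : Plane) ∉ segment ℝ e e' := hsim.zero_notMem_segment i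
  set S := (Finset.univ.erase k).erase i with hS
  have hline : Tendsto (fun r : ℝ => p s k + r • e') (𝓝[>] 0) (𝓝 (p s k)) := by
    have : Tendsto (fun r : ℝ => p s k + r • e') (𝓝 0) (𝓝 (p s k + (0:ℝ) • e')) :=
      Continuous.tendsto (by fun_prop) 0
    rw [zero_smul, add_zero] at this
    exact this.mono_left nhdsWithin_le_nhds
  have hlimS : Tendsto (fun r : ℝ => ∑ j ∈ S, ang (p s j) (p s (finRotate n j)) (p s k + r • e'))
      (𝓝[>] 0) (𝓝 (∑ j ∈ S, ang (p s j) (p s (finRotate n j)) (p s k))) := by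
    refine tendsto_finsetSum _ fun j hj => ?_
    refine tendsto_ang tendsto_const_nhds tendsto_const_nhds hline ?_
    intro hm
    rcases hsim.eq_of_vertex_mem hm with h1 | h1
    · exact (Finset.ne_of_mem_erase (Finset.mem_of_mem_erase hj)) h1
    · exact Finset.ne_of_mem_erase hj ((finRotate n).injective (h1.trans hk))
  have hlima : Tendsto (fun r : ℝ => ang (p s i) (p s k) (p s k + r • e')) (𝓝[>] 0)
      (𝓝 (ang e e' 0)) := by
    have h1 : Tendsto (fun r : ℝ => ang (e + r • e') e' 0) (𝓝[>] 0) (𝓝 (ang e e' 0)) := by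
      refine tendsto_ang ?_ tendsto_const_nhds tendsto_const_nhds hslit
      have : Tendsto (fun r : ℝ => e + r • e') (𝓝 0) (𝓝 (e + (0:ℝ) • e')) :=
        Continuous.tendsto (by fun_prop) 0
      rw [zero_smul, add_zero] at this
      exact this.mono_left nhdsWithin_le_nhds
    refine h1.congr' ?_
    filter_upwards [self_mem_nhdsWithin] with r hr
    have hr : 0 < r := hr
    -- From this point the ends of the first edge lie in the directions −(e + r e') and −e', and
    -- `arg` ignores the positive factor r.
    have e1 : p s k - (p s k + r • e') = (-r) • e' := by module
    have e2 : p s i - (p s k + r • e') = (-1 : ℝ) • (e + r • e') := by rw [he]; module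
    rw [ang, ang, e1, e2, toC_smul, toC_smul, sub_zero, sub_zero]
    have : ((-r : ℝ) : ℂ) * toC e' / (((-1 : ℝ) : ℂ) * toC (e + r • e')) =
        (r : ℂ) * (toC e' / toC (e + r • e')) := by
      push_cast
      rw [neg_one_mul, neg_mul, neg_div_neg_eq, mul_div_assoc]
    rw [this, Complex.arg_real_mul _ hr]
  have hsum := hlima.add hlimS
  have hconst : Tendsto (fun r : ℝ => ang (p s i) (p s k) (p s k + r • e') +
      ∑ j ∈ S, ang (p s j) (p s (finRotate n j)) (p s k + r • e')) (𝓝[>] 0) (𝓝 Real.pi) := by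
    refine tendsto_const_nhds.congr' ?_
    filter_upwards [Ioo_mem_nhdsGT (zero_lt_one' ℝ)] with r hr
    have hx : p s k + r • e' ∈ openSegment ℝ (p s k) (p s (finRotate n k)) := by
      refine ⟨1 - r, r, by linarith [hr.2], hr.1, by ring, ?_⟩
      rw [he']; module
    rw [← h.sum_ang_edge hs hx, ← Finset.add_sum_erase _ _ (Finset.mem_erase.2 ⟨hik, Finset.mem_univ i⟩)]
  have heq := tendsto_nhds_unique hsum hconst
  have harg : ang e e' 0 ∈ Ioo (-Real.pi) Real.pi := by
    refine ⟨Complex.neg_pi_lt_arg _, lt_of_le_of_ne (Complex.arg_le_pi _) ?_⟩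
    exact (Complex.mem_slitPlane_iff_arg.1 (ratio_mem_slitPlane hslit)).1
  constructor <;> linarith [harg.1, harg.2]

/-- The edges that contain a given point of the curve, and the angle under which the remaining ones
are seen. -/
theorem exists_edges (h : InwardMotion p T) {s : ℝ} (hs : s ∈ Icc 0 T) {x : Plane} {i₀ : Fin n}
    (hx : x ∈ segment ℝ (p s i₀) (p s (finRotate n i₀))) :
    ∃ I : Finset (Fin n), I.Nonempty ∧ I.card ≤ 2 ∧
      (∀ j, j ∈ I ↔ x ∈ segment ℝ (p s j) (p s (finRotate n j))) ∧
      ∑ j ∈ Finset.univ \ I, ang (p s j) (p s (finRotate n j)) x ∈ Ioo 0 (2 * Real.pi) := by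
  have hpi := Real.pi_pos
  have hsim := h.simple s hs
  have key : ∀ i, x = p s (finRotate n i) → ∃ I : Finset (Fin n), I.Nonempty ∧ I.card ≤ 2 ∧
      (∀ j, j ∈ I ↔ x ∈ segment ℝ (p s j) (p s (finRotate n j))) ∧
      ∑ j ∈ Finset.univ \ I, ang (p s j) (p s (finRotate n j)) x ∈ Ioo 0 (2 * Real.pi) := by
    rintro i rfl
    refine ⟨{i, finRotate n i}, by simp, Finset.card_le_two, fun j => ?_, ?_⟩
    · simp only [Finset.mem_insert, Finset.mem_singleton]
      constructor
      · rintro (rfl | rfl)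
        · exact right_mem_segment _ _ _
        · exact left_mem_segment _ _ _
      · intro hj
        rcases hsim.eq_of_vertex_mem hj with h1 | h1
        · exact Or.inr h1
        · exact Or.inl ((finRotate n).injective h1)
    · convert h.sum_ang_vertex hs i using 2
      ext j
      simp
  rw [segment_eq_image_lineMap] at hx
  obtain ⟨r, hr, rfl⟩ := hx
  rcases eq_or_lt_of_le hr.1 with rfl | hr0
  · refine key ((finRotate n).symm i₀) ?_
    rw [AffineMap.lineMap_apply_zero, Equiv.apply_symm_apply]
  rcases eq_or_lt_of_le hr.2 with rfl | hr1
  · exact key i₀ (by simp)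
  have hx : AffineMap.lineMap (p s i₀) (p s (finRotate n i₀)) r ∈
      openSegment ℝ (p s i₀) (p s (finRotate n i₀)) := by
    rw [openSegment_eq_image_lineMap]
    exact ⟨r, ⟨hr0, hr1⟩, rfl⟩
  refine ⟨{i₀}, by simp, by simp, fun j => ?_, ?_⟩
  · rw [Finset.mem_singleton]
    constructor
    · rintro rfl
      exact openSegment_subset_segment _ _ _ hx
    · intro hj
      by_contra hne
      exact h.notMem_of_openSegment hs (Ne.symm hne) hx hj
  · rw [Finset.sdiff_singleton_eq_erase, h.sum_ang_edge hs hx]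
    constructor <;> linarith

/-- Edges that avoid `x` at time `s₀` still contribute an angle in (0, 2π) at nearby times. The one
or two edges through `x` contribute an angle in (0, π) each before the passage and in (−π, 0) each
after it. So the total lies in (0, 4π) before and in (−2π, 2π) after, and it is a multiple of 2π. -/
theorem eventually_of_mem (h : InwardMotion p T) {s₀ : ℝ} (hs₀ : s₀ ∈ Icc 0 T) {x : Plane}
    {i₀ : Fin n} (hx : x ∈ segment ℝ (p s₀ i₀) (p s₀ (finRotate n i₀))) :
    ∀ᶠ s in 𝓝 s₀, s ∈ Icc 0 T → s ≠ s₀ →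
      (∀ j, x ∉ segment ℝ (p s j) (p s (finRotate n j))) ∧
      (s₀ < s → winding (p s) x = 0) ∧ (s < s₀ → winding (p s) x = 2 * Real.pi) := by
  have hpi := Real.pi_pos
  obtain ⟨I, hI0, hI2, hI, hsum⟩ := h.exists_edges hs₀ hx
  have hlim : Tendsto (fun s => ∑ j ∈ Finset.univ \ I, ang (p s j) (p s (finRotate n j)) x) (𝓝 s₀)
      (𝓝 (∑ j ∈ Finset.univ \ I, ang (p s₀ j) (p s₀ (finRotate n j)) x)) := by
    refine tendsto_finsetSum _ fun j hj => ?_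
    refine tendsto_ang ((h.cont _).tendsto _) ((h.cont _).tendsto _) tendsto_const_nhds ?_
    rw [← hI]
    exact (Finset.mem_sdiff.1 hj).2
  have hnot : ∀ᶠ s in 𝓝 s₀, ∀ j, j ∉ I → x ∉ segment ℝ (p s j) (p s (finRotate n j)) := by
    rw [Filter.eventually_all]
    intro j
    by_cases hj : j ∈ I
    · exact Eventually.of_forall fun s hn => absurd hj hn
    · rw [hI] at hj
      filter_upwards [(isClosed_setOf_mem_segment (h.cont j) (h.cont (finRotate n j))
        x).isOpen_compl.mem_nhds hj] with s hs _
      exact hs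
  filter_upwards [hlim.eventually (isOpen_Ioo.mem_nhds hsum), hnot] with s hs1 hs2 hs hne
  have hon : ∀ j ∈ I, (s₀ < s → ang (p s j) (p s (finRotate n j)) x ∈ Ioo (-Real.pi) 0) ∧
      (s < s₀ → ang (p s j) (p s (finRotate n j)) x ∈ Ioo 0 Real.pi) := by
    intro j hj
    exact ⟨fun hlt => ang_mem_Ioo_of_right (h.right j s hs s₀ hs₀ x ((hI j).1 hj) hlt),
      fun hlt => ang_mem_Ioo_of_left (h.left j s hs s₀ hs₀ x ((hI j).1 hj) hlt)⟩
  have hoff : ∀ j, x ∉ segment ℝ (p s j) (p s (finRotate n j)) := by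
    intro j hj
    by_cases hjI : j ∈ I
    · have hxj := (hI j).1 hjI
      have hzero : (inner ℝ (rot (p s (finRotate n j) - p s j)) (x - p s j) : ℝ) = 0 := by
        obtain ⟨α, β, _, _, hαβ, rfl⟩ := hj
        have : α • p s j + β • p s (finRotate n j) - p s j
            = β • (p s (finRotate n j) - p s j) := by
          rw [← eq_sub_iff_add_eq] at hαβ; subst hαβ; module
        rw [this, inner_smul_right, inner_rot_self, mul_zero]
      rcases lt_or_gt_of_ne hne with hlt | hlt
      · exact (h.left j s hs s₀ hs₀ x hxj hlt).ne' hzero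
      · exact (h.right j s hs s₀ hs₀ x hxj hlt).ne hzero
    · exact hs2 j hjI hj
  have hcard : (1 : ℝ) ≤ I.card ∧ (I.card : ℝ) ≤ 2 :=
    ⟨by exact_mod_cast Finset.card_pos.2 hI0, by exact_mod_cast hI2⟩
  have hw : (winding (p s) x : Real.Angle) = 0 := coe_winding fun j hj =>
    hoff j (hj ▸ left_mem_segment _ _ _)
  have hsplit : winding (p s) x = ∑ j ∈ Finset.univ \ I, ang (p s j) (p s (finRotate n j)) x +
      ∑ j ∈ I, ang (p s j) (p s (finRotate n j)) x :=
    (Finset.sum_sdiff (Finset.subset_univ I)).symm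
  refine ⟨hoff, fun hlt => ?_, fun hlt => ?_⟩
  · have h1 : ∑ j ∈ I, ang (p s j) (p s (finRotate n j)) x < 0 :=
      Finset.sum_neg (fun j hj => ((hon j hj).1 hlt).2) hI0
    have h2 : ∑ _j ∈ I, (-Real.pi) < ∑ j ∈ I, ang (p s j) (p s (finRotate n j)) x :=
      Finset.sum_lt_sum_of_nonempty hI0 fun j hj => ((hon j hj).1 hlt).1
    rw [Finset.sum_const, nsmul_eq_mul] at h2
    refine eq_of_coe_angle_eq (by rw [hw, Real.Angle.coe_zero]) ?_
    rw [sub_zero, hsplit, abs_lt]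
    constructor <;> nlinarith [hs1.1, hs1.2]
  · have h1 : 0 < ∑ j ∈ I, ang (p s j) (p s (finRotate n j)) x :=
      Finset.sum_pos (fun j hj => ((hon j hj).2 hlt).1) hI0
    have h2 : ∑ j ∈ I, ang (p s j) (p s (finRotate n j)) x < ∑ _j ∈ I, Real.pi :=
      Finset.sum_lt_sum_of_nonempty hI0 fun j hj => ((hon j hj).2 hlt).2
    rw [Finset.sum_const, nsmul_eq_mul] at h2
    refine eq_of_coe_angle_eq (by rw [hw, Real.Angle.coe_two_pi]) ?_
    rw [hsplit, abs_lt]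
    constructor <;> nlinarith [hs1.1, hs1.2]

theorem winding_eq (h : InwardMotion p T) {x : Plane} {S : Set ℝ} (hS : IsPreconnected S)
    (hoff : ∀ s ∈ S, ∀ j, x ∉ segment ℝ (p s j) (p s (finRotate n j))) {s s' : ℝ}
    (hs : s ∈ S) (hs' : s' ∈ S) : winding (p s) x = winding (p s') x := by
  refine eq_of_isPreconnected (F := fun s => winding (p s) x) (θ := 0) hS ?_ ?_ hs hs'
  · intro s hs
    refine (tendsto_finsetSum _ fun j _ => ?_).mono_left nhdsWithin_le_nhds
    exact tendsto_ang ((h.cont _).tendsto _) ((h.cont _).tendsto _) tendsto_const_nhds (hoff s hs j)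
  · exact fun s hs => coe_winding fun j hj => hoff s hs j (hj ▸ left_mem_segment _ _ _)

/-- The moving curve passes through each point at most once. -/
theorem time_unique (h : InwardMotion p T) {x : Plane} {s s' : ℝ} (hs : s ∈ Icc 0 T)
    (hs' : s' ∈ Icc 0 T) {i j : Fin n} (hi : x ∈ segment ℝ (p s i) (p s (finRotate n i)))
    (hj : x ∈ segment ℝ (p s' j) (p s' (finRotate n j))) : s = s' := by
  have hpi := Real.pi_pos
  by_contra hne
  wlog hlt : s < s' generalizing s s' i j
  · exact this hs' hs hj hi (Ne.symm hne) (lt_of_le_of_ne (not_lt.1 hlt) (Ne.symm hne))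
  obtain ⟨δ, hδ, hnear⟩ := Metric.eventually_nhds_iff.1 (h.eventually_of_mem hs hi)
  -- The times at which the curve passes through `x` form a closed set, and there are none just
  -- after `s`. So there is a next one, `s₁`.
  set Hit : Set ℝ := ⋃ k, {r | x ∈ segment ℝ (p r k) (p r (finRotate n k))} with hHit
  have hclosed : IsClosed Hit :=
    isClosed_iUnion_of_finite fun k => isClosed_setOf_mem_segment (h.cont _) (h.cont _) x
  have hcomp : IsCompact (Hit ∩ Icc (s + min δ (s' - s) / 2) s') :=
    isCompact_Icc.inter_left hclosed
  have hm0 : 0 < min δ (s' - s) := lt_min hδ (by linarith)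
  have hm1 := min_le_left δ (s' - s)
  have hm2 := min_le_right δ (s' - s)
  obtain ⟨s₁, ⟨hs₁, hs₁I⟩, hleast⟩ := hcomp.exists_isLeast
    ⟨s', mem_iUnion.2 ⟨j, hj⟩, by constructor <;> linarith⟩
  obtain ⟨k, hk⟩ := mem_iUnion.1 hs₁
  have hs₁T : s₁ ∈ Icc 0 T := ⟨by linarith [hs.1, hs₁I.1], hs₁I.2.trans hs'.2⟩
  have hss₁ : s < s₁ := by linarith [hs₁I.1]
  have hoff : ∀ r ∈ Ioo s s₁, ∀ k, x ∉ segment ℝ (p r k) (p r (finRotate n k)) := by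
    intro r hr k hk
    by_cases hr' : r < s + min δ (s' - s) / 2
    · refine (hnear (y := r) ?_ ⟨hs.1.trans hr.1.le, hr.2.le.trans hs₁T.2⟩ hr.1.ne').1 k hk
      rw [Real.dist_eq, abs_of_pos (by linarith [hr.1])]
      linarith
    · have := hleast ⟨mem_iUnion.2 ⟨k, hk⟩, not_lt.1 hr', hr.2.le.trans hs₁I.2⟩
      linarith [hr.2]
  obtain ⟨δ', hδ', hnear'⟩ := Metric.eventually_nhds_iff.1 (h.eventually_of_mem hs₁T hk)
  -- `a` is just after the passage at `s` and `b` just before the one at `s₁`. The winding angles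
  -- there are 0 and 2π, although nothing happens in between.
  set a := s + min δ (s₁ - s) / 2
  set b := s₁ - min δ' (s₁ - s) / 2
  have ha0 : 0 < min δ (s₁ - s) := lt_min hδ (by linarith)
  have hb0 : 0 < min δ' (s₁ - s) := lt_min hδ' (by linarith)
  have ha1 := min_le_left δ (s₁ - s)
  have ha2 := min_le_right δ (s₁ - s)
  have hb1 := min_le_left δ' (s₁ - s)
  have hb2 := min_le_right δ' (s₁ - s)
  have ha : a ∈ Ioo s s₁ := by constructor <;> simp only [a] <;> linarith
  have hb : b ∈ Ioo s s₁ := by constructor <;> simp only [b] <;> linarith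
  have hT : ∀ r ∈ Ioo s s₁, r ∈ Icc 0 T := fun r hr =>
    ⟨hs.1.trans hr.1.le, hr.2.le.trans hs₁T.2⟩
  have hwa : winding (p a) x = 0 := by
    refine (hnear (y := a) ?_ (hT a ha) ha.1.ne').2.1 ha.1
    rw [Real.dist_eq, abs_of_pos (by linarith [ha.1])]
    simp only [a]; linarith
  have hwb : winding (p b) x = 2 * Real.pi := by
    refine (hnear' (y := b) ?_ (hT b hb) hb.2.ne).2.2 hb.2
    rw [Real.dist_eq, abs_of_neg (by linarith [hb.2])]
    simp only [b]; linarith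
  have := h.winding_eq isPreconnected_Ioo hoff ha hb
  linarith

/-- Every later position of the curve lies in the closed region bounded by the initial curve. -/
theorem mem_fill_zero (h : InwardMotion p T) {x : Plane} {s : ℝ} (hs : s ∈ Ioc 0 T) {i : Fin n}
    (hi : x ∈ segment ℝ (p s i) (p s (finRotate n i))) :
    x ∈ fill ((⟨p 0⟩ : Polygon Plane n).boundary ℝ) := by
  have hpi := Real.pi_pos
  by_contra hx
  have hw0 : winding (p 0) x = 0 := winding_eq_zero_of_notMem_fill (p := ⟨p 0⟩) hx
  have hsT : s ∈ Icc 0 T := ⟨hs.1.le, hs.2⟩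
  obtain ⟨δ, hδ, hnear⟩ := Metric.eventually_nhds_iff.1 (h.eventually_of_mem hsT hi)
  -- The curve has not met `x` before `s`, so the winding angle keeps its initial value 0; but just
  -- before the passage it is 2π.
  have hoff : ∀ r ∈ Ico 0 s, ∀ k, x ∉ segment ℝ (p r k) (p r (finRotate n k)) := by
    intro r hr k hk
    exact hr.2.ne (h.time_unique ⟨hr.1, hr.2.le.trans hs.2⟩ hsT hk hi)
  set b := s - min δ s / 2
  have hb0 : 0 < min δ s := lt_min hδ hs.1
  have hb1 := min_le_left δ s
  have hb2 := min_le_right δ s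
  have hb : b ∈ Ico 0 s := by constructor <;> simp only [b] <;> linarith [hs.1]
  have hwb : winding (p b) x = 2 * Real.pi := by
    refine (hnear (y := b) ?_ ⟨hb.1, hb.2.le.trans hs.2⟩ hb.2.ne).2.2 hb.2
    rw [Real.dist_eq, abs_of_neg (by linarith [hb.2])]
    simp only [b]; linarith
  have := h.winding_eq isPreconnected_Ico hoff ⟨le_rfl, hs.1⟩ hb
  linarith

/-- The condition `outer` gives this for interior points of edges; taking closures adds the
vertices. -/
theorem boundary_subset_closure (h : InwardMotion p T) :
    (⟨p 0⟩ : Polygon Plane n).boundary ℝ ⊆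
      closure (fill ((⟨p 0⟩ : Polygon Plane n).boundary ℝ))ᶜ := by
  intro x hx
  obtain ⟨i, hi⟩ := mem_boundary.1 hx
  have hsub : openSegment ℝ (p 0 i) (p 0 (finRotate n i)) ⊆
      closure (fill ((⟨p 0⟩ : Polygon Plane n).boundary ℝ))ᶜ := fun y hy =>
    mem_closure_iff_frequently.2 ((h.outer i y hy).mono fun z hz => hz.1)
  have := closure_mono hsub
  rw [closure_closure, closure_openSegment] at this
  exact this hi

/-- An earlier position of the curve does not meet the region enclosed by a later one. -/
theorem notMem_fill (h : InwardMotion p T) {x : Plane} {s s' : ℝ} (hs : 0 ≤ s) (hss' : s < s')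
    (hs' : s' ≤ T) {i : Fin n} (hi : x ∈ segment ℝ (p s i) (p s (finRotate n i))) :
    x ∉ fill ((⟨p s'⟩ : Polygon Plane n).boundary ℝ) := by
  intro hx
  set J := (⟨p s'⟩ : Polygon Plane n).boundary ℝ
  rw [segment_eq_image_lineMap] at hi
  obtain ⟨r, hr, rfl⟩ := hi
  -- γ traces the point of the edge through time. Between 0 and `s` it avoids the curve of time
  -- `s'`, by `time_unique`, so with `γ s` also `γ 0` is enclosed by that curve.
  set γ : ℝ → Plane := fun u => AffineMap.lineMap (p u i) (p u (finRotate n i)) r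
  have hγ : Continuous γ := by
    have h1 := h.cont i
    have h2 := h.cont (finRotate n i)
    simp only [γ, AffineMap.lineMap_apply_module]
    fun_prop
  have hγm : ∀ u, γ u ∈ segment ℝ (p u i) (p u (finRotate n i)) := fun u => by
    rw [segment_eq_image_lineMap]
    exact ⟨r, hr, rfl⟩
  have hpath : γ 0 ∈ fill J := by
    refine mem_fill_of_isPreconnected (S := γ '' Icc 0 s) (isPreconnected_Icc.image _ hγ.continuousOn)
      ?_ ⟨s, ⟨hs, le_rfl⟩, rfl⟩ ⟨0, ⟨le_rfl, hs⟩, rfl⟩ hx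
    rw [Set.disjoint_left]
    rintro _ ⟨u, hu, rfl⟩ hJ
    obtain ⟨k, hk⟩ := mem_boundary.1 hJ
    have := h.time_unique ⟨hu.1, by linarith [hu.2]⟩ ⟨by linarith, hs'⟩ (hγm u) hk
    linarith [hu.2]
  have h0J : γ 0 ∉ J := by
    intro hJ
    obtain ⟨k, hk⟩ := mem_boundary.1 hJ
    have := h.time_unique ⟨le_rfl, by linarith⟩ ⟨by linarith, hs'⟩ (hγm 0) hk
    linarith
  have hJ0 : fill J ⊆ fill ((⟨p 0⟩ : Polygon Plane n).boundary ℝ) := by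
    refine fill_subset_fill fun y hy => ?_
    obtain ⟨k, hk⟩ := mem_boundary.1 hy
    exact h.mem_fill_zero ⟨by linarith, hs'⟩ hk
  -- So `γ 0`, a point of the initial curve, would be interior to the initial region, although it is
  -- a limit of exterior points.
  have hcl := h.boundary_subset_closure (mem_boundary.2 ⟨i, hγm 0⟩)
  obtain ⟨y, hy, hyn⟩ := mem_closure_iff_nhds.1 hcl _
    ((isOpen_fill_diff (isClosed_boundary _)).mem_nhds ⟨hpath, h0J⟩)
  exact hyn (hJ0 hy.1)

end InwardMotion

end EulerTransform

namespace EulerTransform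

/-! ### Local coordinates along the edges of a polygon -/

section Coordinates

variable {n : ℕ}

/-- The two ends of the `i`-th edge. -/
def corner (i : Fin n) : Bool → Fin n
  | false => i
  | true => finRotate n i

theorem corner_not_ne (h : 3 ≤ n) (i : Fin n) (b : Bool) : corner i (!b) ≠ corner i b := by
  cases b
  · exact finRotate_ne h i
  · exact (finRotate_ne h i).symm

/-- The length of the `i`-th edge. -/
noncomputable def len (p : Polygon Plane n) (i : Fin n) : ℝ := ‖p (finRotate n i) - p i‖

/-- The unit vector that points into the `i`-th edge from one of its ends. -/
noncomputable def fdir (p : Polygon Plane n) (i : Fin n) : Bool → Plane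
  | false => (len p i)⁻¹ • (p (finRotate n i) - p i)
  | true => -((len p i)⁻¹ • (p (finRotate n i) - p i))

theorem fdir_not (p : Polygon Plane n) (i : Fin n) (b : Bool) : fdir p i (!b) = -fdir p i b := by
  cases b <;> simp [fdir]

/-- The velocity of the `k`-th vertex when the edges move inwards with unit speed. -/
noncomputable def miter (p : Polygon Plane n) (k : Fin n) : Plane :=
  (1 / (1 + inner ℝ (normal p ((finRotate n).symm k)) (normal p k)) : ℝ) •
    (normal p ((finRotate n).symm k) + normal p k)

theorem offset_apply (p : Polygon Plane n) (s : ℝ) (k : Fin n) :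
    offset p s k = p k + s • miter p k := by
  rw [miter, smul_smul, mul_one_div]
  rfl

theorem offset_zero (p : Polygon Plane n) : offset p 0 = p := by
  cases p with
  | mk v =>
    have : (offset ⟨v⟩ 0).vertices = v := by
      funext k
      rw [offset_apply, zero_smul, add_zero]
    exact congrArg Polygon.mk this

/-- The slope of the bisector at an end of an edge. -/
noncomputable def kap (p : Polygon Plane n) (i : Fin n) (b : Bool) : ℝ :=
  inner ℝ (fdir p i b) (miter p (corner i b))

/-- The distance of a point from the line of the `i`-th edge, positive on the left. -/
noncomputable def hgt (p : Polygon Plane n) (i : Fin n) (x : Plane) : ℝ :=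
  inner ℝ (normal p i) (x - p i)

/-- The distance of a point from the bisector at an end of the `i`-th edge, measured
parallel to the edge. -/
noncomputable def acoord (p : Polygon Plane n) (i : Fin n) (b : Bool) (x : Plane) : ℝ :=
  inner ℝ (fdir p i b) (x - p (corner i b)) - hgt p i x * kap p i b

/-- The part of the plane swept by the `i`-th edge up to time `T`. -/
def band (p : Polygon Plane n) (T : ℝ) (i : Fin n) : Set Plane :=
  {x | hgt p i x ∈ Icc 0 T ∧ ∀ b, 0 ≤ acoord p i b x}

end Coordinates

namespace IsSimple

variable {n : ℕ} {p : Polygon Plane n}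

theorem len_pos (h : IsSimple p) (i : Fin n) : 0 < len p i :=
  norm_pos_iff.2 (sub_ne_zero.2 (h.ne i).symm)

theorem normal_eq (p : Polygon Plane n) (i : Fin n) : normal p i = rot (fdir p i false) := by
  rw [fdir, rot_smul]; rfl

theorem frame (h : IsSimple p) (i : Fin n) (b : Bool) : IsFrame (fdir p i b) (normal p i) := by
  have h1 : IsFrame (fdir p i false) (normal p i) := by
    rw [normal_eq]
    apply isFrame_rot
    rw [fdir, norm_smul, norm_inv, Real.norm_of_nonneg (h.len_pos i).le]
    exact inv_mul_cancel₀ (h.len_pos i).ne'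
  cases b
  · exact h1
  · rw [← Bool.not_false, fdir_not]; exact h1.neg_left

theorem corner_not (h : IsSimple p) (i : Fin n) (b : Bool) :
    p (corner i (!b)) = p (corner i b) + len p i • fdir p i b := by
  have := (h.len_pos i).ne'
  cases b
  · simp only [corner, fdir, Bool.not_false]
    rw [smul_smul, mul_inv_cancel₀ this]; module
  · simp only [corner, fdir, Bool.not_true, smul_neg]
    rw [smul_smul, mul_inv_cancel₀ this]; module

theorem hgt_eq (h : IsSimple p) (i : Fin n) (b : Bool) (x : Plane) :
    hgt p i x = inner ℝ (normal p i) (x - p (corner i b)) := by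
  cases b
  · rfl
  · have h1 := h.corner_not i false
    simp only [Bool.not_false] at h1
    rw [h1, hgt, ← sub_sub, inner_sub_right _ (_ - _), inner_smul_right, (h.frame i false).nd,
      mul_zero, sub_zero]
    rfl

/-- Opposite normals of consecutive edges would mean opposite directions, so the curve would fold
back. Hence the denominator in `offset` does not vanish. -/
theorem normal_add_ne (h : IsSimple p) (i : Fin n) :
    1 + (inner ℝ (normal p i) (normal p (finRotate n i)) : ℝ) ≠ 0 := by
  intro h0
  have h1 := (h.frame i false).nn
  have h2 := (h.frame (finRotate n i) false).nn
  have h3 : (inner ℝ (normal p i + normal p (finRotate n i))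
      (normal p i + normal p (finRotate n i)) : ℝ) = 0 := by
    rw [inner_add_add_self, h1, h2, real_inner_comm (normal p i)]
    linarith
  rw [inner_self_eq_zero, add_eq_zero_iff_eq_neg, normal_eq, normal_eq, ← rot_neg] at h3
  have h4 := congrArg rot h3
  rw [rot_rot, rot_rot, neg_inj] at h4
  have hl1 := h.len_pos i
  have hl2 := h.len_pos (finRotate n i)
  have e1 : p (finRotate n i) - p i = len p i • fdir p i false := by
    have := h.corner_not i false
    simp only [corner, Bool.not_false] at this
    rw [this]; module
  have e2 : p (finRotate n (finRotate n i)) - p (finRotate n i) =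
      len p (finRotate n i) • fdir p (finRotate n i) false := by
    have := h.corner_not (finRotate n i) false
    simp only [corner, Bool.not_false] at this
    rw [this]; module
  apply h.zero_notMem_segment i
  refine ⟨len p (finRotate n i) / (len p i + len p (finRotate n i)),
    len p i / (len p i + len p (finRotate n i)), by positivity, by positivity, by field_simp; ring, ?_⟩
  rw [e1, e2, h4, smul_smul, smul_smul, smul_neg, neg_add_eq_sub, sub_eq_zero]
  congr 1
  ring

theorem miter_rotate (p : Polygon Plane n) (i : Fin n) : miter p (finRotate n i) =
    (1 / (1 + inner ℝ (normal p i) (normal p (finRotate n i))) : ℝ) •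
      (normal p i + normal p (finRotate n i)) := by
  rw [miter, Equiv.symm_apply_apply]

/-- The denominator of the miter vector is chosen for this: each of its two edge lines moves with
unit speed. -/
theorem inner_normal_miter (h : IsSimple p) (i : Fin n) (b : Bool) :
    (inner ℝ (normal p i) (miter p (corner i b)) : ℝ) = 1 := by
  cases b
  · have h0 := h.normal_add_ne ((finRotate n).symm i)
    rw [Equiv.apply_symm_apply] at h0
    rw [corner, miter, inner_smul_right, inner_add_right, (h.frame i false).nn,
      real_inner_comm (normal p ((finRotate n).symm i)), add_comm _ (1 : ℝ), one_div_mul_cancel h0]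
  · have h0 := h.normal_add_ne i
    rw [corner, miter_rotate, inner_smul_right, inner_add_right, (h.frame i false).nn,
      one_div_mul_cancel h0]

theorem miter_eq (h : IsSimple p) (i : Fin n) (b : Bool) :
    miter p (corner i b) = kap p i b • fdir p i b + normal p i := by
  conv_lhs => rw [(h.frame i b).expand (miter p (corner i b))]
  rw [h.inner_normal_miter, one_smul]
  rfl

theorem hgt_offset (h : IsSimple p) (i : Fin n) (b : Bool) (s : ℝ) :
    hgt p i (offset p s (corner i b)) = s := by
  rw [h.hgt_eq i b, offset_apply, add_sub_cancel_left, inner_smul_right, h.inner_normal_miter,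
    mul_one]

theorem acoord_offset (h : IsSimple p) (i : Fin n) (b : Bool) (s : ℝ) :
    acoord p i b (offset p s (corner i b)) = 0 := by
  rw [acoord, h.hgt_offset, offset_apply, add_sub_cancel_left, inner_smul_right, kap, sub_self]

/-- Both sides give the width of the strip between the two bisectors at the height of `x`; this
turns the length of the offset edge into a linear function of height. -/
theorem acoord_add (h : IsSimple p) (i : Fin n) (b : Bool) (x : Plane) :
    acoord p i b x + acoord p i (!b) x = len p i - hgt p i x * (kap p i b + kap p i (!b)) := by
  rw [acoord, acoord, h.corner_not, fdir_not, inner_neg_left, ← sub_sub, inner_sub_right _ (_ - _),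
    inner_smul_right, (h.frame i b).dd]
  ring

theorem hgt_add_smul (i : Fin n) (x y : Plane) (r : ℝ) :
    hgt p i (x + r • y) = hgt p i x + r * inner ℝ (normal p i) y := by
  rw [hgt, add_sub_right_comm, inner_add_right, inner_smul_right]; rfl

theorem acoord_add_smul (i : Fin n) (b : Bool) (x y : Plane) (r : ℝ) :
    acoord p i b (x + r • y) =
      acoord p i b x + r * (inner ℝ (fdir p i b) y - inner ℝ (normal p i) y * kap p i b) := by
  rw [acoord, acoord, hgt_add_smul, add_sub_right_comm, inner_add_right, inner_smul_right]; ring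

theorem hgt_combo (i : Fin n) (x y : Plane) {r s : ℝ} (hrs : r + s = 1) :
    hgt p i (r • x + s • y) = r * hgt p i x + s * hgt p i y := by
  have : r • x + s • y - p i = r • (x - p i) + s • (y - p i) := by
    rw [← eq_sub_iff_add_eq] at hrs; subst hrs; module
  rw [hgt, this, inner_add_right, inner_smul_right, inner_smul_right]; rfl

theorem acoord_combo (i : Fin n) (b : Bool) (x y : Plane) {r s : ℝ} (hrs : r + s = 1) :
    acoord p i b (r • x + s • y) = r * acoord p i b x + s * acoord p i b y := by
  have : r • x + s • y - p (corner i b) = r • (x - p (corner i b)) + s • (y - p (corner i b)) := by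
    rw [← eq_sub_iff_add_eq] at hrs; subst hrs; module
  rw [acoord, this, hgt_combo i x y hrs, inner_add_right, inner_smul_right, inner_smul_right,
    acoord, acoord]
  ring

theorem ext_coords (h : IsSimple p) (i : Fin n) (b : Bool) {x y : Plane}
    (h1 : hgt p i x = hgt p i y) (h2 : acoord p i b x = acoord p i b y) : x = y := by
  rw [acoord, acoord, h1, sub_left_inj, inner_sub_right, inner_sub_right, sub_left_inj] at h2
  rw [hgt, hgt, inner_sub_right, inner_sub_right, sub_left_inj] at h1
  exact (h.frame i b).ext h2 h1

/-- Otherwise the linear width reaches 0 at the time `len p i / k` within the interval, and at this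
time the two ends of the edge coincide. -/
theorem offset_len_pos (h : IsSimple p) {T : ℝ}
    (hT : ∀ s ∈ Icc 0 T, IsSimple (offset p s)) {s : ℝ} (hs : s ∈ Icc 0 T) (i : Fin n) (b : Bool) :
    0 < len p i - s * (kap p i b + kap p i (!b)) := by
  by_contra hcon
  push Not at hcon
  have hl := h.len_pos i
  set k := kap p i b + kap p i (!b) with hk
  have hsk : 0 < s * k := by linarith
  have hk0 : 0 < k := by
    by_contra hk0
    push Not at hk0
    nlinarith [hs.1]
  have hr : len p i / k ∈ Icc 0 T := by
    refine ⟨by positivity, le_trans ?_ hs.2⟩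
    rw [div_le_iff₀ hk0]; linarith
  refine corner_not_ne h.1 i b ((hT _ hr).inj (h.ext_coords i b ?_ ?_))
  · rw [h.hgt_offset, h.hgt_offset]
  · have h1 := h.acoord_add i b (offset p (len p i / k) (corner i (!b)))
    rw [h.hgt_offset, h.acoord_offset, ← hk, div_mul_cancel₀ _ hk0.ne'] at h1
    rw [h.acoord_offset]
    linarith

/-- A point of the `i`-th edge of the offset curve, in coordinates. -/
theorem mem_segment_offset_iff (h : IsSimple p) {T : ℝ}
    (hT : ∀ s ∈ Icc 0 T, IsSimple (offset p s)) {s : ℝ} (hs : s ∈ Icc 0 T) (i : Fin n) {x : Plane} :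
    x ∈ segment ℝ (offset p s i) (offset p s (finRotate n i)) ↔
      hgt p i x = s ∧ ∀ b, 0 ≤ acoord p i b x := by
  have hpos := h.offset_len_pos hT hs i false
  set L := len p i - s * (kap p i false + kap p i (!false)) with hL
  have a0 : acoord p i false (offset p s i) = 0 := h.acoord_offset i false s
  have a1 : acoord p i true (offset p s (finRotate n i)) = 0 := h.acoord_offset i true s
  have g0 : hgt p i (offset p s i) = s := h.hgt_offset i false s
  have g1 : hgt p i (offset p s (finRotate n i)) = s := h.hgt_offset i true s
  have b0 : acoord p i true (offset p s i) = L := by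
    have := h.acoord_add i false (offset p s i)
    rw [a0, g0, zero_add] at this
    exact this
  have b1 : acoord p i false (offset p s (finRotate n i)) = L := by
    have := h.acoord_add i false (offset p s (finRotate n i))
    rw [g1, Bool.not_false, a1, add_zero] at this
    exact this
  constructor
  · rintro ⟨r, u, hr, hu, hru, rfl⟩
    rw [hgt_combo _ _ _ hru, g0, g1]
    refine ⟨by rw [← add_mul, hru, one_mul], fun b => ?_⟩
    rw [acoord_combo _ _ _ _ hru]
    cases b
    · rw [a0, b1]; positivity
    · rw [a1, b0]; positivity
  · rintro ⟨hx, hb⟩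
    have hadd := h.acoord_add i false x
    rw [hx, ← hL, Bool.not_false] at hadd
    refine ⟨acoord p i true x / L, acoord p i false x / L, div_nonneg (hb _) hpos.le,
      div_nonneg (hb _) hpos.le, ?_, ?_⟩
    · rw [← add_div, add_comm, hadd, div_self hpos.ne']
    · have hsum : acoord p i true x / L + acoord p i false x / L = 1 := by
        rw [← add_div, add_comm, hadd, div_self hpos.ne']
      refine h.ext_coords i false ?_ ?_
      · rw [hgt_combo _ _ _ hsum, g0, g1, hx, ← add_mul, hsum, one_mul]
      · rw [acoord_combo _ _ _ _ hsum, a0, b1, mul_zero, zero_add, div_mul_cancel₀ _ hpos.ne']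

end IsSimple

end EulerTransform

namespace EulerTransform

namespace IsSimple

variable {n : ℕ} {p : Polygon Plane n}

theorem mem_segment_iff (h : IsSimple p) (i : Fin n) {x : Plane} :
    x ∈ segment ℝ (p i) (p (finRotate n i)) ↔ hgt p i x = 0 ∧ ∀ b, 0 ≤ acoord p i b x := by
  have h0 : ∀ s ∈ Icc (0 : ℝ) 0, IsSimple (offset p s) := by
    intro s hs
    rw [Icc_self, mem_singleton_iff] at hs
    rw [hs, offset_zero]
    exact h
  have := h.mem_segment_offset_iff h0 (left_mem_Icc.2 le_rfl) i (x := x)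
  rwa [offset_zero] at this

theorem hgt_corner (h : IsSimple p) (i : Fin n) (b : Bool) : hgt p i (p (corner i b)) = 0 := by
  have := h.hgt_offset i b 0
  rwa [offset_zero] at this

theorem acoord_corner (h : IsSimple p) (i : Fin n) (b : Bool) :
    acoord p i b (p (corner i b)) = 0 := by
  have := h.acoord_offset i b 0
  rwa [offset_zero] at this

theorem acoord_corner_not (h : IsSimple p) (i : Fin n) (b : Bool) :
    acoord p i b (p (corner i (!b))) = len p i := by
  have h1 := h.acoord_add i b (p (corner i (!b)))
  rw [h.acoord_corner, h.hgt_corner] at h1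
  linarith

theorem eq_corner (h : IsSimple p) {i : Fin n} {b : Bool} {x : Plane} (h0 : hgt p i x = 0)
    (ha : acoord p i b x = 0) : x = p (corner i b) :=
  h.ext_coords i b (by rw [h0, h.hgt_corner]) (by rw [ha, h.acoord_corner])

theorem offset_corner_not (h : IsSimple p) (i : Fin n) (b : Bool) (s : ℝ) :
    offset p s (corner i (!b)) = offset p s (corner i b) +
      (len p i - s * (kap p i b + kap p i (!b))) • fdir p i b := by
  refine h.ext_coords i b ?_ ?_
  · rw [IsSimple.hgt_add_smul, (h.frame i b).nd, h.hgt_offset, h.hgt_offset, mul_zero, add_zero]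
  · have h1 := h.acoord_add i b (offset p s (corner i (!b)))
    rw [h.acoord_offset, h.hgt_offset, add_zero] at h1
    rw [IsSimple.acoord_add_smul, h1, h.acoord_offset, (h.frame i b).dd, (h.frame i b).nd]
    ring

end IsSimple

section

variable {n : ℕ}

theorem continuous_hgt (p : Polygon Plane n) (i : Fin n) : Continuous (hgt p i) := by
  unfold hgt
  fun_prop

theorem continuous_acoord (p : Polygon Plane n) (i : Fin n) (b : Bool) :
    Continuous (acoord p i b) := by
  have := continuous_hgt p i
  unfold acoord
  fun_prop

/-- The relative interior of the `i`-th edge. -/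
def openEdge (p : Polygon Plane n) (i : Fin n) : Set Plane :=
  {x | hgt p i x = 0 ∧ ∀ b, 0 < acoord p i b x}

end

theorem bool_cases {q : Bool → Prop} (b : Bool) (h1 : q b) (h2 : q (!b)) : ∀ c, q c := by
  intro c
  cases b <;> cases c <;> assumption

/-! ### A polygon near its edges -/

namespace SimplePolygon

variable (P : SimplePolygon)

/-- The interior of the region bounded by a polygon. -/
def inside : Set Plane := P.carrier \ P.poly.boundary ℝ

/-- The `i`-th edge. -/
def edge (i : Fin P.n) : Set Plane := segment ℝ (P.poly i) (P.poly (finRotate P.n i))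

variable {P}

theorem isClosed_carrier : IsClosed P.carrier := isClosed_fill (isClosed_boundary _)

theorem isOpen_inside : IsOpen P.inside := isOpen_fill_diff (isClosed_boundary _)

theorem isClosed_edge (i : Fin P.n) : IsClosed (P.edge i) := isClosed_segment _ _

theorem edge_subset_boundary (i : Fin P.n) : P.edge i ⊆ P.poly.boundary ℝ := fun _ hx =>
  mem_boundary.2 ⟨i, hx⟩

theorem boundary_subset_carrier : P.poly.boundary ℝ ⊆ P.carrier := subset_fill _

theorem edge_subset_carrier (i : Fin P.n) : P.edge i ⊆ P.carrier :=
  (edge_subset_boundary i).trans boundary_subset_carrier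

theorem mem_edge_iff {i : Fin P.n} {x : Plane} :
    x ∈ P.edge i ↔ hgt P.poly i x = 0 ∧ ∀ b, 0 ≤ acoord P.poly i b x :=
  P.simple.mem_segment_iff i

theorem corner_mem_edge (i : Fin P.n) (b : Bool) : P.poly (corner i b) ∈ P.edge i := by
  cases b
  · exact left_mem_segment _ _ _
  · exact right_mem_segment _ _ _

theorem openEdge_subset_edge (i : Fin P.n) : openEdge P.poly i ⊆ P.edge i := fun _ hx =>
  mem_edge_iff.2 ⟨hx.1, fun b => (hx.2 b).le⟩

theorem mem_openEdge_or {i : Fin P.n} {x : Plane} (hx : x ∈ P.edge i) :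
    x ∈ openEdge P.poly i ∨ ∃ b, x = P.poly (corner i b) := by
  rw [mem_edge_iff] at hx
  by_cases h : ∀ b, 0 < acoord P.poly i b x
  · exact Or.inl ⟨hx.1, h⟩
  · push Not at h
    obtain ⟨b, hb⟩ := h
    exact Or.inr ⟨b, P.simple.eq_corner hx.1 (le_antisymm hb (hx.2 b))⟩

theorem notMem_edge_of_openEdge {i j : Fin P.n} (hij : i ≠ j) {x : Plane}
    (hx : x ∈ openEdge P.poly i) : x ∉ P.edge j := by
  intro hj
  rcases P.simple.eq_of_mem hij (openEdge_subset_edge i hx) hj with ⟨rfl, rfl⟩ | ⟨rfl, rfl⟩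
  · exact (hx.2 true).ne' (P.simple.acoord_corner i true)
  · exact (hx.2 false).ne' (P.simple.acoord_corner _ false)

/-- Near an interior point of an edge, the polygon is the half plane to the left of the edge. -/
theorem exists_ball_of_openEdge {i : Fin P.n} {x : Plane} (hx : x ∈ openEdge P.poly i) :
    ∃ r > 0, ∀ y ∈ Metric.ball x r, (0 < hgt P.poly i y → y ∈ P.inside) ∧
      (hgt P.poly i y < 0 → y ∉ P.carrier) ∧ (hgt P.poly i y = 0 → y ∈ openEdge P.poly i) := by
  have hev : ∀ᶠ y in 𝓝 x, (∀ b, 0 < acoord P.poly i b y) ∧ ∀ j, j ≠ i → y ∉ P.edge j := by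
    refine Filter.Eventually.and ?_ ?_
    · rw [Filter.eventually_all]
      exact fun b => (continuous_acoord _ _ _).continuousAt.eventually (lt_mem_nhds (hx.2 b))
    · rw [Filter.eventually_all]
      intro j
      by_cases hj : j = i
      · exact Eventually.of_forall fun y hn => absurd hj hn
      · filter_upwards [(isClosed_edge j).isOpen_compl.mem_nhds
          (notMem_edge_of_openEdge (Ne.symm hj) hx)] with y hy _
        exact hy
  obtain ⟨r, hr, hball⟩ := Metric.eventually_nhds_iff_ball.1 hev
  have hbd : ∀ y ∈ Metric.ball x r, hgt P.poly i y ≠ 0 → y ∉ P.poly.boundary ℝ := by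
    intro y hy hne hyb
    obtain ⟨j, hj⟩ := mem_boundary.1 hyb
    by_cases hji : j = i
    · subst hji
      exact hne (mem_edge_iff.1 hj).1
    · exact (hball y hy).2 j hji hj
  have hend : ∀ b, x ≠ P.poly (corner i b) := by
    rintro b rfl
    exact (hx.2 b).ne' (P.simple.acoord_corner i b)
  have hccw := P.ccw i x (by rw [edgeSet_eq]; exact openEdge_subset_edge i hx) (hend false) (hend true)
  have hsmall : ∀ᶠ ε in 𝓝[>] (0 : ℝ), ε < r := nhdsWithin_le_nhds (gt_mem_nhds hr)
  obtain ⟨ε, ⟨⟨h1, h2⟩, h3⟩, h4⟩ := ((hccw.and hsmall).and self_mem_nhdsWithin).exists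
  have h4 : 0 < ε := h4
  have hnn := (P.simple.frame i false).nn
  have hnorm : ‖normal P.poly i‖ = 1 := by
    rw [real_inner_self_eq_norm_sq] at hnn
    nlinarith [norm_nonneg (normal P.poly i)]
  have hb1 : x + ε • normal P.poly i ∈ Metric.ball x r := by
    rw [mem_ball_iff_norm, add_sub_cancel_left, norm_smul, hnorm, mul_one,
      Real.norm_of_nonneg h4.le]
    exact h3
  have hb2 : x - ε • normal P.poly i ∈ Metric.ball x r := by
    rw [mem_ball_iff_norm, sub_sub_cancel_left, norm_neg, norm_smul, hnorm, mul_one,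
      Real.norm_of_nonneg h4.le]
    exact h3
  have g1 : hgt P.poly i (x + ε • normal P.poly i) = ε := by
    rw [IsSimple.hgt_add_smul, hx.1, hnn]; ring
  have g2 : hgt P.poly i (x - ε • normal P.poly i) = -ε := by
    rw [sub_eq_add_neg, ← neg_smul, IsSimple.hgt_add_smul, hx.1, hnn]; ring
  -- The two open halves of the ball are convex and miss the boundary, so one test point on each
  -- side, supplied by the orientation, decides for the whole half.
  have hconv : ∀ I : Set ℝ, Convex ℝ I → Convex ℝ (Metric.ball x r ∩ hgt P.poly i ⁻¹' I) := by
    intro I hI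
    refine (convex_ball x r).inter ?_
    intro y hy z hz α β hα hβ hαβ
    rw [mem_preimage, IsSimple.hgt_combo _ _ _ hαβ]
    exact hI hy hz hα hβ hαβ
  refine ⟨r, hr, fun y hy => ⟨fun hpos => ⟨?_, hbd y hy hpos.ne'⟩, fun hneg hyc => ?_,
    fun h0 => ⟨h0, (hball y hy).1⟩⟩⟩
  · refine mem_fill_of_isPreconnected (hconv (Ioi 0) (convex_Ioi 0)).isPreconnected ?_
      (x := x + ε • normal P.poly i) ⟨hb1, ?_⟩ ⟨hy, hpos⟩ h1
    · exact Set.disjoint_left.2 fun z hz => hbd z hz.1 (ne_of_gt hz.2)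
    · rw [mem_preimage, g1]; exact h4
  · refine h2 (mem_fill_of_isPreconnected (hconv (Iio 0) (convex_Iio 0)).isPreconnected ?_
      ⟨hy, hneg⟩ (y := x - ε • normal P.poly i) ⟨hb2, ?_⟩ hyc)
    · exact Set.disjoint_left.2 fun z hz => hbd z hz.1 (ne_of_lt hz.2)
    · rw [mem_preimage, g2]; exact neg_lt_zero.2 h4

end SimplePolygon

/-! ### The bands swept by the edges of a polygon -/

namespace IsMiteredOffset

variable {P : SimplePolygon} {T : ℝ}

theorem pos (hT : IsMiteredOffset P T) : 0 < T := hT.1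

/-- For a point of the edge at time `s₀`, the quantity in `left` and `right` is the positive edge
length at time `s` times `s₀ - s`, so its sign compares the two times. The orientation of the
polygon provides `outer`. -/
theorem motion (hT : IsMiteredOffset P T) :
    InwardMotion (fun s => (offset P.poly s).vertices) T := by
  have hP := P.simple
  have key : ∀ i, ∀ s ∈ Icc 0 T, ∀ s₀ ∈ Icc 0 T, ∀ x ∈ segment ℝ (offset P.poly s₀ i)
      (offset P.poly s₀ (finRotate P.n i)),
      ∃ L > 0, (inner ℝ (rot (offset P.poly s (finRotate P.n i) - offset P.poly s i))
        (x - offset P.poly s i) : ℝ) = L * (s₀ - s) := by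
    intro i s hs s₀ hs₀ x hx
    refine ⟨_, hP.offset_len_pos hT.2 hs i false, ?_⟩
    have hx0 := ((hP.mem_segment_offset_iff hT.2 hs₀ i).1 hx).1
    set L := len P.poly i - s * (kap P.poly i false + kap P.poly i (!false)) with hL
    have hdiff : offset P.poly s (finRotate P.n i) = offset P.poly s i + L • fdir P.poly i false :=
      hP.offset_corner_not i false s
    rw [hdiff, add_sub_cancel_left, rot_smul, ← IsSimple.normal_eq, real_inner_smul_left]
    congr 1
    have h4 : hgt P.poly i (offset P.poly s i) = s := hP.hgt_offset i false s
    have h5 : x - offset P.poly s i = (x - P.poly i) - (offset P.poly s i - P.poly i) := by module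
    rw [h5, inner_sub_right]
    change hgt P.poly i x - hgt P.poly i (offset P.poly s i) = _
    rw [h4, hx0]
  refine ⟨fun i => ?_, hT.2, ?_, ?_, ?_⟩
  · simp only [offset_apply]
    fun_prop
  · intro i s hs s₀ hs₀ x hx hlt
    obtain ⟨L, hL, h⟩ := key i s hs s₀ hs₀ x hx
    rw [h]
    exact mul_pos hL (sub_pos.2 hlt)
  · intro i s hs s₀ hs₀ x hx hlt
    obtain ⟨L, hL, h⟩ := key i s hs s₀ hs₀ x hx
    rw [h]
    exact mul_neg_of_pos_of_neg hL (sub_neg.2 hlt)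
  · simp only [offset_zero]
    intro i x hx
    have hseg := openSegment_subset_segment _ _ _ hx
    have hend1 : x ≠ P.poly i := by
      rintro rfl
      exact hP.ne i (left_mem_openSegment_iff.1 hx)
    have hend2 : x ≠ P.poly (finRotate P.n i) := by
      rintro rfl
      exact hP.ne i (right_mem_openSegment_iff.1 hx)
    have hccw := P.ccw i x (by rw [edgeSet_eq]; exact hseg) hend1 hend2
    have hlim : Tendsto (fun ε : ℝ => x - ε • normal P.poly i) (𝓝[>] 0) (𝓝 x) := by
      have : Tendsto (fun ε : ℝ => x - ε • normal P.poly i) (𝓝 0)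
          (𝓝 (x - (0 : ℝ) • normal P.poly i)) := Continuous.tendsto (by fun_prop) 0
      rw [zero_smul, sub_zero] at this
      exact this.mono_left nhdsWithin_le_nhds
    refine hlim.frequently (Eventually.frequently ?_)
    filter_upwards [hccw, self_mem_nhdsWithin] with ε hε hε0
    have hε0 : 0 < ε := hε0
    refine ⟨hε.2, ?_⟩
    have hx0 : hgt P.poly i x = 0 := (hP.mem_segment_iff i |>.1 hseg).1
    have hg : hgt P.poly i (x - ε • normal P.poly i) = -ε := by
      rw [sub_eq_add_neg, ← neg_smul, IsSimple.hgt_add_smul, hx0, (hP.frame i false).nn]; ring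
    have hd : P.poly (finRotate P.n i) - P.poly i = len P.poly i • fdir P.poly i false := by
      have := hP.corner_not i false
      simp only [corner, Bool.not_false] at this
      rw [this, add_sub_cancel_left]
    rw [hd, rot_smul, ← IsSimple.normal_eq, real_inner_smul_left]
    change len P.poly i * hgt P.poly i _ < 0
    rw [hg]
    nlinarith [hP.len_pos i]

theorem mem_segment_of_band (hT : IsMiteredOffset P T) {i : Fin P.n} {x : Plane}
    (hx : x ∈ band P.poly T i) : x ∈ segment ℝ (offset P.poly (hgt P.poly i x) i)
      (offset P.poly (hgt P.poly i x) (finRotate P.n i)) :=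
  (P.simple.mem_segment_offset_iff hT.2 hx.1 i).2 ⟨rfl, hx.2⟩

/-- A point of a band is met at the time given by its height, and a boundary point is met at time 0.
-/
theorem hgt_eq_zero_of_boundary (hT : IsMiteredOffset P T) {i : Fin P.n} {x : Plane}
    (hx : x ∈ band P.poly T i) (hb : x ∈ P.poly.boundary ℝ) : hgt P.poly i x = 0 := by
  obtain ⟨j, hj⟩ := mem_boundary.1 hb
  refine hT.motion.time_unique hx.1 ⟨le_rfl, hT.pos.le⟩ (hT.mem_segment_of_band hx) (j := j) ?_
  rw [offset_zero]
  exact hj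

theorem mem_edge_of_boundary (hT : IsMiteredOffset P T) {i : Fin P.n} {x : Plane}
    (hx : x ∈ band P.poly T i) (hb : x ∈ P.poly.boundary ℝ) : x ∈ P.edge i :=
  SimplePolygon.mem_edge_iff.2 ⟨hT.hgt_eq_zero_of_boundary hx hb, hx.2⟩

theorem band_subset_carrier (hT : IsMiteredOffset P T) (i : Fin P.n) :
    band P.poly T i ⊆ P.carrier := by
  intro x hx
  rcases eq_or_lt_of_le hx.1.1 with h0 | h0
  · exact SimplePolygon.edge_subset_carrier i (SimplePolygon.mem_edge_iff.2 ⟨h0.symm, hx.2⟩)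
  · have := hT.motion.mem_fill_zero ⟨h0, hx.1.2⟩ (hT.mem_segment_of_band hx)
    rwa [offset_zero] at this

theorem mem_inside_of_band (hT : IsMiteredOffset P T) {i : Fin P.n} {x : Plane}
    (hx : x ∈ band P.poly T i) (h0 : 0 < hgt P.poly i x) : x ∈ P.inside :=
  ⟨hT.band_subset_carrier i hx, fun hb => h0.ne' (hT.hgt_eq_zero_of_boundary hx hb)⟩

/-- The region bounded by the offset curve. -/
theorem fill_subset_inside (hT : IsMiteredOffset P T) :
    fill ((offset P.poly T).boundary ℝ) ⊆ P.inside := by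
  intro x hx
  refine ⟨fill_subset_fill (fun y hy => ?_) hx, fun hb => ?_⟩
  · obtain ⟨k, hk⟩ := mem_boundary.1 hy
    have := hT.motion.mem_fill_zero ⟨hT.pos, le_rfl⟩ hk
    rwa [offset_zero] at this
  · obtain ⟨j, hj⟩ := mem_boundary.1 hb
    refine hT.motion.notMem_fill le_rfl hT.pos le_rfl (i := j) ?_ hx
    rw [offset_zero]
    exact hj

theorem hgt_eq_of_fill (hT : IsMiteredOffset P T) {i : Fin P.n} {x : Plane}
    (hx : x ∈ band P.poly T i) (hf : x ∈ fill ((offset P.poly T).boundary ℝ)) :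
    hgt P.poly i x = T := by
  rcases eq_or_lt_of_le hx.1.2 with h | h
  · exact h
  · exact absurd hf (hT.motion.notMem_fill hx.1.1 h le_rfl (hT.mem_segment_of_band hx))

/-- The bands of two edges of a polygon meet at most in the bisector at a common end. -/
theorem band_inter_band (hT : IsMiteredOffset P T) {i j : Fin P.n} (hij : i ≠ j) {x : Plane}
    (hi : x ∈ band P.poly T i) (hj : x ∈ band P.poly T j) :
    ∃ b, corner i b = corner j (!b) ∧ acoord P.poly i b x = 0 ∧ acoord P.poly j (!b) x = 0 ∧
      hgt P.poly i x = hgt P.poly j x := by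
  have hi' := hT.mem_segment_of_band hi
  have hj' := hT.mem_segment_of_band hj
  -- Both heights are times at which the curve meets `x`, so they agree, and at this one time the
  -- curve is simple.
  have heq : hgt P.poly i x = hgt P.poly j x := hT.motion.time_unique hi.1 hj.1 hi' hj'
  rw [← heq] at hj'
  rcases (hT.2 _ hi.1).eq_of_mem hij hi' hj' with h1 | h1
  · refine ⟨true, h1.1.symm, ?_, ?_, heq⟩
    · rw [h1.2, h1.1]; exact P.simple.acoord_offset i true _
    · rw [h1.2]; exact P.simple.acoord_offset j false _
  · refine ⟨false, h1.1, ?_, ?_, heq⟩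
    · rw [h1.2]; exact P.simple.acoord_offset i false _
    · rw [h1.2, h1.1]; exact P.simple.acoord_offset j true _

end IsMiteredOffset

end EulerTransform

namespace EulerTransform
variable {ι : Type*}

/-- Polar coordinates: the image of an interval times the connected unit circle. -/
theorem isPreconnected_ball_diff (v : Plane) (r : ℝ) :
    IsPreconnected (Metric.ball v r \ {v}) := by
  have hS : IsPreconnected (Metric.sphere (0 : Plane) 1) :=
    isPreconnected_sphere (by
      rw [← Module.finrank_eq_rank, finrank_euclideanSpace_fin]; norm_num) 0 1
  have h : Metric.ball v r \ {v} =
      (fun z : ℝ × Plane => v + z.1 • z.2) '' (Ioo 0 r ×ˢ Metric.sphere (0 : Plane) 1) := by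
    ext x
    constructor
    · rintro ⟨hx, hxv⟩
      have hne : x - v ≠ 0 := sub_ne_zero.2 hxv
      have hpos := norm_pos_iff.2 hne
      refine ⟨(‖x - v‖, ‖x - v‖⁻¹ • (x - v)), ⟨⟨hpos, mem_ball_iff_norm.1 hx⟩, ?_⟩, ?_⟩
      · rw [mem_sphere_zero_iff_norm, norm_smul, norm_inv, norm_norm, inv_mul_cancel₀ hpos.ne']
      · simp only [smul_smul]
        rw [mul_inv_cancel₀ hpos.ne', one_smul, add_sub_cancel]
    · rintro ⟨⟨s, u⟩, ⟨hs, hu⟩, rfl⟩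
      rw [mem_sphere_zero_iff_norm] at hu
      refine ⟨?_, ?_⟩
      · rw [mem_ball_iff_norm, add_sub_cancel_left, norm_smul, hu, mul_one,
          Real.norm_of_nonneg hs.1.le]
        exact hs.2
      · rw [mem_singleton_iff, add_eq_left, smul_eq_zero, not_or]
        refine ⟨hs.1.ne', ?_⟩
        rintro rfl
        simp at hu
  rw [h]
  exact (isPreconnected_Ioo.prod hS).image _ (by fun_prop)

theorem sym2_corner {n m : ℕ} {p : Polygon Plane n} {q : Polygon Plane m} {i : Fin n} {j : Fin m}
    (h : s(p i, p (finRotate n i)) = s(q j, q (finRotate m j))) (b : Bool) :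
    ∃ c, p (corner i b) = q (corner j c) ∧ p (corner i (!b)) = q (corner j (!c)) := by
  rcases Sym2.eq_iff.1 h with ⟨h1, h2⟩ | ⟨h1, h2⟩
  · refine ⟨b, ?_⟩
    cases b
    exacts [⟨h1, h2⟩, ⟨h2, h1⟩]
  · refine ⟨!b, ?_⟩
    cases b
    exacts [⟨h1, h2⟩, ⟨h2, h1⟩]

namespace SimplePolygon

variable {P : SimplePolygon}

theorem exists_corner {i k : Fin P.n} (h : P.poly k ∈ P.edge i) : ∃ b, k = corner i b := by
  rcases P.simple.eq_of_vertex_mem h with h | h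
  · exact ⟨false, h.symm⟩
  · exact ⟨true, h.symm⟩

theorem vertices_subset_boundary : P.vertices ⊆ P.poly.boundary ℝ := by
  rintro _ ⟨k, rfl⟩
  exact edge_subset_boundary k (corner_mem_edge k false)

theorem lineMap_mem_openEdge (i : Fin P.n) {r : ℝ} (hr : r ∈ Ioo (0 : ℝ) 1) :
    AffineMap.lineMap (P.poly i) (P.poly (finRotate P.n i)) r ∈ openEdge P.poly i := by
  have hl := P.simple.len_pos i
  have hs : (1 - r) + r = 1 := by ring
  rw [AffineMap.lineMap_apply_module]
  have h0 := P.simple.hgt_corner i false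
  have h1 := P.simple.hgt_corner i true
  have h2 := P.simple.acoord_corner i false
  have h3 := P.simple.acoord_corner i true
  have h4 := P.simple.acoord_corner_not i false
  have h5 := P.simple.acoord_corner_not i true
  simp only [corner, Bool.not_false, Bool.not_true] at h0 h1 h2 h3 h4 h5
  refine ⟨?_, fun b => ?_⟩
  · rw [IsSimple.hgt_combo _ _ _ hs, h0, h1]; ring
  · rw [IsSimple.acoord_combo _ _ _ _ hs]
    cases b
    · rw [h2, h4]; nlinarith [hr.1]
    · rw [h3, h5]; nlinarith [hr.2]

theorem edge_subset_closure_openEdge (i : Fin P.n) : P.edge i ⊆ closure (openEdge P.poly i) := by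
  rw [edge, ← closure_openSegment, openSegment_eq_image_lineMap]
  refine closure_mono ?_
  rintro _ ⟨r, hr, rfl⟩
  exact lineMap_mem_openEdge i hr

theorem notMem_vertices_of_openEdge {i : Fin P.n} {x : Plane} (hx : x ∈ openEdge P.poly i) :
    x ∉ P.vertices := by
  rintro ⟨k, rfl⟩
  obtain ⟨b, rfl⟩ := exists_corner (openEdge_subset_edge i hx)
  exact (hx.2 b).ne' (P.simple.acoord_corner i b)

/-- Every point of an edge is a limit of interior points. -/
theorem edge_subset_closure_inside (i : Fin P.n) : P.edge i ⊆ closure P.inside := by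
  refine (edge_subset_closure_openEdge i).trans (closure_minimal ?_ isClosed_closure)
  intro x hx
  obtain ⟨r, hr, hball⟩ := exists_ball_of_openEdge hx
  have hlim : Tendsto (fun ε : ℝ => x + ε • normal P.poly i) (𝓝[>] 0) (𝓝 x) := by
    have : Tendsto (fun ε : ℝ => x + ε • normal P.poly i) (𝓝 0)
        (𝓝 (x + (0 : ℝ) • normal P.poly i)) := Continuous.tendsto (by fun_prop) 0
    rw [zero_smul, add_zero] at this
    exact this.mono_left nhdsWithin_le_nhds
  refine mem_closure_of_tendsto hlim ?_
  filter_upwards [hlim.eventually (Metric.ball_mem_nhds x hr), self_mem_nhdsWithin] with ε h1 h2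
  refine (hball _ h1).1 ?_
  rw [IsSimple.hgt_add_smul, hx.1, (P.simple.frame i false).nn]
  have : 0 < ε := h2
  linarith

end SimplePolygon

namespace PolygonalComplex

/-! ### Flags of a complex -/

/-- A flag: a polygon of the complex, one of its edges, and one of the two ends of this edge. -/
structure Flag (K : PolygonalComplex ι) where
  f : ι
  i : Fin (K.face f).n
  b : Bool

namespace Flag

variable {K : PolygonalComplex ι}

/-- The flag at the other end of the edge. -/
def flip (φ : K.Flag) : K.Flag := ⟨φ.f, φ.i, !φ.b⟩

/-- The polygon of a flag. -/
abbrev poly (φ : K.Flag) : Polygon Plane (K.face φ.f).n := (K.face φ.f).poly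

/-- The index of the vertex of a flag. -/
def idx (φ : K.Flag) : Fin (K.face φ.f).n := corner φ.i φ.b

/-- The vertex of a flag. -/
def vtx (φ : K.Flag) : Plane := φ.poly φ.idx

/-- The edge of a flag. -/
def edge (φ : K.Flag) : Sym2 Plane := s(φ.vtx, φ.flip.vtx)

/-- The flags at the two sides of one edge of the complex, with the same vertex. -/
def Twin (φ ψ : K.Flag) : Prop := φ.f ≠ ψ.f ∧ φ.vtx = ψ.vtx ∧ φ.flip.vtx = ψ.flip.vtx

@[simp] theorem flip_flip (φ : K.Flag) : φ.flip.flip = φ := by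
  cases φ; simp [flip]

theorem edge_flip (φ : K.Flag) : φ.flip.edge = φ.edge := by
  rw [edge, flip_flip, edge, Sym2.eq_swap]

theorem vtx_mem_edge (φ : K.Flag) : φ.vtx ∈ φ.edge := Sym2.mem_mk_left _ _

theorem vtx_flip_ne (φ : K.Flag) : φ.flip.vtx ≠ φ.vtx := fun h =>
  corner_not_ne (K.face φ.f).simple.1 φ.i φ.b ((K.face φ.f).simple.inj h)

theorem edge_eq (φ : K.Flag) :
    φ.edge = s(φ.poly φ.i, φ.poly (finRotate (K.face φ.f).n φ.i)) := by
  obtain ⟨f, i, b⟩ := φ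
  cases b
  · rfl
  · rw [edge, Sym2.eq_swap]; rfl

theorem edge_mem (φ : K.Flag) : φ.edge ∈ (K.face φ.f).edges := ⟨φ.i, φ.edge_eq.symm⟩

theorem edge_mem_edges (φ : K.Flag) : φ.edge ∈ K.edges := mem_iUnion.2 ⟨_, φ.edge_mem⟩

theorem seg_edge (φ : K.Flag) : seg φ.edge = (K.face φ.f).edge φ.i := by
  rw [edge_eq, seg_mk]; rfl

theorem vtx_mem_vertices (φ : K.Flag) : φ.vtx ∈ (K.face φ.f).vertices := ⟨_, rfl⟩

theorem vtx_mem_seg (φ : K.Flag) : φ.vtx ∈ seg φ.edge := by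
  rw [seg_edge]; exact SimplePolygon.corner_mem_edge φ.i φ.b

theorem Twin.symm {φ ψ : K.Flag} (h : φ.Twin ψ) : ψ.Twin φ := ⟨h.1.symm, h.2.1.symm, h.2.2.symm⟩

theorem Twin.flip {φ ψ : K.Flag} (h : φ.Twin ψ) : φ.flip.Twin ψ.flip :=
  ⟨h.1, h.2.2, by rw [flip_flip, flip_flip]; exact h.2.1⟩

theorem Twin.edge_eq {φ ψ : K.Flag} (h : φ.Twin ψ) : φ.edge = ψ.edge := by
  rw [edge, edge, h.2.1, h.2.2]

theorem exists_of_mem {f : ι} {e : Sym2 Plane} {v : Plane} (he : e ∈ (K.face f).edges)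
    (hv : v ∈ e) : ∃ φ : K.Flag, φ.f = f ∧ φ.edge = e ∧ φ.vtx = v := by
  obtain ⟨i, rfl⟩ := he
  rcases Sym2.mem_iff.1 hv with rfl | rfl
  · exact ⟨⟨f, i, false⟩, rfl, edge_eq _, rfl⟩
  · exact ⟨⟨f, i, true⟩, rfl, edge_eq _, rfl⟩

theorem exists_of_edges {e : Sym2 Plane} (he : e ∈ K.edges) : ∃ φ : K.Flag, φ.edge = e := by
  obtain ⟨f, i, rfl⟩ := mem_iUnion.1 he
  exact ⟨⟨f, i, false⟩, edge_eq _⟩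

/-- Flags with the same edge and the same vertex on different polygons are twins. -/
theorem twin_of_edge_eq {φ ψ : K.Flag} (hf : φ.f ≠ ψ.f) (he : φ.edge = ψ.edge)
    (hv : φ.vtx = ψ.vtx) : φ.Twin ψ := by
  refine ⟨hf, hv, ?_⟩
  rw [edge, edge, hv] at he
  exact Sym2.congr_right.1 he

theorem ext_of_vtx {φ ψ : K.Flag} (hf : φ.f = ψ.f) (hb : φ.b = ψ.b) (hv : φ.vtx = ψ.vtx) :
    φ = ψ := by
  obtain ⟨f, i, b⟩ := φ
  obtain ⟨g, j, c⟩ := ψ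
  dsimp only at hf hb
  subst hf hb
  have h : corner i b = corner j b := (K.face f).simple.inj hv
  cases b
  · have : i = j := h
    rw [this]
  · have : i = j := (finRotate _).injective h
    rw [this]

theorem eq_or_of_vtx {φ ψ : K.Flag} (hf : φ.f = ψ.f) (hv : φ.vtx = ψ.vtx) :
    φ = ψ ∨ ψ.b = !φ.b := by
  by_cases hb : φ.b = ψ.b
  · exact Or.inl (ext_of_vtx hf hb hv)
  · right
    revert hb
    cases φ.b <;> cases ψ.b <;> simp

theorem eq_of_edge_eq {φ ψ : K.Flag} (hf : φ.f = ψ.f) (he : φ.edge = ψ.edge)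
    (hv : φ.vtx = ψ.vtx) : φ = ψ := by
  obtain ⟨f, i, b⟩ := φ
  obtain ⟨g, j, c⟩ := ψ
  dsimp only at hf
  subst hf
  have h1 : corner i b = corner j c := (K.face f).simple.inj hv
  rw [edge, edge, hv] at he
  have h2 : corner i (!b) = corner j (!c) := (K.face f).simple.inj (Sym2.congr_right.1 he)
  have h3 := finRotate_finRotate_ne (K.face f).simple.1 j
  cases b <;> cases c <;> simp only [corner, Bool.not_true, Bool.not_false] at h1 h2
  · rw [h1]
  · rw [h1] at h2; exact absurd h2 h3
  · rw [h2] at h1; exact absurd h1 h3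
  · rw [h2]

end Flag

variable {K : PolygonalComplex ι}

/-! ### How the polygons of a complex meet -/

theorem mem_boundary_of_mem {f g : ι} (hfg : f ≠ g) {x : Plane} (hf : x ∈ (K.face f).carrier)
    (hg : x ∈ (K.face g).carrier) : x ∈ (K.face f).poly.boundary ℝ := by
  have hx : x ∈ (K.face f).carrier ∩ (K.face g).carrier := ⟨hf, hg⟩
  rcases K.inter_face f g hfg with h | ⟨v, hv, -, h⟩ | ⟨e, ⟨i, rfl⟩, -, h⟩
  · rw [h] at hx; exact hx.elim
  · rw [h, mem_singleton_iff] at hx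
    rw [hx]
    exact SimplePolygon.vertices_subset_boundary hv
  · rw [h, seg_mk] at hx
    exact mem_boundary.2 ⟨i, hx⟩

theorem eq_of_mem_inside {f g : ι} {x : Plane} (hf : x ∈ (K.face f).inside)
    (hg : x ∈ (K.face g).carrier) : f = g := by
  by_contra h
  exact hf.2 (mem_boundary_of_mem h hf.1 hg)

theorem mem_vertices_of_mem {f g : ι} {v : Plane} (hv : v ∈ (K.face f).vertices)
    (hg : v ∈ (K.face g).carrier) : v ∈ (K.face g).vertices := by
  by_cases hfg : f = g
  · exact hfg ▸ hv
  have hx : v ∈ (K.face f).carrier ∩ (K.face g).carrier :=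
    ⟨SimplePolygon.boundary_subset_carrier (SimplePolygon.vertices_subset_boundary hv), hg⟩
  rcases K.inter_face f g hfg with h | ⟨w, -, hw, h⟩ | ⟨e, ⟨i, rfl⟩, ⟨j, hj⟩, h⟩
  · rw [h] at hx; exact hx.elim
  · rw [h, mem_singleton_iff] at hx
    rwa [hx]
  · rw [h, seg_mk] at hx
    obtain ⟨k, rfl⟩ := hv
    obtain ⟨b, rfl⟩ := SimplePolygon.exists_corner hx
    obtain ⟨c, hc, -⟩ := sym2_corner hj.symm b
    exact ⟨_, hc.symm⟩

/-- Edges of different polygons coincide or meet in common vertices. -/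
theorem edge_inter_edge {f g : ι} (hfg : f ≠ g) {i : Fin (K.face f).n} {j : Fin (K.face g).n}
    {x : Plane} (hi : x ∈ (K.face f).edge i) (hj : x ∈ (K.face g).edge j) :
    s((K.face f).poly i, (K.face f).poly (finRotate _ i)) =
      s((K.face g).poly j, (K.face g).poly (finRotate _ j)) ∨
    ∃ b c, x = (K.face f).poly (corner i b) ∧ x = (K.face g).poly (corner j c) := by
  have hfc := SimplePolygon.edge_subset_carrier i hi
  have hgc := SimplePolygon.edge_subset_carrier j hj
  have key : x ∈ (K.face f).vertices → x ∈ (K.face g).vertices →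
      ∃ b c, x = (K.face f).poly (corner i b) ∧ x = (K.face g).poly (corner j c) := by
    rintro ⟨k, rfl⟩ ⟨l, hl⟩
    obtain ⟨b, rfl⟩ := SimplePolygon.exists_corner hi
    rw [← hl] at hj
    obtain ⟨c, rfl⟩ := SimplePolygon.exists_corner hj
    exact ⟨b, c, rfl, hl.symm⟩
  rcases K.inter_face f g hfg with h | ⟨w, hw, hw', h⟩ | ⟨e, ⟨a, ha⟩, ⟨c, hc⟩, h⟩
  · exact absurd (h ▸ (⟨hfc, hgc⟩ : x ∈ (K.face f).carrier ∩ (K.face g).carrier)) (notMem_empty x)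
  · have hx : x = w := by
      have : x ∈ (K.face f).carrier ∩ (K.face g).carrier := ⟨hfc, hgc⟩
      rwa [h] at this
    exact Or.inr (key (hx ▸ hw) (hx ▸ hw'))
  · have hx : x ∈ seg e := h ▸ (⟨hfc, hgc⟩ : x ∈ (K.face f).carrier ∩ (K.face g).carrier)
    have hxa : x ∈ (K.face f).edge a := by rw [← ha, seg_mk] at hx; exact hx
    have hxc : x ∈ (K.face g).edge c := by rw [← hc, seg_mk] at hx; exact hx
    by_cases hia : i = a
    · by_cases hjc : j = c
      · left; rw [hia, hjc]; exact ha.trans hc.symm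
      · have hv : x ∈ (K.face g).vertices := by
          rcases (K.face g).simple.eq_of_mem hjc hj hxc with h1 | h1
          exacts [⟨_, h1.2.symm⟩, ⟨_, h1.2.symm⟩]
        exact Or.inr (key (mem_vertices_of_mem hv hfc) hv)
    · have hv : x ∈ (K.face f).vertices := by
        rcases (K.face f).simple.eq_of_mem hia hi hxa with h1 | h1
        exacts [⟨_, h1.2.symm⟩, ⟨_, h1.2.symm⟩]
      exact Or.inr (key hv (mem_vertices_of_mem hv hgc))

/-- Two polygons have at most one edge in common. -/
theorem eq_of_common_edges {f g : ι} (hfg : f ≠ g) {e e' : Sym2 Plane}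
    (he : e ∈ (K.face f).edges) (he' : e' ∈ (K.face f).edges) (heg : e ∈ (K.face g).edges)
    (heg' : e' ∈ (K.face g).edges) : e = e' := by
  have hsub : ∀ e ∈ (K.face f).edges, e ∈ (K.face g).edges →
      seg e ⊆ (K.face f).carrier ∩ (K.face g).carrier := by
    rintro _ ⟨i, rfl⟩ ⟨j, hj⟩
    refine subset_inter ?_ ?_
    · rw [seg_mk]; exact SimplePolygon.edge_subset_carrier i
    · rw [← hj, seg_mk]; exact SimplePolygon.edge_subset_carrier j
  -- An interior point of an edge lies on no other edge of the polygon and is not a vertex. So a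
  -- common edge forces the intersection of the two polygons to be an edge, and that edge is the
  -- common one.
  have hlen : ∀ i : Fin (K.face f).n, ∃ x, x ∈ openEdge (K.face f).poly i := fun i =>
    ⟨_, SimplePolygon.lineMap_mem_openEdge i (r := 1 / 2) ⟨by norm_num, by norm_num⟩⟩
  have hall : ∀ e₀ ∈ (K.face f).edges, e₀ ∈ (K.face g).edges → ∀ e₁ ∈ (K.face f).edges,
      (K.face f).carrier ∩ (K.face g).carrier = seg e₁ → e₀ = e₁ := by
    rintro _ ⟨i, rfl⟩ hg _ ⟨j, rfl⟩ hj
    obtain ⟨x, hx⟩ := hlen i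
    have hx' := hsub _ ⟨i, rfl⟩ hg (by rw [seg_mk]; exact SimplePolygon.openEdge_subset_edge i hx)
    rw [hj, seg_mk] at hx'
    have hij : i = j := by
      by_contra hij
      exact SimplePolygon.notMem_edge_of_openEdge hij hx hx'
    rw [hij]
  obtain ⟨i, rfl⟩ := he
  obtain ⟨x, hx⟩ := hlen i
  have hxm := hsub _ ⟨i, rfl⟩ heg (by rw [seg_mk]; exact SimplePolygon.openEdge_subset_edge i hx)
  rcases K.inter_face f g hfg with h | ⟨w, hw, -, h⟩ | ⟨e₁, he₁, -, h⟩
  · rw [h] at hxm; exact hxm.elim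
  · rw [h, mem_singleton_iff] at hxm
    exact absurd (hxm ▸ hw) (SimplePolygon.notMem_vertices_of_openEdge hx)
  · rw [hall _ ⟨i, rfl⟩ heg e₁ he₁ h, hall e' he' heg' e₁ he₁ h]

end PolygonalComplex

end EulerTransform

namespace EulerTransform
variable {ι : Type*}

namespace IsSimple

variable {n : ℕ} {p : Polygon Plane n}

theorem fdir_eq (h : IsSimple p) (i : Fin n) (b : Bool) :
    fdir p i b = (‖p (corner i (!b)) - p (corner i b)‖)⁻¹ • (p (corner i (!b)) - p (corner i b)) := by
  have h1 : p (corner i (!b)) - p (corner i b) = len p i • fdir p i b := by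
    rw [h.corner_not, add_sub_cancel_left]
  have h2 : ‖fdir p i b‖ = 1 := by
    have := (h.frame i b).dd
    rw [real_inner_self_eq_norm_sq] at this
    nlinarith [norm_nonneg (fdir p i b)]
  rw [h1, norm_smul, h2, mul_one, Real.norm_of_nonneg (h.len_pos i).le, smul_smul,
    inv_mul_cancel₀ (h.len_pos i).ne', one_smul]

theorem normal_eq_fdir (p : Polygon Plane n) (i : Fin n) (b : Bool) :
    normal p i = (if b then -1 else 1 : ℝ) • rot (fdir p i b) := by
  cases b
  · simp [normal_eq]
  · rw [← Bool.not_false, fdir_not, rot_neg, normal_eq]; simp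

theorem len_eq (i : Fin n) (b : Bool) : len p i = ‖p (corner i (!b)) - p (corner i b)‖ := by
  cases b
  · rfl
  · rw [norm_sub_rev]; rfl

end IsSimple

namespace PolygonalComplex

variable {K : PolygonalComplex ι}

/-! ### Metric data of flags and twins -/

namespace Flag

/-- The unit vector pointing from the vertex of a flag into its edge. -/
noncomputable def dir (φ : K.Flag) : Plane := fdir φ.poly φ.i φ.b

/-- The unit normal of the edge of a flag that points into its polygon. -/
noncomputable def nrm (φ : K.Flag) : Plane := normal φ.poly φ.i

/-- The length of the edge of a flag. -/
noncomputable def len (φ : K.Flag) : ℝ := EulerTransform.len φ.poly φ.i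

theorem simple (φ : K.Flag) : IsSimple φ.poly := (K.face φ.f).simple

theorem frame (φ : K.Flag) : IsFrame φ.dir φ.nrm := φ.simple.frame φ.i φ.b

/-- The edge of two twins is traversed in opposite directions. -/
theorem Twin.b_eq {φ ψ : K.Flag} (h : φ.Twin ψ) : ψ.b = !φ.b := by
  by_contra hb
  have hb : φ.b = ψ.b := by
    revert hb
    cases φ.b <;> cases ψ.b <;> simp
  obtain ⟨f, i, b⟩ := φ
  obtain ⟨g, j, c⟩ := ψ
  dsimp only at hb
  subst hb
  obtain ⟨hfg, h1, h2⟩ := h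
  dsimp only at hfg
  change (K.face f).poly (corner i b) = (K.face g).poly (corner j b) at h1
  change (K.face f).poly (corner i (!b)) = (K.face g).poly (corner j (!b)) at h2
  -- If both polygons traversed the edge in the same direction, they would have the same inner
  -- normal and overlap near the midpoint of the edge.
  have hc : ∀ c, (K.face f).poly (corner i c) = (K.face g).poly (corner j c) := bool_cases b h1 h2
  have hd : fdir (K.face f).poly i false = fdir (K.face g).poly j false := by
    rw [(K.face f).simple.fdir_eq, (K.face g).simple.fdir_eq, hc, hc]
  have hn : normal (K.face f).poly i = normal (K.face g).poly j := by
    rw [IsSimple.normal_eq, IsSimple.normal_eq, hd]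
  have hh : ∀ x, hgt (K.face f).poly i x = hgt (K.face g).poly j x := fun x => by
    rw [hgt, hgt, hn]; exact congrArg (fun v => inner ℝ _ (x - v)) (hc false)
  have hx : AffineMap.lineMap ((K.face f).poly i) ((K.face f).poly (finRotate _ i)) (1 / 2 : ℝ)
      ∈ openEdge (K.face f).poly i :=
    SimplePolygon.lineMap_mem_openEdge i ⟨by norm_num, by norm_num⟩
  have hy : AffineMap.lineMap ((K.face g).poly j) ((K.face g).poly (finRotate _ j)) (1 / 2 : ℝ)
      ∈ openEdge (K.face g).poly j :=
    SimplePolygon.lineMap_mem_openEdge j ⟨by norm_num, by norm_num⟩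
  rw [show (K.face g).poly j = (K.face f).poly i from (hc false).symm,
    show (K.face g).poly (finRotate _ j) = (K.face f).poly (finRotate _ i) from (hc true).symm] at hy
  set x : Plane := AffineMap.lineMap ((K.face f).poly i) ((K.face f).poly (finRotate _ i)) (1 / 2 : ℝ)
  obtain ⟨r, hr, hball⟩ := SimplePolygon.exists_ball_of_openEdge hx
  obtain ⟨s, hs, hball'⟩ := SimplePolygon.exists_ball_of_openEdge hy
  have hpos := lt_min hr hs
  have hnn := ((K.face f).simple.frame i false).nn
  have hnorm : ‖normal (K.face f).poly i‖ = 1 := by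
    rw [real_inner_self_eq_norm_sq] at hnn
    nlinarith [norm_nonneg (normal (K.face f).poly i)]
  have hz : x + (min r s / 2) • normal (K.face f).poly i ∈ Metric.ball x (min r s) := by
    rw [mem_ball_iff_norm, add_sub_cancel_left, norm_smul, hnorm, mul_one,
      Real.norm_of_nonneg (by positivity)]
    linarith
  have hzh : 0 < hgt (K.face f).poly i (x + (min r s / 2) • normal (K.face f).poly i) := by
    rw [IsSimple.hgt_add_smul, hx.1, hnn]; linarith
  refine hfg (eq_of_mem_inside ((hball _ (Metric.ball_subset_ball (min_le_left _ _) hz)).1 hzh) ?_)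
  exact ((hball' _ (Metric.ball_subset_ball (min_le_right _ _) hz)).1 (by rw [← hh]; exact hzh)).1

theorem Twin.dir_eq {φ ψ : K.Flag} (h : φ.Twin ψ) : ψ.dir = φ.dir := by
  rw [dir, dir, φ.simple.fdir_eq, ψ.simple.fdir_eq]
  have h1 : φ.poly (corner φ.i φ.b) = ψ.poly (corner ψ.i ψ.b) := h.2.1
  have h2 : φ.poly (corner φ.i (!φ.b)) = ψ.poly (corner ψ.i (!ψ.b)) := h.2.2
  rw [h1, h2]

theorem Twin.len_eq {φ ψ : K.Flag} (h : φ.Twin ψ) : ψ.len = φ.len := by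
  rw [len, len, IsSimple.len_eq φ.i φ.b, IsSimple.len_eq ψ.i ψ.b]
  have h1 : φ.poly (corner φ.i φ.b) = ψ.poly (corner ψ.i ψ.b) := h.2.1
  have h2 : φ.poly (corner φ.i (!φ.b)) = ψ.poly (corner ψ.i (!ψ.b)) := h.2.2
  rw [h1, h2]

theorem Twin.nrm_eq {φ ψ : K.Flag} (h : φ.Twin ψ) : ψ.nrm = -φ.nrm := by
  rw [nrm, nrm, IsSimple.normal_eq_fdir φ.poly _ φ.b, IsSimple.normal_eq_fdir ψ.poly _ ψ.b]
  have h1 : fdir ψ.poly ψ.i ψ.b = fdir φ.poly φ.i φ.b := h.dir_eq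
  rw [h1, h.b_eq]
  cases φ.b <;> simp

/-- Of three polygons on one edge, two would traverse it in the same direction. -/
theorem Twin.unique {φ ψ χ : K.Flag} (h : φ.Twin ψ) (h' : φ.Twin χ) : ψ = χ := by
  by_cases hf : ψ.f = χ.f
  · exact ext_of_vtx hf (by rw [h.b_eq, h'.b_eq]) (h.2.1.symm.trans h'.2.1)
  · have h1 : ψ.Twin χ := ⟨hf, h.2.1.symm.trans h'.2.1, h.2.2.symm.trans h'.2.2⟩
    have := h1.b_eq
    rw [h.b_eq, h'.b_eq] at this
    revert this
    cases φ.b <;> simp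

/-- The distance from the line of the edge of a flag. -/
noncomputable def h (φ : K.Flag) (x : Plane) : ℝ := hgt φ.poly φ.i x

/-- The distance from the bisector at the vertex of a flag. -/
noncomputable def a (φ : K.Flag) (x : Plane) : ℝ := acoord φ.poly φ.i φ.b x

/-- The slope of the bisector at the vertex of a flag. -/
noncomputable def κ (φ : K.Flag) : ℝ := kap φ.poly φ.i φ.b

theorem h_flip (φ : K.Flag) : φ.flip.h = φ.h := rfl

theorem h_eq (φ : K.Flag) (x : Plane) : φ.h x = inner ℝ φ.nrm (x - φ.vtx) :=
  φ.simple.hgt_eq φ.i φ.b x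

theorem a_eq (φ : K.Flag) (x : Plane) : φ.a x = inner ℝ φ.dir (x - φ.vtx) - φ.h x * φ.κ := rfl

theorem a_add (φ : K.Flag) (x : Plane) : φ.a x + φ.flip.a x = φ.len - φ.h x * (φ.κ + φ.flip.κ) :=
  φ.simple.acoord_add φ.i φ.b x

theorem Twin.h_eq {φ ψ : K.Flag} (h : φ.Twin ψ) (x : Plane) : ψ.h x = -φ.h x := by
  rw [Flag.h_eq, Flag.h_eq, h.nrm_eq, h.2.1, inner_neg_left]

theorem Twin.a_eq {φ ψ : K.Flag} (h : φ.Twin ψ) (x : Plane) :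
    ψ.a x = φ.a x + φ.h x * (φ.κ + ψ.κ) := by
  rw [Flag.a_eq, Flag.a_eq, h.h_eq, h.dir_eq, h.2.1]; ring

theorem mem_openEdge_iff (φ : K.Flag) {x : Plane} :
    x ∈ openEdge φ.poly φ.i ↔ φ.h x = 0 ∧ 0 < φ.a x ∧ 0 < φ.flip.a x :=
  and_congr Iff.rfl ⟨fun h => ⟨h _, h _⟩, fun h => bool_cases φ.b h.1 h.2⟩

theorem mem_edge_iff (φ : K.Flag) {x : Plane} :
    x ∈ (K.face φ.f).edge φ.i ↔ φ.h x = 0 ∧ 0 ≤ φ.a x ∧ 0 ≤ φ.flip.a x :=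
  SimplePolygon.mem_edge_iff.trans
    (and_congr Iff.rfl ⟨fun h => ⟨h _, h _⟩, fun h => bool_cases φ.b h.1 h.2⟩)

theorem Twin.openEdge_eq {φ ψ : K.Flag} (h : φ.Twin ψ) :
    openEdge ψ.poly ψ.i = openEdge φ.poly φ.i := by
  ext x
  rw [mem_openEdge_iff, mem_openEdge_iff, h.h_eq, h.a_eq, h.flip.a_eq, h_flip, neg_eq_zero]
  refine and_congr_right fun h0 => ?_
  rw [h0, zero_mul, zero_mul, add_zero, add_zero]

theorem a_vtx (φ : K.Flag) : φ.a φ.vtx = 0 := φ.simple.acoord_corner φ.i φ.b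

theorem h_vtx (φ : K.Flag) : φ.h φ.vtx = 0 := φ.simple.hgt_corner φ.i φ.b

/-- The polygons of two twins cover a neighbourhood of the interior of their edge. -/
theorem Twin.union_mem_nhds {φ ψ : K.Flag} (h : φ.Twin ψ) {x : Plane}
    (hx : x ∈ openEdge φ.poly φ.i) : (K.face φ.f).carrier ∪ (K.face ψ.f).carrier ∈ 𝓝 x := by
  obtain ⟨r, hr, hball⟩ := SimplePolygon.exists_ball_of_openEdge hx
  obtain ⟨s, hs, hball'⟩ := SimplePolygon.exists_ball_of_openEdge (h.openEdge_eq ▸ hx)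
  filter_upwards [Metric.ball_mem_nhds x hr, Metric.ball_mem_nhds x hs] with y hy hy'
  rcases lt_trichotomy (φ.h y) 0 with h0 | h0 | h0
  · right
    refine ((hball' y hy').1 ?_).1
    have := h.h_eq y
    change 0 < ψ.h y
    linarith
  · left
    exact SimplePolygon.edge_subset_carrier _ (SimplePolygon.openEdge_subset_edge _
      ((hball y hy).2.2 h0))
  · left
    exact ((hball y hy).1 h0).1

end Flag

/-! ### Holes and the outside -/

theorem carrier_subset_space (f : ι) : (K.face f).carrier ⊆ K.space := 
  subset_iUnion (fun f => (K.face f).carrier) f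

theorem notMem_compl_of_mem_nhds {x : Plane} (h : K.space ∈ 𝓝 x) (C : K.ComplPolygon) :
    x ∉ C.carrier := by
  obtain ⟨C, y, hy, rfl⟩ := C
  intro hx
  have hx' : x ∈ closure K.spaceᶜ := closure_mono (connectedComponentIn_subset _ _) hx
  rw [closure_compl] at hx'
  exact hx' (mem_interior_iff_mem_nhds.2 h)

theorem Flag.Twin.notMem_compl {φ ψ : K.Flag} (h : φ.Twin ψ) {x : Plane}
    (hx : x ∈ openEdge φ.poly φ.i) (C : K.ComplPolygon) : x ∉ C.carrier :=
  notMem_compl_of_mem_nhds (mem_of_superset (h.union_mem_nhds hx)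
    (union_subset (carrier_subset_space _) (carrier_subset_space _))) C

theorem Flag.Twin.not_seg_subset {φ ψ : K.Flag} (h : φ.Twin ψ) (C : K.ComplPolygon) :
    ¬ seg φ.edge ⊆ C.carrier := by
  intro hsub
  have hx := SimplePolygon.lineMap_mem_openEdge φ.i (r := 1 / 2) ⟨by norm_num, by norm_num⟩
  refine h.notMem_compl hx C (hsub ?_)
  rw [Flag.seg_edge]
  exact SimplePolygon.openEdge_subset_edge _ hx

theorem isClosed_compl (C : K.ComplPolygon) : IsClosed C.carrier := by
  obtain ⟨C, y, hy, rfl⟩ := C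
  exact isClosed_closure

theorem eq_of_mem_compl (hK : K.IsEulerInput) {C D : K.ComplPolygon} {x : Plane}
    (hC : x ∈ C.carrier) (hD : x ∈ D.carrier) : C = D := by
  by_contra h
  exact Set.disjoint_left.1 (hK.disjoint C D h) hC hD

variable [Finite ι]

/-- Near an interior point of an edge that lies on one polygon only, the other side of the edge
belongs to a hole or to the outside. -/
theorem Flag.exists_compl_near (φ : K.Flag) (hφ : ∀ ψ, ¬ φ.Twin ψ) {x : Plane}
    (hx : x ∈ openEdge φ.poly φ.i) :
    ∃ C : K.ComplPolygon, ∃ r > 0, ∀ y ∈ Metric.ball x r, φ.h y ≤ 0 → y ∈ C.carrier := by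
  have hother : ∀ g, g ≠ φ.f → x ∉ (K.face g).carrier := by
    intro g hg hxg
    have hxf := SimplePolygon.edge_subset_carrier _ (SimplePolygon.openEdge_subset_edge _ hx)
    obtain ⟨j, hj⟩ := mem_boundary.1 (mem_boundary_of_mem hg hxg hxf)
    rcases edge_inter_edge hg.symm (SimplePolygon.openEdge_subset_edge _ hx) hj with h | ⟨b, c, h, -⟩
    · obtain ⟨c, h1, h2⟩ := sym2_corner h φ.b
      exact hφ ⟨g, j, c⟩ ⟨hg.symm, h1, h2⟩
    · exact SimplePolygon.notMem_vertices_of_openEdge hx (h ▸ ⟨_, rfl⟩)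
  have hev : ∀ᶠ y in 𝓝 x, ∀ g, g ≠ φ.f → y ∉ (K.face g).carrier := by
    rw [Filter.eventually_all]
    intro g
    by_cases hg : g = φ.f
    · exact Eventually.of_forall fun y hn => absurd hg hn
    · filter_upwards [SimplePolygon.isClosed_carrier.isOpen_compl.mem_nhds (hother g hg)] with y hy _
      exact hy
  obtain ⟨s, hs, hball'⟩ := Metric.eventually_nhds_iff_ball.1 hev
  obtain ⟨r, hr, hball⟩ := SimplePolygon.exists_ball_of_openEdge hx
  -- The half disc beyond the edge is connected and avoids the complex, so it lies in one component
  -- of the complement; the closure takes in the part of the edge in the disc.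
  set B := Metric.ball x (min r s) ∩ φ.h ⁻¹' Iio 0 with hB
  have hpos := lt_min hr hs
  have hBs : B ⊆ K.spaceᶜ := by
    rintro y ⟨hy, hy0⟩ hys
    obtain ⟨g, hg⟩ := mem_iUnion.1 hys
    by_cases hgf : g = φ.f
    · subst hgf
      exact (hball y (Metric.ball_subset_ball (min_le_left _ _) hy)).2.1 hy0 hg
    · exact hball' y (Metric.ball_subset_ball (min_le_right _ _) hy) g hgf hg
  have hBc : IsPreconnected B := by
    refine Convex.isPreconnected ((convex_ball x _).inter ?_)
    intro y hy z hz α β hα hβ hαβ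
    have h1 : φ.h y < 0 := hy
    have h2 : φ.h z < 0 := hz
    change φ.h (α • y + β • z) < 0
    rw [Flag.h, IsSimple.hgt_combo _ _ _ hαβ]
    exact convex_Iio (0 : ℝ) h1 h2 hα hβ hαβ
  have hlim : ∀ y : Plane, Tendsto (fun ε : ℝ => y - ε • φ.nrm) (𝓝[>] 0) (𝓝 y) := fun y => by
    have : Tendsto (fun ε : ℝ => y - ε • φ.nrm) (𝓝 0) (𝓝 (y - (0 : ℝ) • φ.nrm)) :=
      Continuous.tendsto (by fun_prop) 0
    rw [zero_smul, sub_zero] at this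
    exact this.mono_left nhdsWithin_le_nhds
  have hcl : ∀ y ∈ Metric.ball x (min r s), φ.h y ≤ 0 → ∀ᶠ ε in 𝓝[>] (0 : ℝ), y - ε • φ.nrm ∈ B := by
    intro y hy hy0
    filter_upwards [(hlim y).eventually (Metric.isOpen_ball.mem_nhds hy), self_mem_nhdsWithin]
      with ε h1 h2
    refine ⟨h1, ?_⟩
    have h2 : 0 < ε := h2
    change hgt φ.poly φ.i (y - ε • φ.nrm) < 0
    rw [sub_eq_add_neg, ← neg_smul, IsSimple.hgt_add_smul]
    have h3 : (inner ℝ (normal φ.poly φ.i) φ.nrm : ℝ) = 1 := φ.frame.nn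
    have h4 : hgt φ.poly φ.i y ≤ 0 := hy0
    rw [h3]; linarith
  obtain ⟨ε, hε⟩ := (hcl x (Metric.mem_ball_self hpos) hx.1.le).exists
  refine ⟨⟨_, x - ε • φ.nrm, hBs hε, rfl⟩, min r s, hpos, fun y hy hy0 => ?_⟩
  refine closure_mono (hBc.subset_connectedComponentIn hε hBs) ?_
  exact mem_closure_of_tendsto (hlim y) (hcl y hy hy0)

/-- An edge that lies on one polygon only is contained in a hole or in the outside. -/
theorem Flag.exists_compl (hK : K.IsEulerInput) (φ : K.Flag) (hφ : ∀ ψ, ¬ φ.Twin ψ) :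
    ∃ C : K.ComplPolygon, seg φ.edge ⊆ C.carrier := by
  set γ : ℝ → Plane := fun r => AffineMap.lineMap (φ.poly φ.i) (φ.poly (finRotate _ φ.i)) r with hγ
  have hγc : Continuous γ := by
    simp only [γ, AffineMap.lineMap_apply_module]
    fun_prop
  have hγm : ∀ r ∈ Ioo (0 : ℝ) 1, γ r ∈ openEdge φ.poly φ.i := fun r hr =>
    SimplePolygon.lineMap_mem_openEdge _ hr
  have hh : (1 / 2 : ℝ) ∈ Ioo (0 : ℝ) 1 := ⟨by norm_num, by norm_num⟩
  obtain ⟨C, r, hr, hC⟩ := φ.exists_compl_near hφ (hγm _ hh)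
  refine ⟨C, ?_⟩
  -- The parameters whose points lie in `C` form an open subset of (0, 1), because a complementary
  -- polygon that meets `C` is `C`. This subset is also relatively closed and nonempty, hence
  -- everything.
  set u : Set ℝ := Ioo 0 1 ∩ γ ⁻¹' C.carrier with hu
  have huo : IsOpen u := by
    rw [isOpen_iff_mem_nhds]
    rintro s ⟨hs, hsC⟩
    obtain ⟨D, q, hq, hD⟩ := φ.exists_compl_near hφ (hγm s hs)
    have hDC : D = C := eq_of_mem_compl hK
      (hD _ (Metric.mem_ball_self hq) (hγm s hs).1.le) hsC
    subst hDC
    filter_upwards [isOpen_Ioo.mem_nhds hs,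
      hγc.continuousAt.eventually (Metric.ball_mem_nhds _ hq)] with s' h1 h2
    exact ⟨h1, hD _ h2 (hγm s' h1).1.le⟩
  have hsub : Ioo (0 : ℝ) 1 ⊆ u := by
    refine isPreconnected_Ioo.subset_of_closure_inter_subset huo ?_ ?_
    · exact ⟨1 / 2, hh, hh, hC _ (Metric.mem_ball_self hr) (hγm _ hh).1.le⟩
    · rintro s ⟨hs, hs'⟩
      refine ⟨hs', ?_⟩
      have := closure_mono (inter_subset_right (s := Ioo (0:ℝ) 1)) hs
      rwa [((isClosed_compl C).preimage hγc).closure_eq] at this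
  rw [Flag.seg_edge, SimplePolygon.edge, ← closure_openSegment, openSegment_eq_image_lineMap]
  refine closure_minimal ?_ (isClosed_compl C)
  rintro _ ⟨s, hs, rfl⟩
  exact (hsub hs).2

/-- If all edges at `v` of a set of polygons with the vertex `v` are inner edges of this set, then
it covers a neighbourhood of `v`. -/
theorem iUnion_mem_nhds_of_twins {v : Plane} {c : Set ι} (hc : c.Nonempty)
    (hv : ∀ f ∈ c, v ∈ (K.face f).vertices)
    (htw : ∀ φ : K.Flag, φ.f ∈ c → φ.vtx = v → ∃ ψ, φ.Twin ψ ∧ ψ.f ∈ c) :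
    ⋃ f ∈ c, (K.face f).carrier ∈ 𝓝 v := by
  set A := ⋃ f ∈ c, (K.face f).carrier with hA
  have hAcl : IsClosed A := (Set.toFinite c).isClosed_biUnion fun f _ => SimplePolygon.isClosed_carrier
  have hev : ∀ᶠ y in 𝓝 v, ∀ f, ∀ i : Fin (K.face f).n,
      (v ∉ (K.face f).edge i → y ∉ (K.face f).edge i) ∧
      ((K.face f).poly i ≠ v → y ≠ (K.face f).poly i) := by
    rw [Filter.eventually_all]
    intro f
    rw [Filter.eventually_all]
    intro i
    refine Filter.Eventually.and ?_ ?_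
    · by_cases h : v ∈ (K.face f).edge i
      · exact Eventually.of_forall fun y hn => absurd h hn
      · filter_upwards [(SimplePolygon.isClosed_edge i).isOpen_compl.mem_nhds h] with y hy _
        exact hy
    · by_cases h : (K.face f).poly i = v
      · exact Eventually.of_forall fun y hn => absurd h hn
      · filter_upwards [isOpen_compl_singleton.mem_nhds (Ne.symm h)] with y hy _
        exact hy
  obtain ⟨r, hr, hball⟩ := Metric.eventually_nhds_iff_ball.1 hev
  set S := Metric.ball v r \ {v} with hS
  -- The punctured disc `S` meets only edges that end in `v`, and no other vertex. So a point of `A`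
  -- in it lies inside a polygon or in the interior of an edge with both sides covered. Thus `A` is
  -- open and closed in the connected set `S`.
  have hsub : A ∩ S ⊆ interior A := by
    rintro y ⟨hyA, hyb, hyv⟩
    obtain ⟨f, hfc, hyf⟩ := mem_iUnion₂.1 hyA
    have hsubA : ∀ g ∈ c, (K.face g).carrier ⊆ A := fun g hg =>
      subset_iUnion₂ (s := fun f (_ : f ∈ c) => (K.face f).carrier) g hg
    rw [mem_interior_iff_mem_nhds]
    by_cases hyi : y ∈ (K.face f).inside
    · exact mem_of_superset (SimplePolygon.isOpen_inside.mem_nhds hyi)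
        (sdiff_subset.trans (hsubA f hfc))
    · have hyb' : y ∈ (K.face f).poly.boundary ℝ := by
        by_contra h
        exact hyi ⟨hyf, h⟩
      obtain ⟨i, hi⟩ := mem_boundary.1 hyb'
      have hvi : v ∈ (K.face f).edge i := by
        by_contra h
        exact (hball y hyb f i).1 h hi
      obtain ⟨k, hk⟩ := hv f hfc
      have hk' : (K.face f).poly k = v := hk
      rw [← hk'] at hvi
      obtain ⟨b, rfl⟩ := SimplePolygon.exists_corner hvi
      have hyo : y ∈ openEdge (K.face f).poly i := by
        rcases SimplePolygon.mem_openEdge_or hi with h | ⟨b', h⟩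
        · exact h
        · by_cases hb' : (K.face f).poly (corner i b') = v
          · exact absurd (h.trans hb') hyv
          · exact absurd h ((hball y hyb f _).2 hb')
      obtain ⟨ψ, hψ, hψc⟩ := htw ⟨f, i, b⟩ hfc hk'
      exact mem_of_superset (hψ.union_mem_nhds hyo) (union_subset (hsubA _ hfc) (hsubA _ hψc))
  have hSA : S ⊆ interior A := by
    refine (isPreconnected_ball_diff v r).subset_of_closure_inter_subset isOpen_interior ?_ ?_
    · obtain ⟨f, hf⟩ := hc
      obtain ⟨k, rfl⟩ := hv f hf
      have h1 := SimplePolygon.edge_subset_closure_inside k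
        (SimplePolygon.corner_mem_edge (P := K.face f) k false)
      obtain ⟨y, hy, hyi⟩ := mem_closure_iff_nhds.1 h1 _ (Metric.ball_mem_nhds _ hr)
      have hyS : y ∈ S := by
        refine ⟨hy, ?_⟩
        rintro rfl
        exact hyi.2 (SimplePolygon.vertices_subset_boundary ⟨k, rfl⟩)
      exact ⟨y, hyS, hsub ⟨mem_iUnion₂.2 ⟨f, hf, hyi.1⟩, hyS⟩⟩
    · rintro y ⟨hy, hyS⟩
      refine hsub ⟨?_, hyS⟩
      have := closure_mono interior_subset hy
      rwa [hAcl.closure_eq] at this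
  refine mem_of_superset (Metric.ball_mem_nhds v hr) fun y hy => ?_
  by_cases hyv : y = v
  · obtain ⟨f, hf⟩ := hc
    rw [hyv]
    exact mem_iUnion₂.2 ⟨f, hf, SimplePolygon.boundary_subset_carrier
      (SimplePolygon.vertices_subset_boundary (hv f hf))⟩
  · exact interior_subset (hSA ⟨hy, hyv⟩)

end PolygonalComplex

end EulerTransform

namespace EulerTransform
variable {ι : Type*}

namespace PolygonalComplex

variable {K : PolygonalComplex ι}

/-! ### The two edges of a polygon at a vertex, and half-angle formulas -/

namespace Flag

/-- The other flag of the same polygon at the same vertex. -/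
def mate : K.Flag → K.Flag
  | ⟨f, i, false⟩ => ⟨f, (finRotate _).symm i, true⟩
  | ⟨f, i, true⟩ => ⟨f, finRotate _ i, false⟩

theorem mate_f (φ : K.Flag) : φ.mate.f = φ.f := by
  obtain ⟨f, i, b⟩ := φ
  cases b <;> rfl

theorem mate_b (φ : K.Flag) : φ.mate.b = !φ.b := by
  obtain ⟨f, i, b⟩ := φ
  cases b <;> rfl

theorem mate_mate (φ : K.Flag) : φ.mate.mate = φ := by
  obtain ⟨f, i, b⟩ := φ
  cases b <;> simp only [mate, Equiv.apply_symm_apply, Equiv.symm_apply_apply]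

theorem mate_vtx (φ : K.Flag) : φ.mate.vtx = φ.vtx := by
  obtain ⟨f, i, b⟩ := φ
  cases b
  · change (K.face f).poly (finRotate _ ((finRotate _).symm i)) = (K.face f).poly i
    rw [Equiv.apply_symm_apply]
  · rfl

theorem mate_ne (φ : K.Flag) : φ.mate ≠ φ := by
  intro h
  have := φ.mate_b
  rw [h] at this
  revert this
  cases φ.b <;> simp

theorem eq_or_eq_mate {φ ψ : K.Flag} (hf : φ.f = ψ.f) (hv : φ.vtx = ψ.vtx) :
    ψ = φ ∨ ψ = φ.mate := by
  rcases eq_or_of_vtx hf hv with h | h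
  · exact Or.inl h.symm
  · exact Or.inr (ext_of_vtx (by rw [mate_f, hf]) (by rw [mate_b, h]) (by rw [mate_vtx, hv]))

theorem mate_edge_ne (φ : K.Flag) : φ.mate.edge ≠ φ.edge := fun h =>
  φ.mate_ne (eq_of_edge_eq φ.mate_f h φ.mate_vtx)

/-- The velocity of the vertex of a flag in the inward motion of its polygon. -/
noncomputable def mit (φ : K.Flag) : Plane := miter φ.poly φ.idx

theorem mit_eq (φ : K.Flag) : φ.mit = φ.κ • φ.dir + φ.nrm := φ.simple.miter_eq φ.i φ.b

theorem mate_mit (φ : K.Flag) : φ.mate.mit = φ.mit := by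
  obtain ⟨f, i, b⟩ := φ
  cases b
  · change miter (K.face f).poly (finRotate _ ((finRotate _).symm i)) = miter (K.face f).poly i
    rw [Equiv.apply_symm_apply]
  · rfl

theorem exists_smul_mit (φ : K.Flag) : ∃ σ : ℝ, σ • φ.mit = φ.nrm + φ.mate.nrm := by
  have key : ∀ f : ι, ∀ i : Fin (K.face f).n, ∃ σ : ℝ,
      σ • miter (K.face f).poly (finRotate _ i) =
        normal (K.face f).poly i + normal (K.face f).poly (finRotate _ i) := by
    intro f i
    refine ⟨1 + inner ℝ (normal (K.face f).poly i) (normal (K.face f).poly (finRotate _ i)), ?_⟩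
    rw [IsSimple.miter_rotate, smul_smul, mul_one_div_cancel ((K.face f).simple.normal_add_ne i), one_smul]
  obtain ⟨f, i, b⟩ := φ
  cases b
  · obtain ⟨σ, hσ⟩ := key f ((finRotate _).symm i)
    refine ⟨σ, ?_⟩
    rw [Equiv.apply_symm_apply] at hσ
    exact hσ.trans (add_comm _ _)
  · exact key f i

theorem inner_nrm_mit (φ : K.Flag) : (inner ℝ φ.nrm φ.mit : ℝ) = 1 :=
  φ.simple.inner_normal_miter φ.i φ.b

/-- The second normal is the mirror image of the first in the bisector, which has the direction κ d
+ n of squared length κ² + 1. Multiplying by this number avoids denominators. -/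
theorem mate_nrm (φ : K.Flag) :
    (φ.κ ^ 2 + 1) • φ.mate.nrm = (2 * φ.κ) • φ.dir + (1 - φ.κ ^ 2) • φ.nrm := by
  obtain ⟨σ, hσ⟩ := φ.exists_smul_mit
  have h1 : (inner ℝ φ.mate.nrm φ.mit : ℝ) = 1 := by
    rw [← mate_mit]; exact φ.mate.inner_nrm_mit
  have h2 : (inner ℝ φ.mit φ.mit : ℝ) = φ.κ ^ 2 + 1 := by
    rw [mit_eq, inner_add_add_self, real_inner_smul_left, real_inner_smul_left,
      inner_smul_right, inner_smul_right, φ.frame.dd, φ.frame.nn, φ.frame.dn, φ.frame.nd]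
    ring
  have h3 : σ * (φ.κ ^ 2 + 1) = 2 := by
    rw [← h2, ← real_inner_smul_left, hσ, inner_add_left, h1, φ.inner_nrm_mit]
    norm_num
  have h4 : φ.mate.nrm = σ • φ.mit - φ.nrm := by rw [hσ]; module
  have h5 : (φ.κ ^ 2 + 1) • φ.mate.nrm = (σ * (φ.κ ^ 2 + 1)) • φ.mit - (φ.κ ^ 2 + 1) • φ.nrm := by
    rw [h4]; module
  rw [h5, h3, mit_eq]
  module

/-- The formula for the normals, turned by a right angle; the signs `s` and `-s` differ because one
edge enters the vertex and the other leaves it. With κ = cot(θ/2) for the interior angle θ, it says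
that the second edge has the direction cos θ d + sin θ n. -/
theorem mate_dir (φ : K.Flag) :
    (φ.κ ^ 2 + 1) • φ.mate.dir = (φ.κ ^ 2 - 1) • φ.dir + (2 * φ.κ) • φ.nrm := by
  have hn := φ.mate_nrm
  have h1 : φ.nrm = (if φ.b then -1 else 1 : ℝ) • rot φ.dir := IsSimple.normal_eq_fdir _ _ _
  have h2 : φ.mate.nrm = (if φ.mate.b then -1 else 1 : ℝ) • rot φ.mate.dir :=
    IsSimple.normal_eq_fdir _ _ _
  rw [mate_b] at h2
  obtain ⟨s, hs, hs1, hs2⟩ : ∃ s : ℝ, s * s = 1 ∧ φ.nrm = s • rot φ.dir ∧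
      φ.mate.nrm = (-s) • rot φ.mate.dir := by
    rw [h1, h2]
    cases φ.b
    · exact ⟨1, by norm_num, by simp, by simp⟩
    · exact ⟨-1, by norm_num, by simp, by simp⟩
  have h3 : φ.mate.dir = s • rot φ.mate.nrm := by
    rw [hs2, rot_smul, rot_rot, smul_smul, smul_neg, mul_neg, hs]; simp
  have h4 : s • rot ((φ.κ ^ 2 + 1) • φ.mate.nrm) =
      s • rot ((2 * φ.κ) • φ.dir + (1 - φ.κ ^ 2) • φ.nrm) := by rw [hn]
  have hadd : ∀ x y : Plane, rot (x + y) = rot x + rot y := by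
    intro x y
    apply plane_ext <;> simp; ring
  have h5 : s • rot φ.nrm = -φ.dir := by
    rw [hs1, rot_smul, rot_rot, smul_smul, hs, one_smul]
  calc (φ.κ ^ 2 + 1) • φ.mate.dir = s • rot ((φ.κ ^ 2 + 1) • φ.mate.nrm) := by
        conv_lhs => rw [h3]
        rw [rot_smul]; module
    _ = (2 * φ.κ) • (s • rot φ.dir) + (1 - φ.κ ^ 2) • (s • rot φ.nrm) := by
        rw [h4, hadd, rot_smul, rot_smul]; module
    _ = _ := by rw [← hs1, h5]; module

theorem mate_κ (φ : K.Flag) : φ.mate.κ = φ.κ := by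
  have h1 : φ.mate.κ = inner ℝ φ.mate.dir φ.mit := by
    rw [← mate_mit, mit_eq, inner_add_right, inner_smul_right, φ.mate.frame.dd, φ.mate.frame.dn]
    ring
  have h2 : (φ.κ ^ 2 + 1) * φ.mate.κ = (φ.κ ^ 2 + 1) * φ.κ := by
    rw [h1, ← real_inner_smul_left, mate_dir, inner_add_left, real_inner_smul_left,
      real_inner_smul_left, φ.inner_nrm_mit, mit_eq, inner_add_right, inner_smul_right, φ.frame.dd,
      φ.frame.dn]
    ring
  exact mul_left_cancel₀ (by positivity) h2

theorem h_add_smul (φ : K.Flag) (x w : Plane) (r : ℝ) :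
    φ.h (x + r • w) = φ.h x + r * inner ℝ φ.nrm w := IsSimple.hgt_add_smul _ _ _ _

theorem a_add_smul (φ : K.Flag) (x w : Plane) (r : ℝ) :
    φ.a (x + r • w) = φ.a x + r * (inner ℝ φ.dir w - inner ℝ φ.nrm w * φ.κ) :=
  IsSimple.acoord_add_smul _ _ _ _ _

theorem len_pos (φ : K.Flag) : 0 < φ.len := φ.simple.len_pos φ.i

theorem flip_a_vtx (φ : K.Flag) : φ.flip.a φ.vtx = φ.len := by
  have := φ.a_add φ.vtx
  rw [a_vtx, h_vtx] at this
  linarith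

theorem mem_band_iff (φ : K.Flag) {T : ℝ} {x : Plane} :
    x ∈ band φ.poly T φ.i ↔ φ.h x ∈ Icc 0 T ∧ 0 ≤ φ.a x ∧ 0 ≤ φ.flip.a x :=
  and_congr Iff.rfl ⟨fun h => ⟨h _, h _⟩, fun h => bool_cases φ.b h.1 h.2⟩

theorem eventually_vtx_add (φ : K.Flag) (w : Plane) {q : Plane → Prop} (h : ∀ᶠ y in 𝓝 φ.vtx, q y) :
    ∀ᶠ ε in 𝓝[>] (0 : ℝ), q (φ.vtx + ε • w) := by
  have : Tendsto (fun ε : ℝ => φ.vtx + ε • w) (𝓝 0) (𝓝 (φ.vtx + (0 : ℝ) • w)) :=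
    Continuous.tendsto (by fun_prop) 0
  rw [zero_smul, add_zero] at this
  exact (this.mono_left nhdsWithin_le_nhds).eventually h

/-- A direction between the edge, excluded, and the bisector leads into the band of the edge, whose
points of positive height are inside the polygon. -/
theorem eventually_mem_inside (φ : K.Flag) {T : ℝ} (hT : IsMiteredOffset (K.face φ.f) T) {w : Plane}
    (h1 : 0 < (inner ℝ φ.nrm w : ℝ)) (h2 : 0 ≤ (inner ℝ φ.dir w - inner ℝ φ.nrm w * φ.κ : ℝ)) :
    ∀ᶠ ε in 𝓝[>] (0 : ℝ), φ.vtx + ε • w ∈ (K.face φ.f).inside := by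
  have e1 : ∀ᶠ y in 𝓝 φ.vtx, φ.h y < T := by
    refine (continuous_hgt _ _).continuousAt.eventually (gt_mem_nhds ?_)
    have := φ.h_vtx
    change φ.h φ.vtx < T
    rw [this]; exact hT.pos
  have e2 : ∀ᶠ y in 𝓝 φ.vtx, 0 < φ.flip.a y := by
    refine (continuous_acoord _ _ _).continuousAt.eventually (lt_mem_nhds ?_)
    change 0 < φ.flip.a φ.vtx
    rw [flip_a_vtx]; exact φ.len_pos
  filter_upwards [φ.eventually_vtx_add w e1, φ.eventually_vtx_add w e2, self_mem_nhdsWithin]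
    with ε h3 h4 h5
  have h5 : 0 < ε := h5
  have hpos : 0 < φ.h (φ.vtx + ε • w) := by
    rw [h_add_smul, h_vtx, zero_add]; positivity
  refine hT.mem_inside_of_band (φ.mem_band_iff.2 ⟨⟨hpos.le, h3.le⟩, ?_, h4.le⟩) hpos
  rw [a_add_smul, a_vtx, zero_add]; positivity

theorem eventually_mem_openEdge (φ : K.Flag) :
    ∀ᶠ ε in 𝓝[>] (0 : ℝ), φ.vtx + ε • φ.dir ∈ openEdge φ.poly φ.i := by
  have e2 : ∀ᶠ y in 𝓝 φ.vtx, 0 < φ.flip.a y := by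
    refine (continuous_acoord _ _ _).continuousAt.eventually (lt_mem_nhds ?_)
    change 0 < φ.flip.a φ.vtx
    rw [flip_a_vtx]; exact φ.len_pos
  filter_upwards [φ.eventually_vtx_add φ.dir e2, self_mem_nhdsWithin] with ε h1 h2
  have h2 : 0 < ε := h2
  rw [mem_openEdge_iff]
  refine ⟨?_, ?_, h1⟩
  · rw [h_add_smul, h_vtx, φ.frame.nd]; ring
  · rw [a_add_smul, a_vtx, φ.frame.nd, φ.frame.dd]; linarith

/-- At a common edge of two polygons the angle between the two bisectors at a common vertex is
less than `π` on the side of the edge. -/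
theorem Twin.κ_add_pos {t : ι → ℝ} (ht : ∀ f, IsMiteredOffset (K.face f) (t f)) {φ ψ : K.Flag}
    (hφψ : φ.Twin ψ) : 0 < φ.κ + ψ.κ := by
  by_contra hcon
  push Not at hcon
  set k := φ.κ with hk
  -- Write k and m as cotangents of half-angles in (0, π). In the frame of φ, the second edge of the
  -- other polygon points at twice the half-angle of m. So k ≤ m says that this edge starts within
  -- the closed angle of the first polygon.
  obtain ⟨m, hm⟩ : ∃ m, ψ.κ = -m := ⟨-ψ.κ, by ring⟩
  rw [hm] at hcon
  have hdir : (m ^ 2 + 1) • ψ.mate.dir = (m ^ 2 - 1) • φ.dir + (2 * m) • φ.nrm := by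
    have := ψ.mate_dir
    rw [hm, hφψ.dir_eq, hφψ.nrm_eq] at this
    rw [neg_sq] at this
    rw [this]; module
  have hvtx : ψ.mate.vtx = φ.vtx := by rw [mate_vtx, hφψ.2.1]
  have hmf : ψ.mate.f = ψ.f := ψ.mate_f
  have hopen := ψ.mate.eventually_mem_openEdge
  rw [hvtx] at hopen
  have hm1 : 0 < m ^ 2 + 1 := by positivity
  have hk1 : 0 < k ^ 2 + 1 := by positivity
  rcases eq_or_lt_of_le (show k ≤ m by linarith) with hkm | hkm
  -- If the angles agree, the second edges of both polygons overlap, hence coincide, and the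
  -- polygons have two edges in common.
  · have hdd : φ.mate.dir = ψ.mate.dir := by
      have h1 := φ.mate_dir
      rw [← hk, hkm, ← hdir] at h1
      exact smul_right_injective _ hm1.ne' h1
    have hopen' := φ.mate.eventually_mem_openEdge
    rw [mate_vtx, hdd] at hopen'
    obtain ⟨ε, h1, h2⟩ := (hopen.and hopen').exists
    have hne : φ.mate.f ≠ ψ.mate.f := by rw [mate_f, mate_f]; exact hφψ.1
    rcases edge_inter_edge hne (SimplePolygon.openEdge_subset_edge _ h2)
        (SimplePolygon.openEdge_subset_edge _ h1) with he | ⟨b, c, he, -⟩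
    · have he' : φ.mate.edge = ψ.mate.edge := by
        rw [Flag.edge_eq, Flag.edge_eq]; exact he
      have m1 := φ.mate.edge_mem
      have m2 := ψ.mate.edge_mem
      rw [mate_f] at m1 m2
      refine φ.mate_edge_ne (eq_of_common_edges hφψ.1 m1 φ.edge_mem ?_ ?_)
      · rw [he']; exact m2
      · rw [hφψ.edge_eq]; exact ψ.edge_mem
    · exact SimplePolygon.notMem_vertices_of_openEdge h2 (he ▸ ⟨_, rfl⟩)
  -- Otherwise the second edge of ψ runs into the interior of the first polygon, through the band of
  -- φ or that of `φ.mate`. The sign of X − Y k tells on which side of the bisector it starts.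
  · have hcarr : ∀ χ : K.Flag, χ.f = φ.f → χ.vtx = φ.vtx → 0 < (inner ℝ χ.nrm ψ.mate.dir : ℝ) →
        ¬ 0 ≤ (inner ℝ χ.dir ψ.mate.dir - inner ℝ χ.nrm ψ.mate.dir * χ.κ : ℝ) := by
      intro χ hχf hχv h1 h2
      have := χ.eventually_mem_inside (ht _) h1 h2
      rw [hχv] at this
      obtain ⟨ε, h3, h4⟩ := (this.and hopen).exists
      have := eq_of_mem_inside h3 (SimplePolygon.edge_subset_carrier _
        (SimplePolygon.openEdge_subset_edge _ h4))
      rw [hχf, mate_f] at this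
      exact hφψ.1 this
    have i1 : (m ^ 2 + 1) * inner ℝ φ.nrm ψ.mate.dir = (2 * m : ℝ) := by
      rw [← inner_smul_right, hdir, inner_add_right, inner_smul_right, inner_smul_right, φ.frame.nd,
        φ.frame.nn]
      ring
    have i2 : (m ^ 2 + 1) * inner ℝ φ.dir ψ.mate.dir = (m ^ 2 - 1 : ℝ) := by
      rw [← inner_smul_right, hdir, inner_add_right, inner_smul_right, inner_smul_right, φ.frame.dd,
        φ.frame.dn]
      ring
    have j1 : (k ^ 2 + 1) * inner ℝ φ.mate.nrm ψ.mate.dir =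
        (2 * k * inner ℝ φ.dir ψ.mate.dir + (1 - k ^ 2) * inner ℝ φ.nrm ψ.mate.dir : ℝ) := by
      rw [← real_inner_smul_left, mate_nrm, inner_add_left, real_inner_smul_left,
        real_inner_smul_left]
    have j2 : (k ^ 2 + 1) * inner ℝ φ.mate.dir ψ.mate.dir =
        ((k ^ 2 - 1) * inner ℝ φ.dir ψ.mate.dir + (2 * k) * inner ℝ φ.nrm ψ.mate.dir : ℝ) := by
      rw [← real_inner_smul_left, mate_dir, inner_add_left, real_inner_smul_left,
        real_inner_smul_left]
    have c1 := hcarr φ rfl rfl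
    have c2 := hcarr φ.mate φ.mate_f φ.mate_vtx
    rw [mate_κ] at c2
    rw [← hk] at c1 c2
    set X : ℝ := inner ℝ φ.dir ψ.mate.dir
    set Y : ℝ := inner ℝ φ.nrm ψ.mate.dir
    set X' : ℝ := inner ℝ φ.mate.dir ψ.mate.dir
    set Y' : ℝ := inner ℝ φ.mate.nrm ψ.mate.dir
    have e1 : (m ^ 2 + 1) * (X - Y * k) = m ^ 2 - 1 - 2 * m * k := by linear_combination i2 - k * i1
    have e2 : X' - Y' * k = -(X - Y * k) := by
      have : (k ^ 2 + 1) * (X' - Y' * k) = (k ^ 2 + 1) * -(X - Y * k) := by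
        linear_combination j2 - k * j1
      exact mul_left_cancel₀ hk1.ne' this
    have e3 : (m ^ 2 + 1) * ((k ^ 2 + 1) * Y') = 2 * (m - k) * (k * m + 1) := by
      linear_combination (m ^ 2 + 1) * j1 + 2 * k * i2 + (1 - k ^ 2) * i1
    by_cases hA : 0 ≤ X - Y * k
    · have hm0 : 0 < m := by
        have : 0 ≤ m ^ 2 - 1 - 2 * m * k := by rw [← e1]; positivity
        by_contra hm0
        push Not at hm0
        nlinarith
      refine c1 ?_ hA
      have : 0 < (m ^ 2 + 1) * Y := by rw [i1]; positivity
      exact pos_of_mul_pos_right this hm1.le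
    · push Not at hA
      refine c2 ?_ (by linarith)
      have h1 : (m ^ 2 + 1) * (X - Y * k) < 0 := mul_neg_of_pos_of_neg hm1 hA
      have h2 : 0 < k * m + 1 := by nlinarith
      have h3 : 0 < (m ^ 2 + 1) * ((k ^ 2 + 1) * Y') := by
        rw [e3]
        have : 0 < m - k := by linarith
        positivity
      exact pos_of_mul_pos_right (pos_of_mul_pos_right h3 hm1.le) hk1.le

end Flag

end PolygonalComplex

end EulerTransform

namespace EulerTransform
variable {ι : Type*}

namespace PolygonalComplex

variable {K : PolygonalComplex ι}

namespace Flag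

/-! ### The pieces into which the new edges cut the bands -/

/-- The edge of the flag lies on one polygon only. -/
def Outer (φ : K.Flag) : Prop := ∀ ψ, ¬ φ.Twin ψ

theorem not_outer {φ : K.Flag} : ¬ φ.Outer ↔ ∃ ψ, φ.Twin ψ := by simp [Outer]

theorem Outer.flip {φ : K.Flag} (h : φ.Outer) : φ.flip.Outer := fun ψ hψ => by
  have := hψ.flip
  rw [flip_flip] at this
  exact h _ this

theorem eq_of_outer {φ ψ : K.Flag} (h : φ.Outer) (he : φ.edge = ψ.edge) (hv : φ.vtx = ψ.vtx) :
    φ = ψ := by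
  by_cases hf : φ.f = ψ.f
  · exact eq_of_edge_eq hf he hv
  · exact absurd (twin_of_edge_eq hf he hv) (h ψ)

theorem eq_or_eq_flip {φ ψ : K.Flag} (hf : φ.f = ψ.f) (he : φ.edge = ψ.edge) :
    ψ = φ ∨ ψ = φ.flip := by
  have : ψ.vtx = φ.vtx ∨ ψ.vtx = φ.flip.vtx := 
    Sym2.mem_iff.1 (show ψ.vtx ∈ φ.edge by rw [he]; exact ψ.vtx_mem_edge)
  rcases this with h | h
  · exact Or.inl (eq_of_edge_eq hf.symm he.symm h)
  · exact Or.inr (eq_of_edge_eq hf.symm (by rw [edge_flip, he]) h)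

theorem twin_or_twin_flip {φ ψ : K.Flag} (hf : φ.f ≠ ψ.f) (he : φ.edge = ψ.edge) :
    φ.Twin ψ ∨ φ.Twin ψ.flip := by
  have : φ.vtx = ψ.vtx ∨ φ.vtx = ψ.flip.vtx := 
    Sym2.mem_iff.1 (show φ.vtx ∈ ψ.edge by rw [← he]; exact φ.vtx_mem_edge)
  rcases this with h | h
  · exact Or.inl (twin_of_edge_eq hf he h)
  · exact Or.inr (twin_of_edge_eq hf (by rw [edge_flip, he]) h)

theorem eq_vtx {φ : K.Flag} {x : Plane} (h0 : φ.h x = 0) (ha : φ.a x = 0) : x = φ.vtx :=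
  φ.simple.eq_corner h0 ha

theorem ext_ha (φ : K.Flag) {x y : Plane} (h0 : φ.h x = φ.h y) (ha : φ.a x = φ.a y) : x = y :=
  φ.simple.ext_coords φ.i φ.b h0 ha

variable (t : ι → ℝ)

/-- The position of the copy of the vertex of a flag in the offset polygon. -/
noncomputable def q (φ : K.Flag) : Plane := offset φ.poly (t φ.f) φ.idx

open Classical in
/-- The distance from the vertex of a flag to the point where the new edge crosses its edge. -/
noncomputable def μ (φ : K.Flag) : ℝ :=
  if h : ∃ ψ, φ.Twin ψ then
    t φ.f * t h.choose.f / (t φ.f + t h.choose.f) * (φ.κ + h.choose.κ)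
  else 0

variable {t}

theorem Twin.μ_eq {φ ψ : K.Flag} (h : φ.Twin ψ) :
    φ.μ t = t φ.f * t ψ.f / (t φ.f + t ψ.f) * (φ.κ + ψ.κ) := by
  have hex : ∃ ψ, φ.Twin ψ := ⟨ψ, h⟩
  rw [μ, dif_pos hex, hex.choose_spec.unique h]

theorem Outer.μ_eq {φ : K.Flag} (h : φ.Outer) : φ.μ t = 0 :=
  dif_neg fun ⟨ψ, hψ⟩ => h ψ hψ

theorem Twin.μ_eq_μ {φ ψ : K.Flag} (h : φ.Twin ψ) : ψ.μ t = φ.μ t := by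
  rw [h.μ_eq, h.symm.μ_eq, mul_comm (t ψ.f), add_comm (t ψ.f), add_comm ψ.κ]

section

variable (ht : ∀ f, IsMiteredOffset (K.face f) (t f))

include ht

theorem Twin.μ_pos {φ ψ : K.Flag} (h : φ.Twin ψ) : 0 < φ.μ t := by
  rw [h.μ_eq]
  have h1 := (ht φ.f).pos
  have h2 := (ht ψ.f).pos
  have h3 := h.κ_add_pos ht
  positivity

theorem μ_nonneg (φ : K.Flag) : 0 ≤ φ.μ t := by
  by_cases h : φ.Outer
  · rw [h.μ_eq]
  · obtain ⟨ψ, hψ⟩ := not_outer.1 h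
    exact (hψ.μ_pos ht).le

theorem outer_of_μ {φ : K.Flag} (h : φ.μ t ≤ 0) : φ.Outer := by
  by_contra hn
  obtain ⟨ψ, hψ⟩ := not_outer.1 hn
  exact absurd (hψ.μ_pos ht) (not_lt.2 h)

theorem offset_len_pos (φ : K.Flag) : 0 < φ.len - t φ.f * (φ.κ + φ.flip.κ) :=
  φ.simple.offset_len_pos (ht φ.f).2 ⟨(ht φ.f).pos.le, le_rfl⟩ φ.i φ.b

/-- For an inner edge, weight the two positive offset lengths by t' and t and add them. Divided by t
+ t', the result is exactly `φ.len` − μ − μ', where μ and μ' belong to the two ends. -/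
theorem μ_add_lt (φ : K.Flag) : φ.μ t + φ.flip.μ t < φ.len := by
  by_cases h : φ.Outer
  · rw [h.μ_eq, h.flip.μ_eq, add_zero]; exact φ.len_pos
  · obtain ⟨ψ, hψ⟩ := not_outer.1 h
    have h1 := (ht φ.f).pos
    have h2 := (ht ψ.f).pos
    have h3 := φ.offset_len_pos ht
    have h4 := ψ.offset_len_pos ht
    rw [hψ.len_eq] at h4
    rw [hψ.μ_eq, hψ.flip.μ_eq]
    change t φ.f * t ψ.f / (t φ.f + t ψ.f) * (φ.κ + ψ.κ) +
      t φ.f * t ψ.f / (t φ.f + t ψ.f) * (φ.flip.κ + ψ.flip.κ) < φ.len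
    rw [← mul_add, div_mul_eq_mul_div, div_lt_iff₀ (by positivity)]
    nlinarith [mul_pos h1 h4, mul_pos h2 h3]

/-- The two triangles of a band are disjoint at every height `s`: the difference of both sides
interpolates linearly between `μ_add_lt` at height 0 and `offset_len_pos` at height `t φ.f`. -/
theorem gap (φ : K.Flag) {s : ℝ} (hs : s ∈ Icc 0 (t φ.f)) :
    (φ.μ t + φ.flip.μ t) * (t φ.f - s) < t φ.f * (φ.len - s * (φ.κ + φ.flip.κ)) := by
  have h1 := φ.μ_add_lt ht
  have h2 := φ.offset_len_pos ht
  have h3 := (ht φ.f).pos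
  have key : t φ.f * (φ.len - s * (φ.κ + φ.flip.κ)) - (φ.μ t + φ.flip.μ t) * (t φ.f - s) =
      (t φ.f - s) * (φ.len - (φ.μ t + φ.flip.μ t)) +
        s * (φ.len - t φ.f * (φ.κ + φ.flip.κ)) := by ring
  rcases eq_or_lt_of_le hs.1 with h0 | h0
  · rw [← h0] at key ⊢
    nlinarith [mul_pos h3 (sub_pos.2 h1)]
  · nlinarith [mul_nonneg (sub_nonneg.2 hs.2) (sub_pos.2 h1).le, mul_pos h0 h2]

end

variable (t) in
/-- The part of a band that belongs to the cell of the vertex of a flag. -/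
def tri (φ : K.Flag) : Set Plane :=
  {x | φ.h x ∈ Icc 0 (t φ.f) ∧ 0 ≤ φ.a x ∧ t φ.f * φ.a x ≤ φ.μ t * (t φ.f - φ.h x)}

variable (t) in
/-- The part of a band that belongs to the cell of its edge. -/
def mid (φ : K.Flag) : Set Plane :=
  {x | φ.h x ∈ Icc 0 (t φ.f) ∧ φ.μ t * (t φ.f - φ.h x) ≤ t φ.f * φ.a x ∧
    φ.flip.μ t * (t φ.f - φ.h x) ≤ t φ.f * φ.flip.a x}

variable (t) in
/-- The part of a new edge at the vertex of a flag that lies in the band of this flag. -/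
def half (φ : K.Flag) : Set Plane :=
  {x | φ.h x ∈ Icc 0 (t φ.f) ∧ t φ.f * φ.a x = φ.μ t * (t φ.f - φ.h x)}

theorem mid_flip (φ : K.Flag) : φ.flip.mid t = φ.mid t := by
  ext x
  simp only [mid, mem_ofPred_eq, flip_flip, h_flip]
  exact and_congr Iff.rfl and_comm

section

variable (ht : ∀ f, IsMiteredOffset (K.face f) (t f))

include ht

theorem flip_a_pos_of_tri {φ : K.Flag} {x : Plane} (hx : x ∈ φ.tri t) : 0 < φ.flip.a x := by
  have h1 := φ.gap ht hx.1
  have h2 := φ.a_add x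
  have h3 := (ht φ.f).pos
  have h4 := φ.flip.μ_nonneg ht
  rw [← h2] at h1
  have h5 : 0 ≤ φ.flip.μ t * (t φ.f - φ.h x) := mul_nonneg h4 (sub_nonneg.2 hx.1.2)
  have h6 : 0 < t φ.f * φ.flip.a x := by
    have := hx.2.2
    nlinarith
  exact pos_of_mul_pos_right h6 h3.le

theorem tri_subset_band (φ : K.Flag) : φ.tri t ⊆ band φ.poly (t φ.f) φ.i := fun _ hx =>
  φ.mem_band_iff.2 ⟨hx.1, hx.2.1, (flip_a_pos_of_tri ht hx).le⟩

theorem mid_subset_band (φ : K.Flag) : φ.mid t ⊆ band φ.poly (t φ.f) φ.i := by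
  intro x hx
  have h3 := (ht φ.f).pos
  have h5 : 0 ≤ φ.μ t * (t φ.f - φ.h x) := mul_nonneg (φ.μ_nonneg ht) (sub_nonneg.2 hx.1.2)
  have h6 : 0 ≤ φ.flip.μ t * (t φ.f - φ.h x) :=
    mul_nonneg (φ.flip.μ_nonneg ht) (sub_nonneg.2 hx.1.2)
  exact φ.mem_band_iff.2 ⟨hx.1, nonneg_of_mul_nonneg_right (h5.trans hx.2.1) h3,
    nonneg_of_mul_nonneg_right (h6.trans hx.2.2) h3⟩

theorem half_subset_tri (φ : K.Flag) : φ.half t ⊆ φ.tri t := by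
  intro x hx
  have h3 := (ht φ.f).pos
  have h5 : 0 ≤ φ.μ t * (t φ.f - φ.h x) := mul_nonneg (φ.μ_nonneg ht) (sub_nonneg.2 hx.1.2)
  rw [← hx.2] at h5
  exact ⟨hx.1, nonneg_of_mul_nonneg_right h5 h3, hx.2.le⟩

theorem half_subset_mid (φ : K.Flag) : φ.half t ⊆ φ.mid t := by
  intro x hx
  refine ⟨hx.1, hx.2.ge, ?_⟩
  have h1 := φ.gap ht hx.1
  rw [← φ.a_add x] at h1
  have := hx.2
  nlinarith

omit ht in
theorem half_of_tri_mid {φ : K.Flag} {x : Plane} (h1 : x ∈ φ.tri t) (h2 : x ∈ φ.mid t) :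
    x ∈ φ.half t := ⟨h1.1, le_antisymm h1.2.2 h2.2.1⟩

theorem half_of_mid {φ : K.Flag} {x : Plane} (h : x ∈ φ.mid t) (ha : φ.a x = 0) :
    x ∈ φ.half t := by
  refine ⟨h.1, ?_⟩
  have h1 := h.2.1
  rw [ha, mul_zero] at h1 ⊢
  exact le_antisymm (mul_nonneg (φ.μ_nonneg ht) (sub_nonneg.2 h.1.2)) h1

/-- A point common to two bands. -/
theorem band_cases {φ ψ : K.Flag} {x : Plane} (hφ : x ∈ band φ.poly (t φ.f) φ.i)
    (hψ : x ∈ band ψ.poly (t ψ.f) ψ.i) :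
    (ψ = φ ∨ ψ = φ.flip) ∨
    (∃ φ', (φ' = φ ∨ φ' = φ.flip) ∧ (φ'.mate = ψ ∨ φ'.mate = ψ.flip) ∧ φ'.a x = 0 ∧
      φ'.mate.a x = 0 ∧ φ'.mate.h x = φ'.h x) ∨
    (φ.h x = 0 ∧ (φ.Twin ψ ∨ φ.Twin ψ.flip)) ∨
    (φ.f ≠ ψ.f ∧ φ.edge ≠ ψ.edge ∧ ∃ φ' ψ', (φ' = φ ∨ φ' = φ.flip) ∧ (ψ' = ψ ∨ ψ' = ψ.flip) ∧
      x = φ'.vtx ∧ x = ψ'.vtx) := by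
  by_cases hf : φ.f = ψ.f
  · obtain ⟨f, i, b⟩ := φ
    obtain ⟨g, j, c⟩ := ψ
    dsimp only at hf hφ hψ
    subst hf
    by_cases hij : i = j
    · left
      subst hij
      cases b <;> cases c <;> simp [flip]
    · right; left
      obtain ⟨d, h1, h2, h3, h4⟩ := (ht f).band_inter_band hij hφ hψ
      have hmate : (⟨f, i, d⟩ : K.Flag).mate = ⟨f, j, !d⟩ :=
        ext_of_vtx (mate_f _) (mate_b _) ((mate_vtx _).trans (congrArg (K.face f).poly h1))
      refine ⟨⟨f, i, d⟩, ?_, ?_, h2, ?_, ?_⟩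
      · cases b <;> cases d <;> simp [flip]
      · rw [hmate]
        cases c <;> cases d <;> simp [flip]
      · rw [hmate]; exact h3
      · rw [hmate]; exact h4.symm
  -- Points common to different polygons lie on both boundaries, and a band meets the boundary of
  -- its polygon only in its own edge.
  · right; right
    have hφb := mem_boundary_of_mem hf ((ht _).band_subset_carrier _ hφ)
      ((ht _).band_subset_carrier _ hψ)
    have hψb := mem_boundary_of_mem (Ne.symm hf) ((ht _).band_subset_carrier _ hψ)
      ((ht _).band_subset_carrier _ hφ)
    have hφe := (ht _).mem_edge_of_boundary hφ hφb
    have hψe := (ht _).mem_edge_of_boundary hψ hψb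
    by_cases he : φ.edge = ψ.edge
    · left
      exact ⟨(ht _).hgt_eq_zero_of_boundary hφ hφb, twin_or_twin_flip hf he⟩
    · right
      rcases edge_inter_edge hf hφe hψe with h | ⟨b, c, h1, h2⟩
      · exact absurd (by rw [edge_eq, edge_eq]; exact h) he
      · refine ⟨hf, he, ⟨φ.f, φ.i, b⟩, ⟨ψ.f, ψ.i, c⟩, ?_, ?_, h1, h2⟩
        · obtain ⟨f, i, b'⟩ := φ
          cases b <;> cases b' <;> simp [flip]
        · obtain ⟨f, i, c'⟩ := ψ
          cases c <;> cases c' <;> simp [flip]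

omit ht in
-- At the vertex the inequality defining `mid` reads μ t ≤ 0, whereas μ > 0 on an edge of two
-- polygons.
theorem outer_of_mid_vtx (ht : ∀ f, IsMiteredOffset (K.face f) (t f)) {φ : K.Flag}
    (h : φ.vtx ∈ φ.mid t) : φ.Outer := by
  have h1 := h.2.1
  rw [a_vtx, h_vtx, mul_zero, sub_zero] at h1
  have h3 := (ht φ.f).pos
  refine outer_of_μ ht ?_
  by_contra hc
  push Not at hc
  nlinarith [mul_pos hc h3]

theorem eq_vtx_of_tri {φ : K.Flag} {x : Plane} (h : x ∈ φ.tri t) {φ' : K.Flag}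
    (hφ : φ' = φ ∨ φ' = φ.flip) (hx : φ'.a x = 0) : φ' = φ := by
  rcases hφ with h' | h'
  · exact h'
  · rw [h'] at hx
    exact absurd hx (flip_a_pos_of_tri ht h).ne'

theorem q_eq (φ : K.Flag) : φ.h (φ.q t) = t φ.f ∧ φ.a (φ.q t) = 0 := by
  have := (ht φ.f).pos
  exact ⟨φ.simple.hgt_offset φ.i φ.b _, φ.simple.acoord_offset φ.i φ.b _⟩

/-- The vertex cells at different vertices are disjoint, and at one vertex the pieces of unrelated
polygons have only the vertex in common. -/
theorem tri_inter_tri {φ ψ : K.Flag} {x : Plane} (hφ : x ∈ φ.tri t) (hψ : x ∈ ψ.tri t) :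
    φ.vtx = ψ.vtx ∧ (φ.f = ψ.f ∨ φ.Twin ψ ∨ x = φ.vtx) := by
  rcases band_cases ht (φ.tri_subset_band ht hφ) (ψ.tri_subset_band ht hψ) with
    (h | h) | ⟨φ', h1, h2, h3, h4, -⟩ | ⟨h0, h | h⟩ | ⟨-, -, φ', ψ', h1, h2, h3, h4⟩
  · exact ⟨by rw [h], Or.inl (by rw [h])⟩
  -- Triangles at the two ends of one edge of a polygon are separated by `gap`.
  · exfalso
    subst h
    have e1 := hφ.2.2
    have e2 := hψ.2.2
    rw [h_flip] at e2
    have e3 := φ.gap ht hφ.1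
    rw [← φ.a_add x] at e3
    change t φ.f * φ.flip.a x ≤ φ.flip.μ t * (t φ.f - φ.h x) at e2
    nlinarith
  · have e1 := eq_vtx_of_tri ht hφ h1 h3
    have e2 : φ'.mate = ψ := eq_vtx_of_tri ht hψ h2 h4
    subst e1
    rw [← e2, mate_vtx, mate_f]
    exact ⟨rfl, Or.inl rfl⟩
  · exact ⟨h.2.1, Or.inr (Or.inl h)⟩
  -- Triangles at opposite ends, on the two sides of a common edge: a common point has height 0 and
  -- distances at most μ and μ' from the ends, against `μ_add_lt`.
  · exfalso
    have hf : φ.flip.Twin ψ := by have := h.flip; rwa [flip_flip] at this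
    have e0 : ψ.h x = 0 := by rw [hf.h_eq, h_flip, h0, neg_zero]
    have e1 := hφ.2.2
    have e2 := hψ.2.2
    have e3 := hf.a_eq x
    rw [h_flip, h0, zero_mul, add_zero] at e3
    rw [h0, sub_zero] at e1
    rw [e0, sub_zero, e3, hf.μ_eq_μ] at e2
    have e4 := φ.a_add x
    rw [h0] at e4
    have e5 := φ.μ_add_lt ht
    have p1 := (ht φ.f).pos
    have p2 := (ht ψ.f).pos
    rw [mul_comm] at e1 e2
    have e6 := le_of_mul_le_mul_right e1 p1
    have e7 := le_of_mul_le_mul_right e2 p2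
    linarith
  · have k1 : φ' = φ := eq_vtx_of_tri ht hφ h1 (by rw [h3, a_vtx])
    have k2 : ψ' = ψ := eq_vtx_of_tri ht hψ h2 (by rw [h4, a_vtx])
    rw [k1] at h3
    rw [k2] at h4
    exact ⟨h3.symm.trans h4, Or.inr (Or.inr h3)⟩

/-- Inside one band, or on a bisector, the pieces meet along `half`. Across a common edge the height
is 0 and the coordinates of both sides agree, as do the two values of μ. Otherwise the point is a
vertex, which `mid` contains only if its edge is outer. -/
theorem mid_inter_tri {φ ψ : K.Flag} {x : Plane} (hφ : x ∈ φ.mid t) (hψ : x ∈ ψ.tri t) :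
    ∃ φ', (φ' = φ ∨ φ' = φ.flip) ∧ φ'.vtx = ψ.vtx ∧
      ((φ'.f = ψ.f ∧ x ∈ φ'.half t) ∨ (φ'.Twin ψ ∧ x ∈ φ'.half t) ∨
        (φ'.f ≠ ψ.f ∧ φ'.Outer ∧ x = φ'.vtx)) := by
  have hmid : ∀ φ', (φ' = φ ∨ φ' = φ.flip) → x ∈ φ'.mid t := by
    rintro φ' (rfl | rfl)
    · exact hφ
    · rwa [mid_flip]
  have htwin : ∀ φ', (φ' = φ ∨ φ' = φ.flip) → φ'.h x = 0 → φ'.Twin ψ → x ∈ φ'.half t := by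
    intro φ' h1 h0 h
    refine half_of_tri_mid ?_ (hmid φ' h1)
    have m := hmid φ' h1
    have e2 := hψ.2.2
    have e3 := h.a_eq x
    rw [h0, zero_mul, add_zero] at e3
    rw [h.h_eq, h0, neg_zero, sub_zero, e3, h.μ_eq_μ, mul_comm] at e2
    have e4 := le_of_mul_le_mul_right e2 (ht ψ.f).pos
    have e5 := hψ.2.1
    rw [e3] at e5
    refine ⟨m.1, e5, ?_⟩
    rw [h0, sub_zero, mul_comm]
    exact mul_le_mul_of_nonneg_right e4 (ht φ'.f).pos.le
  rcases band_cases ht (φ.mid_subset_band ht hφ) (ψ.tri_subset_band ht hψ) with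
    (h | h) | ⟨φ', h1, h2, h3, h4, -⟩ | ⟨h0, h | h⟩ | ⟨hf, -, φ', ψ', h1, h2, h3, h4⟩
  · subst h
    exact ⟨ψ, Or.inl rfl, rfl, Or.inl ⟨rfl, half_of_tri_mid hψ hφ⟩⟩
  · subst h
    exact ⟨φ.flip, Or.inr rfl, rfl, Or.inl ⟨rfl, half_of_tri_mid hψ (hmid _ (Or.inr rfl))⟩⟩
  · have e2 : φ'.mate = ψ := eq_vtx_of_tri ht hψ h2 h4
    exact ⟨φ', h1, by rw [← e2, mate_vtx],
      Or.inl ⟨by rw [← e2, mate_f], half_of_mid ht (hmid φ' h1) h3⟩⟩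
  · exact ⟨φ, Or.inl rfl, h.2.1, Or.inr (Or.inl ⟨h, htwin φ (Or.inl rfl) h0 h⟩)⟩
  · have hf : φ.flip.Twin ψ := by have := h.flip; rwa [flip_flip] at this
    exact ⟨φ.flip, Or.inr rfl, hf.2.1,
      Or.inr (Or.inl ⟨hf, htwin φ.flip (Or.inr rfl) (by rw [h_flip]; exact h0) hf⟩)⟩
  · have k2 : ψ' = ψ := eq_vtx_of_tri ht hψ h2 (by rw [h4, a_vtx])
    rw [k2] at h4
    refine ⟨φ', h1, h3.symm.trans h4, Or.inr (Or.inr ⟨?_, ?_, h3⟩)⟩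
    · rcases h1 with rfl | rfl <;> exact hf
    · have := hmid φ' h1
      rw [h3] at this
      exact outer_of_mid_vtx ht this

end

/-- Two consecutive edges of a polygon do not both lie on this polygon only. -/
theorem not_outer_mate [Finite ι] (hK : K.IsEulerInput) {φ : K.Flag} (h : φ.Outer) :
    ¬ φ.mate.Outer := by
  intro h'
  obtain ⟨C, hC⟩ := φ.exists_compl hK h
  obtain ⟨D, hD⟩ := φ.mate.exists_compl hK h'
  -- Both complementary polygons contain the vertex, so they agree. A hole is then excluded by
  -- sharing only one edge with the polygon, the outside by the adjacency of the two edges.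
  have hCD : D = C := by
    refine eq_of_mem_compl hK (hD φ.mate.vtx_mem_seg) ?_
    rw [mate_vtx]
    exact hC φ.vtx_mem_seg
  subst hCD
  have h1 := φ.mate.edge_mem
  rw [mate_f] at h1
  by_cases hb : D.IsHole
  · exact φ.mate_edge_ne (hK.hole φ.f D hb _ h1 _ φ.edge_mem hD hC)
  · rw [seg_edge] at hC hD
    obtain ⟨f, i, b⟩ := φ
    cases b
    · refine hK.outside f D hb ((finRotate _).symm i) ⟨?_, ?_⟩
      · rw [edgeSet_eq]; exact hD
      · rw [Equiv.apply_symm_apply, edgeSet_eq]; exact hC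
    · refine hK.outside f D hb i ⟨?_, ?_⟩
      · rw [edgeSet_eq]; exact hC
      · rw [edgeSet_eq]; exact hD

/-- On a bisector strictly below the offset vertex, the two middle pieces would force μ ≤ 0 for both
edges, so both would be outer, contrary to `not_outer_mate`. Apart from offset vertices, the pieces
can only meet in a vertex of two outer edges. -/
theorem mid_inter_mid [Finite ι] (hK : K.IsEulerInput)
    (ht : ∀ f, IsMiteredOffset (K.face f) (t f)) {φ ψ : K.Flag} (hne : φ.edge ≠ ψ.edge)
    {x : Plane} (hφ : x ∈ φ.mid t) (hψ : x ∈ ψ.mid t) :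
    ∃ φ' ψ', (φ' = φ ∨ φ' = φ.flip) ∧ (ψ' = ψ ∨ ψ' = ψ.flip) ∧ φ'.vtx = ψ'.vtx ∧
      ((φ'.f = ψ'.f ∧ x = φ'.q t) ∨ (φ'.Outer ∧ ψ'.Outer ∧ x = φ'.vtx)) := by
  have hmid : ∀ {φ φ' : K.Flag}, (φ' = φ ∨ φ' = φ.flip) → x ∈ φ.mid t → x ∈ φ'.mid t := by
    rintro φ φ' (rfl | rfl) h
    · exact h
    · rwa [mid_flip]
  rcases band_cases ht (φ.mid_subset_band ht hφ) (ψ.mid_subset_band ht hψ) with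
    (h | h) | ⟨φ', h1, h2, h3, h4, h5⟩ | ⟨h0, h | h⟩ | ⟨hf, -, φ', ψ', h1, h2, h3, h4⟩
  · exact absurd (by rw [h]) hne
  · exact absurd (by rw [h, edge_flip]) hne
  · refine ⟨φ', φ'.mate, h1, h2, (mate_vtx _).symm, Or.inl ⟨φ'.mate_f.symm, ?_⟩⟩
    have m1 := hmid h1 hφ
    have m2 := hmid h2 hψ
    have hq := φ'.q_eq ht
    refine φ'.ext_ha ?_ (by rw [h3, hq.2])
    rw [hq.1]
    by_contra hlt
    have hlt : 0 < t φ'.f - φ'.h x := sub_pos.2 (lt_of_le_of_ne m1.1.2 hlt)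
    have e1 := m1.2.1
    have e2 := m2.2.1
    rw [h3, mul_zero] at e1
    rw [h4, mul_zero, h5, mate_f] at e2
    refine not_outer_mate hK (outer_of_μ ht (φ := φ') ?_) (outer_of_μ ht ?_)
    · exact nonpos_of_mul_nonpos_left e1 hlt
    · exact nonpos_of_mul_nonpos_left e2 hlt
  · exact absurd h.edge_eq hne
  · exact absurd (by rw [h.edge_eq, edge_flip]) hne
  · refine ⟨φ', ψ', h1, h2, h3.symm.trans h4, Or.inr ⟨?_, ?_, h3⟩⟩
    · exact outer_of_mid_vtx ht (h3 ▸ hmid h1 hφ)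
    · exact outer_of_mid_vtx ht (h4 ▸ hmid h2 hψ)

end Flag

end PolygonalComplex

end EulerTransform

namespace EulerTransform
variable {ι : Type*}

namespace PolygonalComplex

variable {K : PolygonalComplex ι}

/-! ### Vertices and edges of the Euler transformation -/

theorem HatVertex.ext_of {x y : K.HatVertex} (ho : x.owner = y.owner) (hb : x.base = y.base) :
    x = y := by
  cases x with
  | ofFace f i =>
    cases y with
    | ofFace g j =>
      obtain rfl : f = g := Sum.inl_injective ho
      rw [(K.face f).simple.inj hb]
    | ofCompl D w hw hD => cases ho
  | ofCompl C v hv hC =>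
    cases y with
    | ofFace g j => cases ho
    | ofCompl D w hw hD =>
      obtain rfl : C = D := Sum.inr_injective ho
      obtain rfl : v = w := hb
      rfl

namespace Flag

/-- The copy of the vertex of a flag in its polygon. -/
def hv (φ : K.Flag) : K.HatVertex := .ofFace φ.f φ.idx

theorem hv_owner (φ : K.Flag) : φ.hv.owner = Sum.inl φ.f := rfl

theorem hv_base (φ : K.Flag) : φ.hv.base = φ.vtx := rfl

theorem hv_pos (t : ι → ℝ) (φ : K.Flag) : φ.hv.pos t = φ.q t := rfl

theorem hv_mate (φ : K.Flag) : φ.mate.hv = φ.hv :=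
  HatVertex.ext_of (by rw [hv_owner, hv_owner, mate_f]) (mate_vtx φ)

/-- The two polygons, holes or outside that contain an edge. -/
theorem owner_cases [Finite ι] {φ : K.Flag} {o : ι ⊕ K.ComplPolygon}
    (ho : φ.edge ∈ K.edgesOf o) (hne : o ≠ Sum.inl φ.f) :
    (∃ ψ, φ.Twin ψ ∧ o = Sum.inl ψ.f) ∨
      (φ.Outer ∧ ∃ C : K.ComplPolygon, o = Sum.inr C ∧ seg φ.edge ⊆ C.carrier) := by
  cases o with
  | inl g =>
    left
    obtain ⟨ψ, rfl, he, hv⟩ := exists_of_mem (K := K) (f := g) ho φ.vtx_mem_edge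
    exact ⟨ψ, twin_of_edge_eq (fun h => hne (by rw [h])) he.symm hv.symm, rfl⟩
  | inr C =>
    right
    exact ⟨fun ψ hψ => hψ.not_seg_subset C ho.2, C, rfl, ho.2⟩

/-- The other side of an inner edge is its unique twin, as the interior of the edge has a
neighbourhood in the complex. The other side of an outer edge is the unique complementary polygon
through its vertex. -/
theorem owner_unique [Finite ι] (hK : K.IsEulerInput) {φ : K.Flag} {o o' : ι ⊕ K.ComplPolygon}
    (ho : φ.edge ∈ K.edgesOf o) (hne : o ≠ Sum.inl φ.f)
    (ho' : φ.edge ∈ K.edgesOf o') (hne' : o' ≠ Sum.inl φ.f) : o = o' := by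
  rcases owner_cases ho hne with ⟨ψ, h1, rfl⟩ | ⟨h1, C, rfl, hC⟩ <;>
    rcases owner_cases ho' hne' with ⟨χ, h2, rfl⟩ | ⟨h2, D, rfl, hD⟩
  · rw [h1.unique h2]
  · exact absurd h1 (h2 ψ)
  · exact absurd h2 (h1 χ)
  · rw [eq_of_mem_compl hK (hC φ.vtx_mem_seg) (hD φ.vtx_mem_seg)]

theorem vtx_mem_K (φ : K.Flag) : φ.vtx ∈ K.vertices := mem_iUnion.2 ⟨_, φ.vtx_mem_vertices⟩

theorem exists_opp [Finite ι] (hK : K.IsEulerInput) (φ : K.Flag) : ∃ y : K.HatVertex,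
    y.base = φ.vtx ∧ y.owner ≠ Sum.inl φ.f ∧ φ.edge ∈ K.edgesOf y.owner := by
  by_cases h : φ.Outer
  · obtain ⟨C, hC⟩ := φ.exists_compl hK h
    exact ⟨.ofCompl C φ.vtx φ.vtx_mem_K (hC φ.vtx_mem_seg), rfl, Sum.inr_ne_inl,
      φ.edge_mem_edges, hC⟩
  · obtain ⟨ψ, hψ⟩ := not_outer.1 h
    refine ⟨ψ.hv, hψ.2.1.symm, fun h => hψ.1 (Sum.inl_injective h).symm, ?_⟩
    rw [hψ.edge_eq]
    exact ψ.edge_mem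

/-- The copy of the vertex of a flag on the other side of its edge. -/
noncomputable def opp [Finite ι] (hK : K.IsEulerInput) (φ : K.Flag) : K.HatVertex :=
  (φ.exists_opp hK).choose

section Opp

variable [Finite ι] (hK : K.IsEulerInput)

theorem opp_base (φ : K.Flag) : (φ.opp hK).base = φ.vtx := (φ.exists_opp hK).choose_spec.1

theorem opp_owner_ne (φ : K.Flag) : (φ.opp hK).owner ≠ Sum.inl φ.f :=
  (φ.exists_opp hK).choose_spec.2.1

theorem edge_mem_opp (φ : K.Flag) : φ.edge ∈ K.edgesOf (φ.opp hK).owner :=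
  (φ.exists_opp hK).choose_spec.2.2

theorem opp_eq {φ : K.Flag} {y : K.HatVertex} (hb : y.base = φ.vtx)
    (hne : y.owner ≠ Sum.inl φ.f) (he : φ.edge ∈ K.edgesOf y.owner) : φ.opp hK = y :=
  HatVertex.ext_of (owner_unique hK (φ.edge_mem_opp hK) (φ.opp_owner_ne hK) he hne)
    ((φ.opp_base hK).trans hb.symm)

theorem Twin.opp_eq {φ ψ : K.Flag} (h : φ.Twin ψ) : φ.opp hK = ψ.hv := by
  refine Flag.opp_eq hK h.2.1.symm (fun h' => h.1 (Sum.inl_injective h').symm) ?_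
  rw [h.edge_eq]
  exact ψ.edge_mem

theorem Outer.opp {φ : K.Flag} (h : φ.Outer) : ∃ C : K.ComplPolygon,
    (φ.opp hK).owner = Sum.inr C ∧ seg φ.edge ⊆ C.carrier := by
  rcases owner_cases (φ.edge_mem_opp hK) (φ.opp_owner_ne hK) with ⟨ψ, h1, -⟩ | ⟨-, h1⟩
  · exact absurd h1 (h ψ)
  · exact h1

omit [Finite ι] in
theorem pos_of_owner_inr {y : K.HatVertex} {C : K.ComplPolygon} (h : y.owner = Sum.inr C)
    (t : ι → ℝ) : y.pos t = y.base := by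
  cases y with
  | ofFace f i => cases h
  | ofCompl D w hw hD => rfl

theorem Outer.opp_pos {φ : K.Flag} (h : φ.Outer) (t : ι → ℝ) : (φ.opp hK).pos t = φ.vtx := by
  obtain ⟨C, hC, -⟩ := h.opp hK
  rw [pos_of_owner_inr hC, opp_base]

theorem opp_flip_owner (φ : K.Flag) : (φ.flip.opp hK).owner = (φ.opp hK).owner := by
  have h1 := φ.flip.edge_mem_opp hK
  rw [edge_flip] at h1
  exact owner_unique hK h1 (φ.flip.opp_owner_ne hK) (φ.edge_mem_opp hK) (φ.opp_owner_ne hK)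

/-- The copies of the vertex on the two sides of two outer edges at one vertex agree. -/
theorem Outer.opp_eq_opp {φ ψ : K.Flag} (h : φ.Outer) (h' : ψ.Outer) (hv : φ.vtx = ψ.vtx) :
    φ.opp hK = ψ.opp hK := by
  obtain ⟨C, hC, hCs⟩ := h.opp hK
  obtain ⟨D, hD, hDs⟩ := h'.opp hK
  have : C = D := eq_of_mem_compl hK (hCs φ.vtx_mem_seg) (hv ▸ hDs ψ.vtx_mem_seg)
  exact HatVertex.ext_of (by rw [hC, hD, this]) (by rw [opp_base, opp_base, hv])

/-- The copy of an edge in the polygon of a flag. -/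
def top (φ : K.Flag) : Sym2 K.HatVertex := s(φ.hv, φ.flip.hv)

/-- The copy of an edge on the other side. -/
noncomputable def bot (φ : K.Flag) : Sym2 K.HatVertex := s(φ.opp hK, φ.flip.opp hK)

/-- The new edge that joins the copies of a vertex on the two sides of an edge. -/
noncomputable def cross (φ : K.Flag) : Sym2 K.HatVertex := s(φ.hv, φ.opp hK)

omit [Finite ι] in
theorem top_flip (φ : K.Flag) : φ.flip.top = φ.top := by
  rw [top, flip_flip, top, Sym2.eq_swap]

theorem bot_flip (φ : K.Flag) : φ.flip.bot hK = φ.bot hK := by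
  rw [bot, flip_flip, bot, Sym2.eq_swap]

omit [Finite ι] in
theorem top_eq (φ : K.Flag) : φ.top = s(.ofFace φ.f φ.i, .ofFace φ.f (finRotate _ φ.i)) := by
  obtain ⟨f, i, b⟩ := φ
  cases b
  · rfl
  · rw [← top_flip]; rfl

theorem Twin.bot_eq {φ ψ : K.Flag} (h : φ.Twin ψ) : φ.bot hK = ψ.top := by
  rw [bot, top, h.opp_eq hK, h.flip.opp_eq hK]

theorem Twin.cross_eq {φ ψ : K.Flag} (h : φ.Twin ψ) : ψ.cross hK = φ.cross hK := by
  rw [cross, cross, h.opp_eq hK, h.symm.opp_eq hK, Sym2.eq_swap]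

end Opp

end Flag

open EulerTransform.PolygonalComplex.Flag

theorem mem_facets_ofFace {f : ι} {ε : Sym2 K.HatVertex} :
    ε ∈ (HatCell.ofFace f : K.HatCell).facets ↔ ∃ φ : K.Flag, φ.f = f ∧ ε = φ.top := by
  constructor
  · rintro ⟨i, rfl⟩
    exact ⟨⟨f, i, false⟩, rfl, rfl⟩
  · rintro ⟨φ, rfl, rfl⟩
    exact ⟨φ.i, φ.top_eq⟩

section Facets

variable [Finite ι] (hK : K.IsEulerInput)

/-- A copy of an end of the edge belongs either to the polygon of φ or to the unique other side,
where it is given by `opp`. This turns the description of facets by owners into a list of four. -/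
theorem mem_facets_ofEdge {φ : K.Flag} {e : Sym2 Plane} (he : e ∈ K.edges) (hφ : φ.edge = e)
    {ε : Sym2 K.HatVertex} : ε ∈ (HatCell.ofEdge e he : K.HatCell).facets ↔
      ε = φ.top ∨ ε = φ.bot hK ∨ ε = φ.cross hK ∨ ε = φ.flip.cross hK := by
  subst hφ
  constructor
  · rintro (⟨x, y, rfl, ho, hb, he⟩ | ⟨x, y, rfl, ho, hb, hx, he, he'⟩)
    · have key : ∀ x y : K.HatVertex, x.owner = y.owner → x.base = φ.vtx → y.base = φ.flip.vtx →
          φ.edge ∈ K.edgesOf x.owner → s(x, y) = φ.top ∨ s(x, y) = φ.bot hK := by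
        intro x y ho h1 h2 he
        by_cases hf : x.owner = Sum.inl φ.f
        · left
          rw [HatVertex.ext_of (hf.trans φ.hv_owner.symm) h1,
            HatVertex.ext_of (y := φ.flip.hv) (ho.symm.trans hf) h2]
          rfl
        · right
          rw [← opp_eq hK h1 hf he, ← opp_eq (φ := φ.flip) (y := y) hK h2 (ho ▸ hf)
            (by rw [edge_flip, ← ho]; exact he)]
          rfl
      rcases Sym2.eq_iff.1 hb with ⟨h1, h2⟩ | ⟨h1, h2⟩
      · rcases key x y ho h1 h2 he with h | h
        exacts [Or.inl h, Or.inr (Or.inl h)]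
      · rw [Sym2.eq_swap]
        rcases key y x ho.symm h2 h1 (ho ▸ he) with h | h
        exacts [Or.inl h, Or.inr (Or.inl h)]
    · have key : ∀ ψ : K.Flag, ψ.f = φ.f → ψ.edge = φ.edge → x.base = ψ.vtx →
          s(x, y) = ψ.cross hK := by
        intro ψ hψf hψe h1
        by_cases hf : x.owner = Sum.inl ψ.f
        · rw [HatVertex.ext_of (y := ψ.hv) hf h1,
            ← opp_eq (φ := ψ) (y := y) hK (hb.symm.trans h1) (fun h => ho (hf.trans h.symm))
              (by rw [hψe]; exact he')]
          rfl
        · have hy : y.owner = Sum.inl ψ.f := by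
            by_contra hy
            rw [← hψe] at he he'
            exact ho (owner_unique hK he hf he' hy)
          rw [Sym2.eq_swap, HatVertex.ext_of (x := y) (y := ψ.hv) hy (hb.symm.trans h1),
            ← opp_eq (φ := ψ) (y := x) hK h1 hf (by rw [hψe]; exact he)]
          rfl
      right; right
      rcases Sym2.mem_iff.1 hx with h | h
      · exact Or.inl (key φ rfl rfl h)
      · exact Or.inr (key φ.flip rfl φ.edge_flip h)
  · have hcross : ∀ ψ : K.Flag, ψ.edge = φ.edge →
        ψ.cross hK ∈ (HatCell.ofEdge φ.edge he : K.HatCell).facets := by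
      intro ψ hψ
      refine Or.inr ⟨ψ.hv, ψ.opp hK, rfl, (ψ.opp_owner_ne hK).symm, (ψ.opp_base hK).symm, ?_, ?_, ?_⟩
      · rw [← hψ]; exact ψ.vtx_mem_edge
      · rw [← hψ]; exact ψ.edge_mem
      · rw [← hψ]; exact ψ.edge_mem_opp hK
    rintro (rfl | rfl | rfl | rfl)
    · exact Or.inl ⟨φ.hv, φ.flip.hv, rfl, rfl, rfl, φ.edge_mem⟩
    · refine Or.inl ⟨φ.opp hK, φ.flip.opp hK, rfl, (φ.opp_flip_owner hK).symm, ?_, φ.edge_mem_opp hK⟩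
      rw [opp_base, opp_base]; rfl
    · exact hcross φ rfl
    · exact hcross φ.flip φ.edge_flip

theorem mem_facets_ofVertex {v : Plane} {c : Set ι} (hc : c ∈ K.fans v) {ε : Sym2 K.HatVertex} :
    ε ∈ (HatCell.ofVertex v c hc : K.HatCell).facets ↔
      ∃ φ : K.Flag, φ.f ∈ c ∧ φ.vtx = v ∧ ε = φ.cross hK := by
  constructor
  · rintro ⟨x, y, rfl, ho, hx, hy, ⟨f, hf, hxf⟩, e, hv, he, he'⟩
    rw [hxf] at he
    obtain ⟨φ, rfl, rfl, rfl⟩ := exists_of_mem (K := K) (f := f) he hv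
    refine ⟨φ, hf, rfl, ?_⟩
    rw [HatVertex.ext_of (y := φ.hv) hxf hx,
      ← opp_eq (φ := φ) (y := y) hK hy (fun h => ho (hxf.trans h.symm)) he']
    rfl
  · rintro ⟨φ, hf, rfl, rfl⟩
    exact ⟨φ.hv, φ.opp hK, rfl, (φ.opp_owner_ne hK).symm, rfl, φ.opp_base hK, ⟨φ.f, hf, rfl⟩,
      φ.edge, φ.vtx_mem_edge, φ.edge_mem, φ.edge_mem_opp hK⟩

include hK

/-- The edges of the Euler transformation. -/
theorem facet_cases {c : K.HatCell} {ε : Sym2 K.HatVertex} (h : ε ∈ c.facets) :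
    (∃ φ : K.Flag, ε = φ.top) ∨ (∃ φ : K.Flag, ε = φ.cross hK) ∨
      (∃ φ : K.Flag, φ.Outer ∧ ε = φ.bot hK) := by
  cases c with
  | ofFace f =>
    obtain ⟨φ, -, h⟩ := mem_facets_ofFace.1 h
    exact Or.inl ⟨φ, h⟩
  | ofEdge e he =>
    obtain ⟨φ, hφ⟩ := exists_of_edges he
    rcases (mem_facets_ofEdge hK he hφ).1 h with h | h | h | h
    · exact Or.inl ⟨φ, h⟩
    · by_cases ho : φ.Outer
      · exact Or.inr (Or.inr ⟨φ, ho, h⟩)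
      · obtain ⟨ψ, hψ⟩ := not_outer.1 ho
        exact Or.inl ⟨ψ, h.trans (hψ.bot_eq hK)⟩
    · exact Or.inr (Or.inl ⟨φ, h⟩)
    · exact Or.inr (Or.inl ⟨φ.flip, h⟩)
  | ofVertex v c hc =>
    obtain ⟨φ, -, -, h⟩ := (mem_facets_ofVertex hK hc).1 h
    exact Or.inr (Or.inl ⟨φ, h⟩)

/-- `SimpleGraph.fromEdgeSet` drops loops; hence no facet gets lost in `hatGraph`. -/
theorem facet_not_isDiag {c : K.HatCell} {ε : Sym2 K.HatVertex} (h : ε ∈ c.facets) :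
    ¬ ε.IsDiag := by
  rcases facet_cases hK h with ⟨φ, rfl⟩ | ⟨φ, rfl⟩ | ⟨φ, -, rfl⟩
  · rw [top, Sym2.mk_isDiag_iff]
    intro h
    exact φ.vtx_flip_ne (congrArg HatVertex.base h).symm
  · rw [cross, Sym2.mk_isDiag_iff]
    intro h
    exact φ.opp_owner_ne hK (congrArg HatVertex.owner h).symm
  · rw [bot, Sym2.mk_isDiag_iff]
    intro h
    have := congrArg HatVertex.base h
    rw [opp_base, opp_base] at this
    exact φ.vtx_flip_ne this.symm

theorem mem_edgeSet_iff {ε : Sym2 K.HatVertex} :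
    ε ∈ K.hatGraph.edgeSet ↔ ∃ c : K.HatCell, ε ∈ c.facets := by
  rw [hatGraph, SimpleGraph.edgeSet_fromEdgeSet]
  constructor
  · rintro ⟨h, -⟩
    exact mem_iUnion.1 h
  · rintro ⟨c, h⟩
    exact ⟨mem_iUnion.2 ⟨c, h⟩, facet_not_isDiag hK h⟩

end Facets

end PolygonalComplex

end EulerTransform

namespace EulerTransform
variable {ι : Type*}

namespace PolygonalComplex

variable {K : PolygonalComplex ι}

open EulerTransform.PolygonalComplex.Flag

/-! ### Fans -/

theorem ShareEdgeAt.mem_vertices {v : Plane} {f g : ι} (h : K.ShareEdgeAt v f g) :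
    v ∈ (K.face f).vertices ∧ v ∈ (K.face g).vertices := by
  obtain ⟨e, hf, hg, hv⟩ := h
  obtain ⟨φ, rfl, -, rfl⟩ := exists_of_mem (K := K) hf hv
  obtain ⟨ψ, rfl, -, h⟩ := exists_of_mem (K := K) hg hv
  exact ⟨φ.vtx_mem_vertices, h ▸ ψ.vtx_mem_vertices⟩

theorem Flag.Twin.shareEdgeAt {φ ψ : K.Flag} (h : φ.Twin ψ) : K.ShareEdgeAt φ.vtx φ.f ψ.f :=
  ⟨φ.edge, φ.edge_mem, h.edge_eq ▸ ψ.edge_mem, φ.vtx_mem_edge⟩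

theorem mem_vertices_of_fan {v : Plane} {c : Set ι} (hc : c ∈ K.fans v) {f : ι} (hf : f ∈ c) :
    v ∈ (K.face f).vertices := by
  obtain ⟨g, hg, rfl⟩ := hc
  have key : ∀ x y, Relation.EqvGen (K.ShareEdgeAt v) x y →
      (v ∈ (K.face x).vertices ↔ v ∈ (K.face y).vertices) := by
    intro x y h
    induction h with
    | rel x y h => exact iff_of_true h.mem_vertices.1 h.mem_vertices.2
    | refl x => exact Iff.rfl
    | symm x y _ ih => exact ih.symm
    | trans x y z _ _ ih1 ih2 => exact ih1.trans ih2
  exact (key g f hf).1 hg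

theorem nonempty_of_fan {v : Plane} {c : Set ι} (hc : c ∈ K.fans v) : c.Nonempty := by
  obtain ⟨g, hg, rfl⟩ := hc
  exact ⟨g, .refl g⟩

theorem mem_fan_of_twin {c : Set ι} {φ ψ : K.Flag} (hc : c ∈ K.fans φ.vtx) (h : φ.Twin ψ)
    (hf : φ.f ∈ c) : ψ.f ∈ c := by
  obtain ⟨g, hg, rfl⟩ := hc
  exact .trans _ _ _ hf (.rel _ _ h.shareEdgeAt)

theorem fan_eq {v : Plane} {c d : Set ι} (hc : c ∈ K.fans v) (hd : d ∈ K.fans v) {f : ι}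
    (hfc : f ∈ c) (hfd : f ∈ d) : c = d := by
  obtain ⟨g, hg, rfl⟩ := hc
  obtain ⟨g', hg', rfl⟩ := hd
  ext x
  exact ⟨fun h => .trans _ _ _ hfd (.trans _ _ _ (.symm _ _ hfc) h),
    fun h => .trans _ _ _ hfc (.trans _ _ _ (.symm _ _ hfd) h)⟩

/-- A set of polygons at `v` that is closed under crossing edges at `v` contains a fan. -/
theorem fan_subset {v : Plane} {c s : Set ι} (hc : c ∈ K.fans v) {f : ι} (hfc : f ∈ c)
    (hfs : f ∈ s)
    (hs : ∀ φ ψ : K.Flag, φ.vtx = v → φ.Twin ψ → φ.f ∈ s → ψ.f ∈ s) : c ⊆ s := by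
  obtain ⟨g, hg, rfl⟩ := hc
  have h1 : ∀ x y, K.ShareEdgeAt v x y → x ∈ s → y ∈ s := by
    intro x y ⟨e, hx, hy, hv⟩ hxs
    by_cases hxy : x = y
    · exact hxy ▸ hxs
    obtain ⟨φ, rfl, he, rfl⟩ := exists_of_mem (K := K) hx hv
    obtain ⟨ψ, rfl, he', hv'⟩ := exists_of_mem (K := K) hy hv
    exact hs φ ψ rfl (twin_of_edge_eq hxy (he.trans he'.symm) hv'.symm) hxs
  have key : ∀ x y, Relation.EqvGen (K.ShareEdgeAt v) x y → (x ∈ s ↔ y ∈ s) := by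
    intro x y h
    induction h with
    | rel x y h =>
      refine ⟨h1 x y h, h1 y x ?_⟩
      obtain ⟨e, hx, hy, hv⟩ := h
      exact ⟨e, hy, hx, hv⟩
    | refl x => exact Iff.rfl
    | symm x y _ ih => exact ih.symm
    | trans x y z _ _ ih1 ih2 => exact ih1.trans ih2
  intro y hy
  exact (key _ _ hy).1 ((key _ _ hfc).2 hfs)

theorem exists_fan {v : Plane} {f : ι} (hv : v ∈ (K.face f).vertices) :
    ∃ c ∈ K.fans v, f ∈ c := ⟨_, ⟨f, hv, rfl⟩, .refl f⟩

theorem exists_flag {v : Plane} {f : ι} (hv : v ∈ (K.face f).vertices) (b : Bool) :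
    ∃ φ : K.Flag, φ.f = f ∧ φ.vtx = v ∧ φ.b = b := by
  obtain ⟨i, rfl⟩ := hv
  cases b
  · exact ⟨⟨f, i, false⟩, rfl, rfl, rfl⟩
  · exact ⟨⟨f, (finRotate _).symm i, true⟩, rfl,
      congrArg (K.face f).poly ((finRotate _).apply_symm_apply i), rfl⟩

/-- A fan that does not surround its vertex has an edge that lies on one polygon only. -/
theorem exists_outer_of_fan [Finite ι] {v : Plane} {c : Set ι} (hc : c ∈ K.fans v)
    (hn : ⋃ f ∈ c, (K.face f).carrier ∉ 𝓝 v) :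
    ∃ φ : K.Flag, φ.Outer ∧ φ.f ∈ c ∧ φ.vtx = v := by
  by_contra! hcon
  refine hn (iUnion_mem_nhds_of_twins (nonempty_of_fan hc) (fun f => mem_vertices_of_fan hc) ?_)
  intro φ hφ hv
  obtain ⟨ψ, hψ⟩ := not_outer.1 fun h => hcon φ h hφ hv
  exact ⟨ψ, hψ, mem_fan_of_twin (hv ▸ hc) hψ hφ⟩

/-- If all its edges at `v` were inner, the fan would cover a neighbourhood of `v` and keep the
complement away. -/
theorem exists_outer_of_compl [Finite ι] {v : Plane} {c : Set ι} (hc : c ∈ K.fans v)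
    {C : K.ComplPolygon} (hC : v ∈ C.carrier) : ∃ φ : K.Flag, φ.Outer ∧ φ.f ∈ c ∧ φ.vtx = v :=
  exists_outer_of_fan hc fun h => notMem_compl_of_mem_nhds
    (mem_of_superset h (iUnion₂_subset fun f _ => carrier_subset_space f)) C hC

/-- A polygon of the other fan has interior points arbitrarily close to `v`, so the fan `c` cannot
cover a neighbourhood. -/
theorem exists_outer_of_ne [Finite ι] {v : Plane} {c d : Set ι} (hc : c ∈ K.fans v)
    (hd : d ∈ K.fans v) (hcd : c ≠ d) : ∃ φ : K.Flag, φ.Outer ∧ φ.f ∈ c ∧ φ.vtx = v := by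
  obtain ⟨g, hg⟩ := nonempty_of_fan hd
  refine exists_outer_of_fan hc fun h => ?_
  obtain ⟨φ, rfl, rfl, -⟩ := exists_flag (mem_vertices_of_fan hd hg) false
  have h1 : φ.vtx ∈ closure (K.face φ.f).inside :=
    SimplePolygon.edge_subset_closure_inside φ.i (SimplePolygon.corner_mem_edge φ.i φ.b)
  obtain ⟨y, hy, hy'⟩ := mem_closure_iff_nhds.1 h1 _ h
  obtain ⟨f, hf, hyf⟩ := mem_iUnion₂.1 hy
  obtain rfl := eq_of_mem_inside hy' hyf
  exact hcd (fan_eq hc hd hf hg)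

/-! ### The segments that realize the edges -/

theorem hatSeg_mk (t : ι → ℝ) (x y : K.HatVertex) :
    K.hatSeg t s(x, y) = segment ℝ (x.pos t) (y.pos t) := by
  rw [hatSeg, Sym2.map_mk, seg_mk]

theorem pos_mem_hatSeg (t : ι → ℝ) {x : K.HatVertex} {ε : Sym2 K.HatVertex} (hx : x ∈ ε) :
    x.pos t ∈ K.hatSeg t ε := by
  induction ε with
  | h a b =>
    rw [hatSeg_mk]
    rcases Sym2.mem_iff.1 hx with rfl | rfl
    exacts [left_mem_segment _ _ _, right_mem_segment _ _ _]

namespace Flag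

theorem h_combo (φ : K.Flag) (x y : Plane) {r s : ℝ} (hrs : r + s = 1) :
    φ.h (r • x + s • y) = r * φ.h x + s * φ.h y := IsSimple.hgt_combo φ.i x y hrs

theorem a_combo (φ : K.Flag) (x y : Plane) {r s : ℝ} (hrs : r + s = 1) :
    φ.a (r • x + s • y) = r * φ.a x + s * φ.a y := IsSimple.acoord_combo φ.i φ.b x y hrs

variable {t : ι → ℝ}

section

variable (ht : ∀ f, IsMiteredOffset (K.face f) (t f))

include ht

theorem mem_top_iff (φ : K.Flag) {x : Plane} :
    x ∈ K.hatSeg t φ.top ↔ φ.h x = t φ.f ∧ 0 ≤ φ.a x ∧ 0 ≤ φ.flip.a x := by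
  rw [top_eq, hatSeg_mk]
  exact (φ.simple.mem_segment_offset_iff (ht φ.f).2 ⟨(ht φ.f).pos.le, le_rfl⟩ φ.i).trans
    (and_congr Iff.rfl ⟨fun h => ⟨h _, h _⟩, fun h => bool_cases φ.b h.1 h.2⟩)

/-- In the coordinates of φ, the new edge runs from height t and abscissa 0 to height −t' and
abscissa t'(κ + κ'). At height 0 its abscissa is μ, and `half` is given by the equation of this
line. -/
theorem Twin.mem_half {φ ψ : K.Flag} (h : φ.Twin ψ) {x : Plane}
    (hx : x ∈ segment ℝ (φ.q t) (ψ.q t)) (h0 : 0 ≤ φ.h x) : x ∈ φ.half t := by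
  obtain ⟨r, s, hr, hs, hrs, rfl⟩ := hx
  have h1 := (ht φ.f).pos
  have h2 := (ht ψ.f).pos
  have q1 := φ.q_eq ht
  have q2 := ψ.q_eq ht
  rw [h.h_eq, h.a_eq] at q2
  have q3 : φ.h (ψ.q t) = -t ψ.f := by linarith [q2.1]
  have q4 : φ.a (ψ.q t) = t ψ.f * (φ.κ + ψ.κ) := by
    have := q2.2
    rw [q3] at this
    linarith
  have e1 := φ.h_combo (φ.q t) (ψ.q t) hrs
  have e2 := φ.a_combo (φ.q t) (ψ.q t) hrs
  rw [q1.1, q3] at e1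
  rw [q1.2, q4] at e2
  refine ⟨⟨h0, ?_⟩, ?_⟩
  · rw [e1]; nlinarith
  · rw [e1, e2, h.μ_eq]
    have : t φ.f + t ψ.f ≠ 0 := by positivity
    obtain rfl : r = 1 - s := by linarith
    field_simp
    ring

theorem half_subset_hatSeg [Finite ι] (hK : K.IsEulerInput) (φ : K.Flag) :
    φ.half t ⊆ K.hatSeg t (φ.cross hK) := by
  intro x hx
  have h1 := (ht φ.f).pos
  have q1 := φ.q_eq ht
  rw [cross, hatSeg_mk, hv_pos]
  by_cases ho : φ.Outer
  · rw [ho.opp_pos]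
    have h2 := hx.2
    rw [ho.μ_eq, zero_mul] at h2
    have h3 : φ.a x = 0 := by simpa [h1.ne'] using h2
    have hrs : φ.h x / t φ.f + (1 - φ.h x / t φ.f) = 1 := by ring
    refine ⟨φ.h x / t φ.f, 1 - φ.h x / t φ.f, div_nonneg hx.1.1 h1.le,
      sub_nonneg.2 ((div_le_one h1).2 hx.1.2), hrs, φ.ext_ha ?_ ?_⟩
    · rw [h_combo _ _ _ hrs, q1.1, h_vtx, mul_zero, add_zero, div_mul_cancel₀ _ h1.ne']
    · rw [a_combo _ _ _ hrs, q1.2, a_vtx, h3]; ring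
  · obtain ⟨ψ, h⟩ := not_outer.1 ho
    rw [h.opp_eq hK, hv_pos]
    have h2 := (ht ψ.f).pos
    have q2 := ψ.q_eq ht
    rw [h.h_eq, h.a_eq] at q2
    have q3 : φ.h (ψ.q t) = -t ψ.f := by linarith [q2.1]
    have q4 : φ.a (ψ.q t) = t ψ.f * (φ.κ + ψ.κ) := by
      have := q2.2
      rw [q3] at this
      linarith
    have hAB : 0 < t φ.f + t ψ.f := by positivity
    -- The weights are determined by the height, which is t at one end and −t' at the other.
    have hrs : (t ψ.f + φ.h x) / (t φ.f + t ψ.f) + (t φ.f - φ.h x) / (t φ.f + t ψ.f) = 1 := by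
      field_simp; ring
    refine ⟨_, _, div_nonneg (add_nonneg h2.le hx.1.1) hAB.le,
      div_nonneg (sub_nonneg.2 hx.1.2) hAB.le, hrs, φ.ext_ha ?_ ?_⟩
    · rw [h_combo _ _ _ hrs, q1.1, q3]; field_simp; ring
    · rw [a_combo _ _ _ hrs, q1.2, q4]
      have h5 := hx.2
      rw [h.μ_eq] at h5
      have : φ.a x = t ψ.f / (t φ.f + t ψ.f) * (φ.κ + ψ.κ) * (t φ.f - φ.h x) := by
        refine mul_left_cancel₀ h1.ne' (h5.trans ?_)
        ring
      rw [this]; ring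

/-- A new edge consists of its parts in the two bands. -/
theorem exists_half [Finite ι] (hK : K.IsEulerInput) {φ : K.Flag} {x : Plane}
    (hx : x ∈ K.hatSeg t (φ.cross hK)) : ∃ φ', (φ' = φ ∨ φ.Twin φ') ∧ x ∈ φ'.half t := by
  rw [cross, hatSeg_mk, hv_pos] at hx
  by_cases ho : φ.Outer
  · rw [ho.opp_pos] at hx
    refine ⟨φ, Or.inl rfl, ?_⟩
    have h1 := (ht φ.f).pos
    have q1 := φ.q_eq ht
    obtain ⟨r, s, hr, hs, hrs, rfl⟩ := hx
    have e1 := φ.h_combo (φ.q t) φ.vtx hrs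
    have e2 := φ.a_combo (φ.q t) φ.vtx hrs
    rw [q1.1, h_vtx, mul_zero, add_zero] at e1
    rw [q1.2, a_vtx, mul_zero, mul_zero, add_zero] at e2
    refine ⟨⟨?_, ?_⟩, ?_⟩
    · rw [e1]; positivity
    · rw [e1]; nlinarith
    · rw [e2, ho.μ_eq, zero_mul, mul_zero]
  · obtain ⟨ψ, h⟩ := not_outer.1 ho
    rw [h.opp_eq hK, hv_pos] at hx
    rcases le_total 0 (φ.h x) with h0 | h0
    · exact ⟨φ, Or.inl rfl, h.mem_half ht hx h0⟩
    · refine ⟨ψ, Or.inr h, h.symm.mem_half ht (segment_symm ℝ (φ.q t) _ ▸ hx) ?_⟩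
      rw [h.h_eq]; linarith

theorem exists_half' [Finite ι] (hK : K.IsEulerInput) {φ : K.Flag} {x : Plane}
    (hx : x ∈ K.hatSeg t (φ.cross hK)) :
    ∃ φ' : K.Flag, φ'.vtx = φ.vtx ∧ φ'.edge = φ.edge ∧ φ'.cross hK = φ.cross hK ∧ x ∈ φ'.half t := by
  obtain ⟨φ', rfl | h, hx'⟩ := exists_half ht hK hx
  · exact ⟨_, rfl, rfl, rfl, hx'⟩
  · exact ⟨_, h.2.1.symm, h.edge_eq.symm, h.cross_eq hK, hx'⟩

omit ht in
theorem Outer.hatSeg_bot [Finite ι] (hK : K.IsEulerInput) {φ : K.Flag} (h : φ.Outer) :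
    K.hatSeg t (φ.bot hK) = seg φ.edge := by
  rw [bot, hatSeg_mk, h.opp_pos, h.flip.opp_pos, edge, seg_mk]

theorem Outer.seg_subset_mid {φ : K.Flag} (h : φ.Outer) : seg φ.edge ⊆ φ.mid t := by
  intro x hx
  rw [seg_edge, mem_edge_iff] at hx
  have h1 := (ht φ.f).pos
  refine ⟨by rw [hx.1]; exact ⟨le_rfl, h1.le⟩, ?_, ?_⟩
  · rw [h.μ_eq, zero_mul]; exact mul_nonneg h1.le hx.2.1
  · rw [h.flip.μ_eq, zero_mul]; exact mul_nonneg h1.le hx.2.2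

theorem top_subset_mid (φ : K.Flag) : K.hatSeg t φ.top ⊆ φ.mid t := by
  intro x hx
  rw [φ.mem_top_iff ht] at hx
  have h1 := (ht φ.f).pos
  refine ⟨by rw [hx.1]; exact ⟨h1.le, le_rfl⟩, ?_, ?_⟩
  · rw [hx.1, sub_self, mul_zero]; exact mul_nonneg h1.le hx.2.1
  · rw [hx.1, sub_self, mul_zero]; exact mul_nonneg h1.le hx.2.2

end

end Flag

section

variable {t : ι → ℝ} (ht : ∀ f, IsMiteredOffset (K.face f) (t f))

include ht

omit ht in
theorem top_subset_fill (φ : K.Flag) :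
    K.hatSeg t φ.top ⊆ fill ((offset φ.poly (t φ.f)).boundary ℝ) := by
  intro x hx
  rw [top_eq, hatSeg_mk] at hx
  exact subset_fill _ (mem_boundary.2 ⟨φ.i, hx⟩)

theorem eq_of_fill_of_carrier {f g : ι} {x : Plane}
    (hx : x ∈ fill ((offset (K.face f).poly (t f)).boundary ℝ)) (hg : x ∈ (K.face g).carrier) :
    f = g :=
  eq_of_mem_inside ((ht f).fill_subset_inside hx) hg

/-- The offset polygon is inside `f`, so the band belongs to `f` as well; and a band meets the
region of the final curve only at the final height. -/
theorem fill_inter_mid {f : ι} {φ : K.Flag} {x : Plane}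
    (hx : x ∈ fill ((offset (K.face f).poly (t f)).boundary ℝ)) (hφ : x ∈ φ.mid t) :
    φ.f = f ∧ x ∈ K.hatSeg t φ.top := by
  have hb := φ.mid_subset_band ht hφ
  obtain rfl := eq_of_fill_of_carrier ht hx ((ht φ.f).band_subset_carrier _ hb)
  refine ⟨rfl, (φ.mem_top_iff ht).2 ⟨(ht φ.f).hgt_eq_of_fill hb hx, ?_⟩⟩
  exact (φ.mem_band_iff.1 hb).2

theorem fill_inter_tri {f : ι} {φ : K.Flag} {x : Plane}
    (hx : x ∈ fill ((offset (K.face f).poly (t f)).boundary ℝ)) (hφ : x ∈ φ.tri t) :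
    φ.f = f ∧ x = φ.q t := by
  have hb := φ.tri_subset_band ht hφ
  obtain rfl := eq_of_fill_of_carrier ht hx ((ht φ.f).band_subset_carrier _ hb)
  have h1 : φ.h x = t φ.f := (ht φ.f).hgt_eq_of_fill hb hx
  have hq := φ.q_eq ht
  refine ⟨rfl, φ.ext_ha (h1.trans hq.1.symm) ?_⟩
  have h2 := hφ.2.2
  rw [h1, sub_self, mul_zero] at h2
  rw [hq.2]
  have := (ht φ.f).pos
  exact le_antisymm (by by_contra hc; push Not at hc; nlinarith [mul_pos this hc]) hφ.2.1

end

/-! ### The drawing -/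

section Drawing

variable {t : ι → ℝ} [Finite ι] (hK : K.IsEulerInput)
  (ht : ∀ f, IsMiteredOffset (K.face f) (t f))

include hK ht

omit [Finite ι] in
-- Offset vertices lie in the interior of their polygons, the unmoved copies on boundaries. Two
-- unmoved copies of one point lie in the same complementary polygon, since these are disjoint.
theorem pos_injective : Function.Injective (HatVertex.pos (K := K) t) := by
  have hin : ∀ f i, offset (K.face f).poly (t f) i ∈ (K.face f).inside := fun f i =>
    (ht f).fill_subset_inside (subset_fill _ (mem_boundary.2 ⟨i, left_mem_segment _ _ _⟩))
  have hsep : ∀ f i, ∀ v ∈ K.vertices, offset (K.face f).poly (t f) i ≠ v := by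
    rintro f i v hv rfl
    obtain ⟨g, hg⟩ := mem_iUnion.1 hv
    have h1 := SimplePolygon.vertices_subset_boundary hg
    obtain rfl := eq_of_mem_inside (hin f i) (SimplePolygon.boundary_subset_carrier h1)
    exact (hin f i).2 h1
  intro x y hxy
  cases x with
  | ofFace f i =>
    cases y with
    | ofFace g j =>
      change offset (K.face f).poly (t f) i = offset (K.face g).poly (t g) j at hxy
      obtain rfl : f = g := eq_of_mem_inside (hin f i) (hxy ▸ (hin g j).1)
      rw [((ht f).2 _ ⟨(ht f).pos.le, le_rfl⟩).inj hxy]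
    | ofCompl D w hw hD => exact absurd hxy (hsep f i w hw)
  | ofCompl C v hv hC =>
    cases y with
    | ofFace g j => exact absurd hxy.symm (hsep g j v hv)
    | ofCompl D w hw hD =>
      obtain rfl : v = w := hxy
      obtain rfl := eq_of_mem_compl hK hC hD
      rfl

omit ht in
theorem exists_facet (x : K.HatVertex) : ∃ c : K.HatCell, ∃ ε ∈ c.facets, x ∈ ε := by
  cases x with
  | ofFace f i =>
    exact ⟨.ofFace f, _, mem_facets_ofFace.2 ⟨⟨f, i, false⟩, rfl, rfl⟩, Sym2.mem_mk_left _ _⟩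
  | ofCompl C v hv hC =>
    obtain ⟨f, hf⟩ := mem_iUnion.1 hv
    obtain ⟨c, hc, -⟩ := exists_fan hf
    obtain ⟨φ, ho, hφ, rfl⟩ := exists_outer_of_compl hc hC
    refine ⟨.ofVertex φ.vtx c hc, φ.cross hK, (mem_facets_ofVertex hK hc).2 ⟨φ, hφ, rfl, rfl⟩, ?_⟩
    obtain ⟨D, hD⟩ := φ.exists_compl hK ho
    obtain rfl := eq_of_mem_compl hK hC (hD φ.vtx_mem_seg)
    rw [cross, opp_eq hK (y := .ofCompl C φ.vtx hv hC) rfl Sum.inr_ne_inl ⟨φ.edge_mem_edges, hD⟩]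
    exact Sym2.mem_mk_right _ _

omit [Finite ι] hK in
theorem top_inter_top {φ ψ : K.Flag} (hne : φ.top ≠ ψ.top) {x : Plane}
    (hφ : x ∈ K.hatSeg t φ.top) (hψ : x ∈ K.hatSeg t ψ.top) :
    ∃ y ∈ φ.top, y ∈ ψ.top ∧ x = y.pos t := by
  obtain ⟨f, i, b⟩ := φ
  obtain ⟨g, j, c⟩ := ψ
  obtain rfl : f = g := eq_of_fill_of_carrier ht (top_subset_fill _ hφ)
    ((ht _).fill_subset_inside (top_subset_fill _ hψ)).1
  rw [top_eq] at hne hφ hψ ⊢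
  rw [top_eq] at hne ⊢
  dsimp only at *
  have hij : i ≠ j := by rintro rfl; exact hne rfl
  rw [hatSeg_mk] at hφ hψ
  rcases ((ht f).2 _ ⟨(ht f).pos.le, le_rfl⟩).eq_of_mem hij hφ hψ with ⟨rfl, rfl⟩ | ⟨rfl, rfl⟩
  · exact ⟨_, Sym2.mem_mk_right _ _, Sym2.mem_mk_left _ _, rfl⟩
  · exact ⟨_, Sym2.mem_mk_left _ _, Sym2.mem_mk_right _ _, rfl⟩

omit [Finite ι] hK in
theorem hv_mem_top {φ ψ : K.Flag} (hf : φ.f = ψ.f) (h : φ.q t ∈ K.hatSeg t ψ.top) :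
    φ.hv ∈ ψ.top := by
  obtain ⟨f, i, b⟩ := φ
  obtain ⟨g, j, c⟩ := ψ
  obtain rfl : f = g := hf
  rw [top_eq, hatSeg_mk] at h
  rw [top_eq]
  rcases ((ht f).2 _ ⟨(ht f).pos.le, le_rfl⟩).eq_of_vertex_mem h with h | h
  · rw [Sym2.mem_iff]; exact Or.inl (congrArg _ h.symm)
  · rw [Sym2.mem_iff]; exact Or.inr (congrArg _ h.symm)

theorem top_inter_cross {φ ψ : K.Flag} {x : Plane}
    (hφ : x ∈ K.hatSeg t φ.top) (hψ : x ∈ K.hatSeg t (ψ.cross hK)) :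
    ∃ y ∈ φ.top, y ∈ ψ.cross hK ∧ x = y.pos t := by
  obtain ⟨ψ', -, -, h, hx⟩ := exists_half' ht hK hψ
  obtain ⟨h1, rfl⟩ := fill_inter_tri ht (top_subset_fill _ hφ) (ψ'.half_subset_tri ht hx)
  refine ⟨ψ'.hv, hv_mem_top ht h1 hφ, h ▸ Sym2.mem_mk_left _ _, rfl⟩

theorem top_inter_bot {φ ψ : K.Flag} (ho : ψ.Outer) {x : Plane}
    (hφ : x ∈ K.hatSeg t φ.top) (hψ : x ∈ K.hatSeg t (ψ.bot hK)) : False := by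
  rw [ho.hatSeg_bot, seg_edge] at hψ
  have h := (ht _).fill_subset_inside (top_subset_fill _ hφ)
  have h1 := eq_of_mem_inside h (SimplePolygon.edge_subset_carrier _ hψ)
  have h2 := SimplePolygon.edge_subset_boundary _ hψ
  rw [← h1] at h2
  exact h.2 h2

theorem half_inter_half_mate {φ : K.Flag} {x : Plane} (h1 : x ∈ φ.half t)
    (h2 : x ∈ φ.mate.half t) : x = φ.q t := by
  obtain ⟨φ', ψ', h3, h4, -, h5⟩ := mid_inter_mid hK ht φ.mate_edge_ne.symm
    (φ.half_subset_mid ht h1) (φ.mate.half_subset_mid ht h2)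
  rcases h5 with ⟨-, h5⟩ | ⟨o1, o2, h5⟩
  · rw [eq_vtx_of_tri ht (φ.half_subset_tri ht h1) h3 (by rw [h5]; exact (φ'.q_eq ht).2)] at h5
    exact h5
  · exfalso
    have e1 := eq_vtx_of_tri ht (φ.half_subset_tri ht h1) h3 (by rw [h5, a_vtx])
    subst e1
    rcases h4 with rfl | rfl
    · exact not_outer_mate hK o1 o2
    · have := o2.flip
      rw [Flag.flip_flip] at this
      exact not_outer_mate hK o1 this

/-- New edges consist of segments `half` inside triangles. By `tri_inter_tri` there remain two edges
of one polygon, which meet in the offset vertex; twins, which have the same new edge; and the vertex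
itself, where both edges are outer and have the same far copy. -/
theorem cross_inter_cross {φ ψ : K.Flag} (hne : φ.cross hK ≠ ψ.cross hK) {x : Plane}
    (hφ : x ∈ K.hatSeg t (φ.cross hK)) (hψ : x ∈ K.hatSeg t (ψ.cross hK)) :
    ∃ y ∈ φ.cross hK, y ∈ ψ.cross hK ∧ x = y.pos t := by
  obtain ⟨φ', -, -, h1, hx⟩ := exists_half' ht hK hφ
  obtain ⟨ψ', -, -, h2, hx'⟩ := exists_half' ht hK hψ
  rw [← h1, ← h2] at hne ⊢
  obtain ⟨hv, h | h | h⟩ :=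
    tri_inter_tri ht (φ'.half_subset_tri ht hx) (ψ'.half_subset_tri ht hx')
  · rcases eq_or_eq_mate h hv with rfl | rfl
    · exact absurd rfl hne
    · exact ⟨φ'.hv, Sym2.mem_mk_left _ _, φ'.hv_mate ▸ Sym2.mem_mk_left _ _,
        half_inter_half_mate hK ht hx hx'⟩
  · exact absurd (h.cross_eq hK).symm hne
  · have o1 : φ'.Outer := outer_of_mid_vtx ht (h ▸ φ'.half_subset_mid ht hx)
    have o2 : ψ'.Outer := outer_of_mid_vtx ht (hv ▸ h ▸ ψ'.half_subset_mid ht hx')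
    exact ⟨φ'.opp hK, Sym2.mem_mk_right _ _, o1.opp_eq_opp hK o2 hv ▸ Sym2.mem_mk_right _ _,
      by rw [o1.opp_pos, h]⟩

theorem cross_inter_bot {φ ψ : K.Flag} (ho : ψ.Outer) {x : Plane}
    (hφ : x ∈ K.hatSeg t (φ.cross hK)) (hψ : x ∈ K.hatSeg t (ψ.bot hK)) :
    ∃ y ∈ φ.cross hK, y ∈ ψ.bot hK ∧ x = y.pos t := by
  obtain ⟨φ', -, -, h1, hx⟩ := exists_half' ht hK hφ
  rw [← h1]
  rw [ho.hatSeg_bot] at hψ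
  obtain ⟨ψ', h2, hv, h3⟩ := mid_inter_tri ht (ho.seg_subset_mid ht hψ) (φ'.half_subset_tri ht hx)
  have ho' : ψ'.Outer := by
    rcases h2 with rfl | rfl
    exacts [ho, ho.flip]
  have hb : ψ'.opp hK ∈ ψ.bot hK := by
    rcases h2 with rfl | rfl
    exacts [Sym2.mem_mk_left _ _, Sym2.mem_mk_right _ _]
  have hxv : x = ψ'.vtx := by
    rcases h3 with ⟨-, h3⟩ | ⟨h3, -⟩ | ⟨-, -, h3⟩
    · have h0 : ψ'.h x = 0 := by
        rw [seg_edge, mem_edge_iff] at hψ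
        rcases h2 with rfl | rfl
        exacts [hψ.1, hψ.1]
      refine eq_vtx h0 ?_
      have h4 := h3.2
      rw [ho'.μ_eq, zero_mul] at h4
      simpa [(ht ψ'.f).pos.ne'] using h4
    · exact absurd h3 (ho' _)
    · exact h3
  have o1 : φ'.Outer := outer_of_mid_vtx ht (by rw [← hv, ← hxv]; exact φ'.half_subset_mid ht hx)
  exact ⟨ψ'.opp hK, ho'.opp_eq_opp hK o1 hv ▸ Sym2.mem_mk_right _ _, hb, by rw [ho'.opp_pos, hxv]⟩

theorem bot_inter_bot {φ ψ : K.Flag} (ho : φ.Outer) (ho' : ψ.Outer)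
    (hne : φ.bot hK ≠ ψ.bot hK) {x : Plane}
    (hφ : x ∈ K.hatSeg t (φ.bot hK)) (hψ : x ∈ K.hatSeg t (ψ.bot hK)) :
    ∃ y ∈ φ.bot hK, y ∈ ψ.bot hK ∧ x = y.pos t := by
  rw [ho.hatSeg_bot] at hφ
  rw [ho'.hatSeg_bot] at hψ
  have he : φ.edge ≠ ψ.edge := by
    intro he
    by_cases hf : φ.f = ψ.f
    · rcases eq_or_eq_flip hf he with rfl | rfl
      exacts [hne rfl, hne (φ.bot_flip hK).symm]
    · rcases twin_or_twin_flip hf he with h | h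
      exacts [ho _ h, ho _ h]
  obtain ⟨φ', ψ', h1, h2, hv, ⟨-, h⟩ | ⟨o1, o2, h⟩⟩ :=
    mid_inter_mid hK ht he (ho.seg_subset_mid ht hφ) (ho'.seg_subset_mid ht hψ)
  · exfalso
    rw [seg_edge, mem_edge_iff, h] at hφ
    have h3 : φ.h (φ'.q t) = φ'.h (φ'.q t) := by rcases h1 with rfl | rfl <;> rfl
    rw [h3, (φ'.q_eq ht).1] at hφ
    exact (ht φ'.f).pos.ne' hφ.1
  · have hb : φ'.opp hK ∈ φ.bot hK := by
      rcases h1 with rfl | rfl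
      exacts [Sym2.mem_mk_left _ _, Sym2.mem_mk_right _ _]
    have hb' : ψ'.opp hK ∈ ψ.bot hK := by
      rcases h2 with rfl | rfl
      exacts [Sym2.mem_mk_left _ _, Sym2.mem_mk_right _ _]
    exact ⟨φ'.opp hK, hb, o1.opp_eq_opp hK o2 hv ▸ hb', by rw [o1.opp_pos, h]⟩

theorem hatSeg_inter_hatSeg {c d : K.HatCell} {ε δ : Sym2 K.HatVertex} (hε : ε ∈ c.facets)
    (hδ : δ ∈ d.facets) (hne : ε ≠ δ) {x : Plane} (hx : x ∈ K.hatSeg t ε)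
    (hx' : x ∈ K.hatSeg t δ) : ∃ y ∈ ε, y ∈ δ ∧ x = y.pos t := by
  rcases facet_cases hK hε with ⟨φ, rfl⟩ | ⟨φ, rfl⟩ | ⟨φ, ho, rfl⟩ <;>
    rcases facet_cases hK hδ with ⟨ψ, rfl⟩ | ⟨ψ, rfl⟩ | ⟨ψ, ho', rfl⟩
  · exact top_inter_top ht hne hx hx'
  · exact top_inter_cross hK ht hx hx'
  · exact (top_inter_bot hK ht ho' hx hx').elim
  · obtain ⟨y, h1, h2, h3⟩ := top_inter_cross hK ht hx' hx
    exact ⟨y, h2, h1, h3⟩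
  · exact cross_inter_cross hK ht hne hx hx'
  · exact cross_inter_bot hK ht ho' hx hx'
  · exact (top_inter_bot hK ht ho hx' hx).elim
  · obtain ⟨y, h1, h2, h3⟩ := cross_inter_bot hK ht ho hx' hx
    exact ⟨y, h2, h1, h3⟩
  · exact bot_inter_bot hK ht ho ho' hne hx hx'

/-- Each vertex is an end of some facet, so the claim is a case of the intersection of two facets.
-/
theorem mem_of_pos_mem {c : K.HatCell} {ε : Sym2 K.HatVertex} (hε : ε ∈ c.facets)
    {x : K.HatVertex} (hx : x.pos t ∈ K.hatSeg t ε) : x ∈ ε := by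
  obtain ⟨d, δ, hδ, hxδ⟩ := exists_facet hK x
  by_cases hne : ε = δ
  · exact hne ▸ hxδ
  · obtain ⟨y, h1, -, h3⟩ := hatSeg_inter_hatSeg hK ht hε hδ hne hx (pos_mem_hatSeg t hxδ)
    rwa [pos_injective hK ht h3]

theorem isStraightPlaneDrawing : IsStraightPlaneDrawing K.hatGraph (HatVertex.pos t) := by
  refine ⟨pos_injective hK ht, fun ε hε x hx => ?_, fun ε hε δ hδ hne x hx => ?_⟩
  · obtain ⟨c, hc⟩ := (mem_edgeSet_iff hK).1 hε
    exact mem_of_pos_mem hK ht hc hx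
  · obtain ⟨c, hc⟩ := (mem_edgeSet_iff hK).1 hε
    obtain ⟨d, hd⟩ := (mem_edgeSet_iff hK).1 hδ
    obtain ⟨y, h1, h2, h3⟩ := hatSeg_inter_hatSeg hK ht hc hd hne hx.1 hx.2
    exact ⟨y, ⟨h1, h2⟩, h3.symm⟩

/-- A cycle of edges of the Euler transformation is realized by a simple polygon. -/
theorem isSimple_of_cycle {n : ℕ} (hn : 3 ≤ n) {w : Fin n → K.HatVertex}
    (hw : Function.Injective w) {c : K.HatCell}
    (hc : ∀ i, s(w i, w (finRotate n i)) ∈ c.facets) :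
    IsSimple (⟨fun i => (w i).pos t⟩ : Polygon Plane n) := by
  set p : Polygon Plane n := ⟨fun i => (w i).pos t⟩ with hp
  have he : ∀ i, p.edgeSet ℝ i = K.hatSeg t s(w i, w (finRotate n i)) := by
    intro i
    rw [edgeSet_eq, hatSeg_mk]
  have hne : ∀ i j, i ≠ j → s(w i, w (finRotate n i)) ≠ s(w j, w (finRotate n j)) := by
    intro i j hij h
    rcases Sym2.eq_iff.1 h with ⟨h1, -⟩ | ⟨h1, h2⟩
    · exact hij (hw h1)
    · have h1 := hw h1
      have h2 := hw h2
      rw [h1] at h2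
      exact finRotate_finRotate_ne hn j h2
  have hsub : ∀ i j, i ≠ j → ∀ x ∈ p.edgeSet ℝ i ∩ p.edgeSet ℝ j,
      (j = finRotate n i ∧ x = p j) ∨ (i = finRotate n j ∧ x = p i) := by
    rintro i j hij x ⟨h1, h2⟩
    rw [he] at h1 h2
    obtain ⟨y, h3, h4, rfl⟩ := hatSeg_inter_hatSeg hK ht (hc i) (hc j) (hne i j hij) h1 h2
    rcases Sym2.mem_iff.1 h3 with rfl | rfl <;> rcases Sym2.mem_iff.1 h4 with h5 | h5
    · exact absurd (hw h5) hij
    · exact Or.inr ⟨hw h5, rfl⟩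
    · exact Or.inl ⟨(hw h5).symm, congrArg (fun z => HatVertex.pos t z) h5⟩
    · exact absurd ((finRotate n).injective (hw h5)) hij
  refine ⟨hn, (pos_injective hK ht).comp hw, fun i => ?_, fun i j h1 h2 h3 => ?_⟩
  · have hi : i ≠ finRotate n i := (finRotate_ne hn i).symm
    refine Subset.antisymm (fun x hx => ?_) ?_
    · rcases hsub _ _ hi x hx with ⟨-, h⟩ | ⟨h, -⟩
      · exact h
      · exact absurd h.symm (finRotate_finRotate_ne hn i)
    · rw [singleton_subset_iff, edgeSet_eq, edgeSet_eq]
      exact ⟨right_mem_segment _ _ _, left_mem_segment _ _ _⟩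
  · rw [Set.disjoint_left]
    intro x hi hj
    rcases hsub i j h1.symm x ⟨hi, hj⟩ with ⟨h, -⟩ | ⟨h, -⟩
    exacts [h2 h, h3 h]

end Drawing

end PolygonalComplex

theorem IsStraightPlaneDrawing.isPlanar {V : Type*} {G : SimpleGraph V} {p : V → Plane}
    (h : IsStraightPlaneDrawing G p) : IsPlanar G := by
  have hr : ∀ a b : Plane, Set.range (fun s : unitInterval => AffineMap.lineMap a b (s : ℝ)) =
      segment ℝ a b := by
    intro a b
    rw [segment_eq_image_lineMap]
    ext x
    constructor
    · rintro ⟨s, rfl⟩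
      exact ⟨s, s.2, rfl⟩
    · rintro ⟨s, hs, rfl⟩
      exact ⟨⟨s, hs⟩, rfl⟩
  have key : ∀ e : G.edgeSet, ∃ γ : unitInterval → Plane, Continuous γ ∧ Function.Injective γ ∧
      s(γ 0, γ 1) = e.1.map p ∧ Set.range γ = seg (e.1.map p) := by
    rintro ⟨e, he⟩
    induction e with
    | h x y =>
      have hxy : p x ≠ p y := fun hp => G.ne_of_adj he (h.1 hp)
      refine ⟨fun s => AffineMap.lineMap (p x) (p y) (s : ℝ), ?_, ?_, ?_, ?_⟩
      · exact AffineMap.lineMap_continuous.comp continuous_subtype_val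
      · exact (AffineMap.lineMap_injective ℝ hxy).comp Subtype.val_injective
      · simp
      · rw [hr, Sym2.map_mk, seg_mk]
  choose γ h1 h2 h3 h4 using key
  refine ⟨p, γ, h.1, fun e => ⟨h1 e, h2 e, h3 e⟩, fun e v hv => ?_, fun e e' hne => ?_⟩
  · rw [h4] at hv
    exact h.2.1 e e.2 v hv
  · rw [h4, h4]
    exact h.2.2 e e.2 e' e'.2 fun h => hne (Subtype.ext h)

end EulerTransform

namespace EulerTransform
variable {ι : Type*}

namespace PolygonalComplex

variable {K : PolygonalComplex ι}

open EulerTransform.PolygonalComplex.Flag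

/-! ### The regions of the cells -/

variable {t : ι → ℝ}

namespace Flag

theorem convex_tri (φ : K.Flag) : Convex ℝ (φ.tri t) := by
  intro x hx y hy r s hr hs hrs
  obtain ⟨⟨x1, x2⟩, x3, x4⟩ := hx
  obtain ⟨⟨y1, y2⟩, y3, y4⟩ := hy
  obtain rfl : r = 1 - s := by linarith
  simp only [tri, mem_ofPred_eq, h_combo _ _ _ hrs, a_combo _ _ _ hrs]
  refine ⟨⟨by positivity, by nlinarith⟩, by positivity, by nlinarith⟩

theorem convex_mid (φ : K.Flag) : Convex ℝ (φ.mid t) := by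
  intro x hx y hy r s hr hs hrs
  obtain ⟨⟨x1, x2⟩, x3, x4⟩ := hx
  obtain ⟨⟨y1, y2⟩, y3, y4⟩ := hy
  obtain rfl : r = 1 - s := by linarith
  simp only [mid, mem_ofPred_eq, h_combo _ _ _ hrs, a_combo _ _ _ hrs]
  refine ⟨⟨by positivity, by nlinarith⟩, by nlinarith, by nlinarith⟩

variable (ht : ∀ f, IsMiteredOffset (K.face f) (t f))

include ht

theorem vtx_mem_tri (φ : K.Flag) : φ.vtx ∈ φ.tri t := by
  have h1 := (ht φ.f).pos
  have h2 := φ.μ_nonneg ht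
  refine ⟨by rw [h_vtx]; exact ⟨le_rfl, h1.le⟩, by rw [a_vtx], ?_⟩
  rw [a_vtx, h_vtx, sub_zero, mul_zero]
  positivity

/-- The point in which the new edge at the vertex of a flag meets the edge of the flag. -/
theorem crossing_mem_mid (φ : K.Flag) : φ.vtx + φ.μ t • φ.dir ∈ φ.mid t := by
  have h1 := (ht φ.f).pos
  have e1 : φ.h (φ.vtx + φ.μ t • φ.dir) = 0 := by
    rw [h_add_smul, h_vtx, φ.frame.nd, mul_zero, add_zero]
  have e2 : φ.a (φ.vtx + φ.μ t • φ.dir) = φ.μ t := by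
    rw [a_add_smul, a_vtx, φ.frame.nd, φ.frame.dd]; ring
  have e3 := φ.a_add (φ.vtx + φ.μ t • φ.dir)
  have e4 := φ.μ_add_lt ht
  rw [e1, e2, zero_mul, sub_zero] at e3
  refine ⟨by rw [e1]; exact ⟨le_rfl, h1.le⟩, ?_, ?_⟩
  · rw [e1, e2, sub_zero, mul_comm]
  · rw [e1, sub_zero, mul_comm]
    exact mul_le_mul_of_nonneg_left (by linarith) h1.le

theorem crossing_mem_mid_of_edge_eq {φ χ : K.Flag} (he : φ.edge = χ.edge) :
    φ.vtx + φ.μ t • φ.dir ∈ χ.mid t := by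
  have htw : ∀ {χ : K.Flag}, φ.Twin χ → φ.vtx + φ.μ t • φ.dir ∈ χ.mid t := by
    intro χ h
    rw [h.2.1, ← h.μ_eq_μ, ← h.dir_eq]
    exact χ.crossing_mem_mid ht
  by_cases hf : φ.f = χ.f
  · rcases eq_or_eq_flip hf he with rfl | rfl
    · exact χ.crossing_mem_mid ht
    · rw [mid_flip]; exact φ.crossing_mem_mid ht
  · rcases twin_or_twin_flip hf he with h | h
    · exact htw h
    · rw [← mid_flip]; exact htw h

end Flag

theorem hatSeg_subset_region {c : K.HatCell} {ε : Sym2 K.HatVertex} (h : ε ∈ c.facets) :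
    K.hatSeg t ε ⊆ c.region t :=
  (subset_iUnion₂ (s := fun ε _ => K.hatSeg t ε) ε h).trans (subset_fill _)

theorem pos_mem_region {c : K.HatCell} {ε : Sym2 K.HatVertex} (h : ε ∈ c.facets)
    {x : K.HatVertex} (hx : x ∈ ε) : x.pos t ∈ c.region t :=
  hatSeg_subset_region h (pos_mem_hatSeg t hx)

theorem region_ofFace (f : ι) : (HatCell.ofFace f : K.HatCell).region t =
    fill ((offset (K.face f).poly (t f)).boundary ℝ) := by
  rw [HatCell.region, boundary_eq]
  congr 1
  ext x
  simp only [mem_iUnion]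
  constructor
  · rintro ⟨_, ⟨i, rfl⟩, hx⟩
    rw [hatSeg_mk] at hx
    exact ⟨i, hx⟩
  · rintro ⟨i, hx⟩
    exact ⟨_, ⟨i, rfl⟩, by rw [hatSeg_mk]; exact hx⟩

section

variable [Finite ι] (hK : K.IsEulerInput) (ht : ∀ f, IsMiteredOffset (K.face f) (t f))

include hK ht

/-- The middle pieces of the flags of `e` are convex and all contain the crossing point at distance
μ from one end, so their union is star-shaped. It contains the facets. -/
theorem exists_mid_of_region {e : Sym2 Plane} {he : e ∈ K.edges} {x : Plane}
    (hx : x ∈ (HatCell.ofEdge e he : K.HatCell).region t) : ∃ φ : K.Flag, φ.edge = e ∧ x ∈ φ.mid t := by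
  obtain ⟨φ, hφ⟩ := exists_of_edges he
  have hS : StarConvex ℝ (φ.vtx + φ.μ t • φ.dir) (⋃ χ : {χ : K.Flag // χ.edge = e}, χ.1.mid t) :=
    starConvex_iUnion fun χ =>
      χ.1.convex_mid (crossing_mem_mid_of_edge_eq ht (hφ.trans χ.2.symm))
  have hcross : ∀ ψ : K.Flag, ψ.edge = e → K.hatSeg t (ψ.cross hK) ⊆
      ⋃ χ : {χ : K.Flag // χ.edge = e}, χ.1.mid t := by
    intro ψ hψ y hy
    obtain ⟨χ, -, h1, -, h2⟩ := exists_half' ht hK hy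
    exact mem_iUnion.2 ⟨⟨χ, h1.trans hψ⟩, χ.half_subset_mid ht h2⟩
  have := fill_subset_of_starConvex hS
    (mem_iUnion.2 ⟨⟨φ, hφ⟩, φ.crossing_mem_mid ht⟩)
    (iUnion₂_subset fun ε hε => ?_) hx
  · obtain ⟨χ, h⟩ := mem_iUnion.1 this
    exact ⟨χ.1, χ.2, h⟩
  · rcases (mem_facets_ofEdge hK he hφ).1 hε with rfl | rfl | rfl | rfl
    · exact (φ.top_subset_mid ht).trans
        (subset_iUnion (fun χ : {χ : K.Flag // χ.edge = e} => χ.1.mid t) ⟨φ, hφ⟩)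
    · by_cases ho : φ.Outer
      · rw [ho.hatSeg_bot]
        exact (ho.seg_subset_mid ht).trans
          (subset_iUnion (fun χ : {χ : K.Flag // χ.edge = e} => χ.1.mid t) ⟨φ, hφ⟩)
      · obtain ⟨ψ, hψ⟩ := not_outer.1 ho
        rw [hψ.bot_eq]
        exact (ψ.top_subset_mid ht).trans (subset_iUnion
          (fun χ : {χ : K.Flag // χ.edge = e} => χ.1.mid t) ⟨ψ, hψ.edge_eq ▸ hφ⟩)
    · exact hcross φ hφ
    · exact hcross φ.flip (φ.edge_flip.trans hφ)

/-- The triangles of the fan are convex with the common point `v`, so their union is star-shaped. -/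
theorem exists_tri_of_region {v : Plane} {c : Set ι} {hc : c ∈ K.fans v} {x : Plane}
    (hx : x ∈ (HatCell.ofVertex v c hc : K.HatCell).region t) :
    ∃ φ : K.Flag, φ.f ∈ c ∧ φ.vtx = v ∧ x ∈ φ.tri t := by
  have hS : StarConvex ℝ v (⋃ χ : {χ : K.Flag // χ.f ∈ c ∧ χ.vtx = v}, χ.1.tri t) :=
    starConvex_iUnion fun χ => by
      have := χ.1.convex_tri (t := t) (χ.1.vtx_mem_tri ht)
      rwa [χ.2.2] at this
  obtain ⟨g, hg⟩ := nonempty_of_fan hc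
  obtain ⟨φ, rfl, rfl, -⟩ := exists_flag (mem_vertices_of_fan hc hg) false
  have := fill_subset_of_starConvex hS
    (mem_iUnion.2 ⟨⟨φ, hg, rfl⟩, φ.vtx_mem_tri ht⟩)
    (iUnion₂_subset fun ε hε => ?_) hx
  · obtain ⟨χ, h⟩ := mem_iUnion.1 this
    exact ⟨χ.1, χ.2.1, χ.2.2, h⟩
  · obtain ⟨ψ, hψ, hv, rfl⟩ := (mem_facets_ofVertex hK hc).1 hε
    intro y hy
    obtain ⟨χ, h1, h2⟩ := exists_half ht hK hy
    refine mem_iUnion.2 ⟨⟨χ, ?_⟩, χ.half_subset_tri ht h2⟩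
    rcases h1 with rfl | h1
    · exact ⟨hψ, hv⟩
    · exact ⟨mem_fan_of_twin (hv ▸ hc) h1 hψ, h1.2.1 ▸ hv⟩

/-! ### Cells meet properly -/

omit [Finite ι] hK ht in
theorem HatCell.MeetProperly.symm {c d : K.HatCell} (h : c.MeetProperly t d) :
    d.MeetProperly t c := by
  rw [HatCell.MeetProperly, inter_comm]
  rcases h with h | ⟨x, h1, h2, h3⟩ | ⟨ε, h1, h2, h3⟩
  exacts [Or.inl h, Or.inr (Or.inl ⟨x, h2, h1, h3⟩), Or.inr (Or.inr ⟨ε, h2, h1, h3⟩)]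

omit [Finite ι] hK ht in
theorem meetProperly_of_vertex {c d : K.HatCell} {x : K.HatVertex}
    (hc : ∃ ε ∈ c.facets, x ∈ ε) (hd : ∃ ε ∈ d.facets, x ∈ ε)
    (h : ∀ y ∈ c.region t ∩ d.region t, y = x.pos t) : c.MeetProperly t d := by
  refine Or.inr (Or.inl ⟨x, hc, hd, Subset.antisymm h ?_⟩)
  obtain ⟨ε, hε, hx⟩ := hc
  obtain ⟨δ, hδ, hx'⟩ := hd
  exact singleton_subset_iff.2 ⟨pos_mem_region hε hx, pos_mem_region hδ hx'⟩

omit [Finite ι] hK ht in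
theorem meetProperly_of_facet {c d : K.HatCell} {ε : Sym2 K.HatVertex}
    (hc : ε ∈ c.facets) (hd : ε ∈ d.facets)
    (h : c.region t ∩ d.region t ⊆ K.hatSeg t ε) : c.MeetProperly t d :=
  Or.inr (Or.inr ⟨ε, hc, hd, Subset.antisymm h
    (subset_inter (hatSeg_subset_region hc) (hatSeg_subset_region hd))⟩)

omit [Finite ι] hK in
theorem disjoint_ofFace {f g : ι} (hfg : f ≠ g) :
    Disjoint ((HatCell.ofFace f : K.HatCell).region t)
      ((HatCell.ofFace g : K.HatCell).region t) := by
  rw [region_ofFace, region_ofFace, Set.disjoint_left]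
  intro x hf hg
  exact hfg (eq_of_fill_of_carrier ht hf ((ht g).fill_subset_inside hg).1)

theorem meetProperly_ofFace_ofEdge {f : ι} {e : Sym2 Plane} (he : e ∈ K.edges) :
    (HatCell.ofFace f : K.HatCell).MeetProperly t (.ofEdge e he) := by
  have key : ∀ x ∈ (HatCell.ofFace f : K.HatCell).region t ∩
      (HatCell.ofEdge e he : K.HatCell).region t,
      ∃ φ : K.Flag, φ.edge = e ∧ φ.f = f ∧ x ∈ K.hatSeg t φ.top := by
    rintro x ⟨h1, h2⟩
    obtain ⟨φ, h3, h4⟩ := exists_mid_of_region hK ht h2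
    rw [region_ofFace] at h1
    exact ⟨φ, h3, fill_inter_mid ht h1 h4⟩
  by_cases hex : ∃ φ : K.Flag, φ.edge = e ∧ φ.f = f
  · obtain ⟨φ, h1, h2⟩ := hex
    refine meetProperly_of_facet (mem_facets_ofFace.2 ⟨φ, h2, rfl⟩)
      ((mem_facets_ofEdge hK he h1).2 (Or.inl rfl)) fun x hx => ?_
    obtain ⟨ψ, h3, h4, h5⟩ := key x hx
    rcases eq_or_eq_flip (h2.trans h4.symm) (h1.trans h3.symm) with rfl | rfl
    · exact h5
    · rwa [top_flip] at h5
  · refine Or.inl (eq_empty_of_forall_notMem fun x hx => hex ?_)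
    obtain ⟨ψ, h3, h4, -⟩ := key x hx
    exact ⟨ψ, h3, h4⟩

theorem meetProperly_ofFace_ofVertex {f : ι} {v : Plane} {c : Set ι} (hc : c ∈ K.fans v) :
    (HatCell.ofFace f : K.HatCell).MeetProperly t (.ofVertex v c hc) := by
  have key : ∀ x ∈ (HatCell.ofFace f : K.HatCell).region t ∩
      (HatCell.ofVertex v c hc : K.HatCell).region t,
      ∃ φ : K.Flag, φ.f ∈ c ∧ φ.vtx = v ∧ φ.f = f ∧ x = φ.hv.pos t := by
    rintro x ⟨h1, h2⟩
    obtain ⟨φ, h3, h4, h5⟩ := exists_tri_of_region hK ht h2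
    rw [region_ofFace] at h1
    exact ⟨φ, h3, h4, fill_inter_tri ht h1 h5⟩
  by_cases hex : ∃ φ : K.Flag, φ.f ∈ c ∧ φ.vtx = v ∧ φ.f = f
  · obtain ⟨φ, h0, h1, h2⟩ := hex
    refine meetProperly_of_vertex (x := φ.hv)
      ⟨φ.top, mem_facets_ofFace.2 ⟨φ, h2, rfl⟩, Sym2.mem_mk_left _ _⟩
      ⟨φ.cross hK, (mem_facets_ofVertex hK hc).2 ⟨φ, h0, h1, rfl⟩, Sym2.mem_mk_left _ _⟩
      fun x hx => ?_
    obtain ⟨ψ, -, h3, h4, h5⟩ := key x hx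
    rw [h5]
    congr 1
    exact HatVertex.ext_of (congrArg Sum.inl (h4.trans h2.symm)) (h3.trans h1.symm)
  · refine Or.inl (eq_empty_of_forall_notMem fun x hx => hex ?_)
    obtain ⟨ψ, h0, h3, h4, -⟩ := key x hx
    exact ⟨ψ, h0, h3, h4⟩

omit ht in
/-- A polygon, hole or outside, and a common vertex of two of its edges, are determined by the two
edges. -/
theorem hatVertex_eq_of_edges {e e' : Sym2 Plane} (hne : e ≠ e') {x y : K.HatVertex}
    (hx : x.base ∈ e) (hx' : x.base ∈ e') (hxe : e ∈ K.edgesOf x.owner)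
    (hxe' : e' ∈ K.edgesOf x.owner) (hy : y.base ∈ e) (hy' : y.base ∈ e')
    (hye : e ∈ K.edgesOf y.owner) (hye' : e' ∈ K.edgesOf y.owner) : x = y := by
  have hb : x.base = y.base := by
    by_contra hb
    exact hne (Sym2.eq_of_ne_mem hb hx hy hx' hy')
  -- A polygon of the complex and a hole or the outside that share both edges would violate
  -- `not_outer_mate`.
  have hmix : ∀ (f : ι) (C : K.ComplPolygon) (v : Plane), v ∈ e → v ∈ e' →
      e ∈ K.edgesOf (.inl f) → e' ∈ K.edgesOf (.inl f) → e ∈ K.edgesOf (.inr C) →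
      e' ∈ K.edgesOf (.inr C) → False := by
    intro f C v hv hv' h1 h2 h3 h4
    obtain ⟨φ, rfl, rfl, rfl⟩ := exists_of_mem (K := K) (f := f) h1 hv
    obtain ⟨ψ, h5, rfl, h6⟩ := exists_of_mem (K := K) (f := φ.f) h2 hv'
    rcases eq_or_eq_mate h5.symm h6.symm with rfl | rfl
    · exact hne rfl
    · exact not_outer_mate hK (φ := φ) (fun χ hχ => hχ.not_seg_subset C h3.2)
        fun χ hχ => hχ.not_seg_subset C h4.2
  refine HatVertex.ext_of ?_ hb
  generalize x.owner = o at *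
  generalize y.owner = o' at *
  cases o with
  | inl f =>
    cases o' with
    | inl g =>
      by_contra hfg
      exact hne (eq_of_common_edges (fun h => hfg (by rw [h])) hxe hxe' hye hye')
    | inr D => exact (hmix f D _ hx hx' hxe hxe' hye hye').elim
  | inr C =>
    cases o' with
    | inl g => exact (hmix g C _ hx hx' hye hye' hxe hxe').elim
    | inr D =>
      obtain ⟨φ, rfl⟩ := exists_of_edges hxe.1
      rw [eq_of_mem_compl hK (hxe.2 φ.vtx_mem_seg) (hye.2 φ.vtx_mem_seg)]

omit ht in
theorem exists_facet_ofEdge {e : Sym2 Plane} (he : e ∈ K.edges) {x : K.HatVertex}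
    (hx : x.base ∈ e) (hxe : e ∈ K.edgesOf x.owner) :
    ∃ ε ∈ (HatCell.ofEdge e he : K.HatCell).facets, x ∈ ε := by
  obtain ⟨f, hf⟩ := mem_iUnion.1 he
  obtain ⟨φ, rfl, rfl, h⟩ := exists_of_mem (K := K) hf hx
  refine ⟨φ.cross hK, (mem_facets_ofEdge hK he rfl).2 (Or.inr (Or.inr (Or.inl rfl))), ?_⟩
  by_cases ho : x.owner = Sum.inl φ.f
  · rw [HatVertex.ext_of (y := φ.hv) ho h.symm]
    exact Sym2.mem_mk_left _ _
  · rw [← opp_eq hK h.symm ho hxe]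
    exact Sym2.mem_mk_right _ _

/-- Each common point is a copy of a common end, in a polygon, hole or outside that has both edges.
By `hatVertex_eq_of_edges` there is only one such copy. -/
theorem meetProperly_ofEdge_ofEdge {e e' : Sym2 Plane} (he : e ∈ K.edges) (he' : e' ∈ K.edges)
    (hne : e ≠ e') : (HatCell.ofEdge e he : K.HatCell).MeetProperly t (.ofEdge e' he') := by
  have key : ∀ x ∈ (HatCell.ofEdge e he : K.HatCell).region t ∩
      (HatCell.ofEdge e' he' : K.HatCell).region t,
      ∃ y : K.HatVertex, y.base ∈ e ∧ y.base ∈ e' ∧ e ∈ K.edgesOf y.owner ∧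
        e' ∈ K.edgesOf y.owner ∧ x = y.pos t := by
    rintro x ⟨h1, h2⟩
    obtain ⟨φ, rfl, h4⟩ := exists_mid_of_region hK ht h1
    obtain ⟨ψ, rfl, h6⟩ := exists_mid_of_region hK ht h2
    obtain ⟨φ', ψ', h7, h8, hv, h9⟩ := mid_inter_mid hK ht hne h4 h6
    have e1 : φ'.edge = φ.edge := by
      rcases h7 with rfl | rfl
      exacts [rfl, edge_flip _]
    have e2 : ψ'.edge = ψ.edge := by
      rcases h8 with rfl | rfl
      exacts [rfl, edge_flip _]
    rw [← e1, ← e2]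
    rcases h9 with ⟨hf, h9⟩ | ⟨o1, o2, h9⟩
    · exact ⟨φ'.hv, φ'.vtx_mem_edge, by rw [hv_base, hv]; exact ψ'.vtx_mem_edge, φ'.edge_mem,
        by rw [hv_owner, hf]; exact ψ'.edge_mem, h9⟩
    · refine ⟨φ'.opp hK, by rw [opp_base]; exact φ'.vtx_mem_edge,
        by rw [opp_base, hv]; exact ψ'.vtx_mem_edge, φ'.edge_mem_opp hK, ?_, by rw [o1.opp_pos, h9]⟩
      rw [o1.opp_eq_opp hK o2 hv]
      exact ψ'.edge_mem_opp hK
  by_cases hex : ((HatCell.ofEdge e he : K.HatCell).region t ∩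
      (HatCell.ofEdge e' he' : K.HatCell).region t).Nonempty
  · obtain ⟨x, hx⟩ := hex
    obtain ⟨y, y1, y2, y3, y4, -⟩ := key x hx
    refine meetProperly_of_vertex (x := y) (exists_facet_ofEdge hK he y1 y3)
      (exists_facet_ofEdge hK he' y2 y4) fun x' hx' => ?_
    obtain ⟨z, z1, z2, z3, z4, rfl⟩ := key x' hx'
    rw [hatVertex_eq_of_edges hK hne y1 y2 y3 y4 z1 z2 z3 z4]
  · exact Or.inl (not_nonempty_iff_eq_empty.1 hex)

theorem meetProperly_ofEdge_ofVertex {e : Sym2 Plane} (he : e ∈ K.edges) {v : Plane} {c : Set ι}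
    (hc : c ∈ K.fans v) :
    (HatCell.ofEdge e he : K.HatCell).MeetProperly t (.ofVertex v c hc) := by
  have key : ∀ x ∈ (HatCell.ofEdge e he : K.HatCell).region t ∩
      (HatCell.ofVertex v c hc : K.HatCell).region t,
      ∃ φ : K.Flag, φ.edge = e ∧ φ.vtx = v ∧
        ((φ.f ∈ c ∧ x ∈ φ.half t) ∨ (φ.Outer ∧ x = v)) := by
    rintro x ⟨h1, h2⟩
    obtain ⟨φ, rfl, h4⟩ := exists_mid_of_region hK ht h1
    obtain ⟨ψ, h5, rfl, h6⟩ := exists_tri_of_region hK ht h2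
    obtain ⟨φ', h7, hv, h9⟩ := mid_inter_tri ht h4 h6
    have e1 : φ'.edge = φ.edge := by
      rcases h7 with rfl | rfl
      exacts [rfl, edge_flip _]
    refine ⟨φ', e1, hv, ?_⟩
    rcases h9 with ⟨hf, h9⟩ | ⟨htw, h9⟩ | ⟨-, ho, h9⟩
    · exact Or.inl ⟨hf ▸ h5, h9⟩
    · exact Or.inl ⟨mem_fan_of_twin hc htw.symm h5, h9⟩
    · exact Or.inr ⟨ho, h9.trans hv⟩
  by_cases hex : ∃ χ : K.Flag, χ.edge = e ∧ χ.vtx = v ∧ χ.f ∈ c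
  · obtain ⟨χ, h1, h2, h3⟩ := hex
    refine meetProperly_of_facet (ε := χ.cross hK)
      ((mem_facets_ofEdge hK he h1).2 (Or.inr (Or.inr (Or.inl rfl))))
      ((mem_facets_ofVertex hK hc).2 ⟨χ, h3, h2, rfl⟩) fun x hx => ?_
    obtain ⟨φ, h4, h5, ⟨h6, h7⟩ | ⟨ho, rfl⟩⟩ := key x hx
    · have := φ.half_subset_hatSeg ht hK h7
      by_cases hf : χ.f = φ.f
      · rwa [eq_of_edge_eq hf (h1.trans h4.symm) (h2.trans h5.symm)]
      · rwa [(twin_of_edge_eq hf (h1.trans h4.symm) (h2.trans h5.symm)).cross_eq] at this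
    · obtain rfl := eq_of_outer ho (h4.trans h1.symm) (h5.trans h2.symm)
      have := pos_mem_hatSeg (ε := φ.cross hK) t (Sym2.mem_mk_right _ _)
      rwa [ho.opp_pos, h5] at this
  -- If no polygon of the fan has the edge `e` at `v`, only `v` itself can be common. In this case
  -- `v` lies in a complementary polygon, the fan has an outer edge there, and so both cells have
  -- the unmoved copy of `v` as a vertex.
  · have key' : ∀ x ∈ (HatCell.ofEdge e he : K.HatCell).region t ∩
        (HatCell.ofVertex v c hc : K.HatCell).region t,
        x = v ∧ ∃ φ : K.Flag, φ.edge = e ∧ φ.vtx = v ∧ φ.Outer := by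
      intro x hx
      obtain ⟨φ, h4, h5, ⟨h6, h7⟩ | ⟨ho, rfl⟩⟩ := key x hx
      · exact absurd ⟨φ, h4, h5, h6⟩ hex
      · exact ⟨rfl, φ, h4, h5, ho⟩
    by_cases hne : ((HatCell.ofEdge e he : K.HatCell).region t ∩
        (HatCell.ofVertex v c hc : K.HatCell).region t).Nonempty
    · obtain ⟨x, hx⟩ := hne
      obtain ⟨-, φ, h1, h2, ho⟩ := key' x hx
      obtain ⟨C, hC⟩ := φ.exists_compl hK ho
      have hvC := hC φ.vtx_mem_seg
      rw [h2] at hvC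
      obtain ⟨χ, ho', hχ, hv⟩ := exists_outer_of_compl hc hvC
      refine meetProperly_of_vertex (x := φ.opp hK)
        ⟨φ.bot hK, (mem_facets_ofEdge hK he h1).2 (Or.inr (Or.inl rfl)), Sym2.mem_mk_left _ _⟩
        ⟨χ.cross hK, (mem_facets_ofVertex hK hc).2 ⟨χ, hχ, hv, rfl⟩, ?_⟩ fun x' hx' => ?_
      · rw [ho.opp_eq_opp hK ho' (h2.trans hv.symm)]
        exact Sym2.mem_mk_right _ _
      · rw [(key' x' hx').1, ho.opp_pos, h2]
    · exact Or.inl (not_nonempty_iff_eq_empty.1 hne)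

theorem disjoint_ofVertex {u v : Plane} {c d : Set ι} (hc : c ∈ K.fans u) (hd : d ∈ K.fans v)
    (huv : u ≠ v) : Disjoint ((HatCell.ofVertex u c hc : K.HatCell).region t)
      ((HatCell.ofVertex v d hd : K.HatCell).region t) := by
  rw [Set.disjoint_left]
  intro x h1 h2
  obtain ⟨φ, -, rfl, hφ⟩ := exists_tri_of_region hK ht h1
  obtain ⟨ψ, -, rfl, hψ⟩ := exists_tri_of_region hK ht h2
  exact huv (tri_inter_tri ht hφ hψ).1

/-- Both fans have an outer edge at `v`, and so both cells have the unmoved copy of `v` as a vertex.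
Triangles of different fans belong neither to one polygon nor to twins, so they have only `v` in
common. -/
theorem meetProperly_ofVertex_ofVertex {v : Plane} {c d : Set ι} (hc : c ∈ K.fans v)
    (hd : d ∈ K.fans v) (hcd : c ≠ d) :
    (HatCell.ofVertex v c hc : K.HatCell).MeetProperly t (.ofVertex v d hd) := by
  obtain ⟨χ, o1, h1, v1⟩ := exists_outer_of_ne hc hd hcd
  obtain ⟨χ', o2, h2, v2⟩ := exists_outer_of_ne hd hc hcd.symm
  refine meetProperly_of_vertex (x := χ.opp hK)
    ⟨χ.cross hK, (mem_facets_ofVertex hK hc).2 ⟨χ, h1, v1, rfl⟩, Sym2.mem_mk_right _ _⟩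
    ⟨χ'.cross hK, (mem_facets_ofVertex hK hd).2 ⟨χ', h2, v2, rfl⟩, ?_⟩ ?_
  · rw [o1.opp_eq_opp hK o2 (v1.trans v2.symm)]
    exact Sym2.mem_mk_right _ _
  · rintro x ⟨hx, hx'⟩
    rw [o1.opp_pos, v1]
    obtain ⟨φ, h3, rfl, hφ⟩ := exists_tri_of_region hK ht hx
    obtain ⟨ψ, h4, hv, hψ⟩ := exists_tri_of_region hK ht hx'
    rcases (tri_inter_tri ht hφ hψ).2 with h | h | h
    · exact absurd (fan_eq hc hd h3 (h ▸ h4)) hcd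
    · exact absurd (fan_eq hc hd (mem_fan_of_twin hc h h3) h4) hcd
    · exact h

theorem meetProperly {c d : K.HatCell} (hcd : c ≠ d) : c.MeetProperly t d := by
  cases c with
  | ofFace f =>
    cases d with
    | ofFace g => exact Or.inl (disjoint_ofFace ht fun h => hcd (by rw [h])).inter_eq
    | ofEdge e he => exact meetProperly_ofFace_ofEdge hK ht he
    | ofVertex v c hc => exact meetProperly_ofFace_ofVertex hK ht hc
  | ofEdge e he =>
    cases d with
    | ofFace g => exact (meetProperly_ofFace_ofEdge hK ht he).symm
    | ofEdge e' he' =>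
      exact meetProperly_ofEdge_ofEdge hK ht he he' fun h => hcd (by subst h; rfl)
    | ofVertex v c hc => exact meetProperly_ofEdge_ofVertex hK ht he hc
  | ofVertex v c hc =>
    cases d with
    | ofFace g => exact (meetProperly_ofFace_ofVertex hK ht hc).symm
    | ofEdge e he => exact (meetProperly_ofEdge_ofVertex hK ht he hc).symm
    | ofVertex u d hd =>
      by_cases huv : v = u
      · subst huv
        exact meetProperly_ofVertex_ofVertex hK ht hc hd fun h => hcd (by subst h; rfl)
      · exact Or.inl (disjoint_ofVertex hK ht hc hd huv).inter_eq

end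

end PolygonalComplex

end EulerTransform

namespace EulerTransform
variable {ι : Type*}

theorem val_finRotate_eq_mod {n : ℕ} (i : Fin n) : (finRotate n i).val = (i.val + 1) % n := by
  obtain ⟨m, rfl⟩ : ∃ m, n = m + 1 := ⟨n - 1, by have := i.2; omega⟩
  have h2 := i.2
  rcases val_finRotate i with ⟨h, h'⟩ | ⟨h, h'⟩
  · rw [h', h, Nat.mod_self]
  · rw [h', Nat.mod_eq_of_lt (by omega)]

namespace PolygonalComplex

variable {K : PolygonalComplex ι}

open EulerTransform.PolygonalComplex.Flag

/-! ### The cells are simple polygons -/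

namespace Flag

open Classical in
/-- The next polygon around the vertex of a flag. -/
noncomputable def next (φ : K.Flag) : K.Flag :=
  if h : ∃ ψ, φ.Twin ψ then h.choose.mate else φ

theorem Twin.next_eq {φ ψ : K.Flag} (h : φ.Twin ψ) : φ.next = ψ.mate := by
  have hex : ∃ ψ, φ.Twin ψ := ⟨ψ, h⟩
  rw [next, dif_pos hex, hex.choose_spec.unique h]

theorem Outer.next_eq {φ : K.Flag} (h : φ.Outer) : φ.next = φ := dif_neg fun ⟨ψ, hψ⟩ => h ψ hψ

theorem next_b (φ : K.Flag) : φ.next.b = φ.b := by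
  by_cases h : φ.Outer
  · rw [h.next_eq]
  · obtain ⟨ψ, hψ⟩ := not_outer.1 h
    rw [hψ.next_eq, mate_b, hψ.b_eq, Bool.not_not]

theorem next_vtx (φ : K.Flag) : φ.next.vtx = φ.vtx := by
  by_cases h : φ.Outer
  · rw [h.next_eq]
  · obtain ⟨ψ, hψ⟩ := not_outer.1 h
    rw [hψ.next_eq, mate_vtx, hψ.2.1]

theorem next_mem_fan {c : Set ι} {φ : K.Flag} (hc : c ∈ K.fans φ.vtx) (hφ : φ.f ∈ c) :
    φ.next.f ∈ c := by
  by_cases h : φ.Outer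
  · rwa [h.next_eq]
  · obtain ⟨ψ, hψ⟩ := not_outer.1 h
    rw [hψ.next_eq, mate_f]
    exact mem_fan_of_twin hc hψ hφ

theorem next_injective {φ ψ : K.Flag} (hφ : ¬ φ.Outer) (hψ : ¬ ψ.Outer)
    (h : φ.next = ψ.next) : φ = ψ := by
  obtain ⟨φ', hφ'⟩ := not_outer.1 hφ
  obtain ⟨ψ', hψ'⟩ := not_outer.1 hψ
  rw [hφ'.next_eq, hψ'.next_eq] at h
  have h := congrArg mate h
  rw [mate_mate, mate_mate] at h
  subst h
  exact hφ'.symm.unique hψ'.symm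

theorem not_outer_mate_next {φ : K.Flag} (hφ : ¬ φ.Outer) : ¬ φ.next.mate.Outer := by
  obtain ⟨ψ, hψ⟩ := not_outer.1 hφ
  rw [hψ.next_eq, mate_mate]
  exact not_outer.2 ⟨φ, hψ.symm⟩

theorem next_ne {φ : K.Flag} (hφ : ¬ φ.Outer) : φ.next ≠ φ := by
  obtain ⟨ψ, hψ⟩ := not_outer.1 hφ
  rw [hψ.next_eq]
  intro h
  exact hψ.1 (by rw [← h, mate_f])

/-- Returning after two steps would mean two polygons with two common edges; so the cycle around a
vertex is not a 2-gon. -/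
theorem next_next_ne {φ : K.Flag} (hφ : ¬ φ.Outer) (hφ' : ¬ φ.next.Outer) :
    φ.next.next ≠ φ := by
  obtain ⟨ψ, hψ⟩ := not_outer.1 hφ
  rw [hψ.next_eq] at hφ' ⊢
  obtain ⟨χ, hχ⟩ := not_outer.1 hφ'
  rw [hχ.next_eq]
  rintro rfl
  refine χ.mate_edge_ne (eq_of_common_edges (f := χ.f) (g := ψ.f) ?_ ?_ χ.edge_mem ?_ ?_)
  · have := hψ.1
    rwa [mate_f] at this
  · have := χ.mate.edge_mem
    rwa [mate_f] at this
  · rw [hψ.edge_eq]; exact ψ.edge_mem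
  · rw [← hχ.edge_eq]
    have := ψ.mate.edge_mem
    rwa [mate_f] at this

end Flag

section

variable {t : ι → ℝ} [Finite ι] (hK : K.IsEulerInput)
  (ht : ∀ f, IsMiteredOffset (K.face f) (t f))

include hK ht

omit ht in
theorem Flag.next_facet {φ : K.Flag} (h : ¬ φ.Outer) : s(φ.hv, φ.next.hv) = φ.cross hK := by
  obtain ⟨ψ, hψ⟩ := not_outer.1 h
  rw [hψ.next_eq, hv_mate, cross, hψ.opp_eq hK]

/-- A cell is a simple polygon if its vertices form a periodic orbit. -/
theorem isSimpleClosedPolygon_of_orbit {c : K.HatCell} {Y : Type*} {σ : Y → Y} {y : Y}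
    (hy : y ∈ Function.periodicPts σ) (h1 : σ y ≠ y) (h2 : σ (σ y) ≠ y) {ν : Y → K.HatVertex}
    (hν : Function.Injective ν) (hc : ∀ x, s(ν x, ν (σ x)) ∈ c.facets)
    (hc' : ∀ ε ∈ c.facets, ∃ k, ε = s(ν (σ^[k] y), ν (σ^[k + 1] y))) :
    c.IsSimpleClosedPolygon t := by
  set n := Function.minimalPeriod σ y with hn
  have hpos : 0 < n := Function.minimalPeriod_pos_of_mem_periodicPts hy
  have hper : σ^[n] y = y := Function.iterate_minimalPeriod
  have hn3 : 3 ≤ n := by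
    by_contra hlt
    interval_cases n
    · exact h1 hper
    · exact h2 hper
  have hrot : ∀ i : Fin n, σ^[(finRotate n i : ℕ)] y = σ^[(i : ℕ) + 1] y := by
    intro i
    rw [val_finRotate_eq_mod]
    exact Function.iterate_mod_minimalPeriod_eq
  have hmem : ∀ i : Fin n, s(ν (σ^[(i : ℕ)] y), ν (σ^[(finRotate n i : ℕ)] y)) ∈ c.facets := by
    intro i
    rw [hrot, Function.iterate_succ_apply']
    exact hc _
  refine ⟨n, fun i => ν (σ^[(i : ℕ)] y), Subset.antisymm ?_ ?_,
    isSimple_of_cycle hK ht hn3 (fun i j hij => ?_) hmem⟩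
  · intro ε hε
    obtain ⟨k, rfl⟩ := hc' ε hε
    refine ⟨⟨k % n, Nat.mod_lt _ hpos⟩, ?_⟩
    dsimp only
    rw [hrot]
    dsimp only
    rw [Function.iterate_succ_apply' σ (k % n), Function.iterate_succ_apply' σ k,
      Function.iterate_mod_minimalPeriod_eq]
  · rintro _ ⟨i, rfl⟩
    exact hmem i
  · exact Fin.ext (Function.iterate_injOn_Iio_minimalPeriod i.2 j.2 (hν hij))

omit hK ht [Finite ι] in
-- The flags of a polygon at `v` are one flag of `O` and its mate, so crossing either edge leads to
-- a polygon that has a flag in `O`. By `fan_subset`, such a set of polygons is the whole fan; this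
-- shows that an orbit runs through all facets of a vertex cell.
theorem fan_flags {v : Plane} {c : Set ι} (hc : c ∈ K.fans v) {O : Set K.Flag}
    (hO : ∀ φ ∈ O, φ.vtx = v ∧ φ.f ∈ c) (hne : O.Nonempty)
    (hnext : ∀ φ ∈ O, ∀ ψ, φ.Twin ψ → ψ.mate ∈ O)
    (hprev : ∀ φ ∈ O, ∀ ψ, φ.mate.Twin ψ → ψ ∈ O) {φ : K.Flag} (hφ : φ.f ∈ c)
    (hv : φ.vtx = v) : φ ∈ O ∨ φ.mate ∈ O := by
  obtain ⟨φ₀, h0⟩ := hne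
  have key : c ⊆ {f | ∃ χ ∈ O, χ.f = f} := by
    refine fan_subset hc (hO φ₀ h0).2 ⟨φ₀, h0, rfl⟩ ?_
    rintro φ ψ hφv hψ ⟨χ, hχ, hf⟩
    rcases eq_or_eq_mate hf ((hO χ hχ).1.trans hφv.symm) with rfl | rfl
    · exact ⟨_, hnext _ hχ ψ hψ, ψ.mate_f⟩
    · exact ⟨_, hprev _ hχ ψ hψ, rfl⟩
  obtain ⟨χ, hχ, hf⟩ := key hφ
  rcases eq_or_eq_mate hf ((hO χ hχ).1.trans hv.symm) with rfl | rfl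
  · exact Or.inl hχ
  · exact Or.inr (by rwa [mate_mate])

omit hK ht [Finite ι] in
theorem exists_iterate_succ {Y : Type*} {σ : Y → Y} {y : Y} (hy : y ∈ Function.periodicPts σ)
    (k : ℕ) : ∃ j, σ (σ^[j] y) = σ^[k] y := by
  obtain ⟨n, hn, h⟩ := hy
  refine ⟨k + (n - 1), ?_⟩
  rw [← Function.iterate_succ_apply' σ, Nat.succ_eq_add_one, add_assoc, Nat.sub_add_cancel hn,
    Function.iterate_add_apply, h.eq]

/-- The flags that leave a vertex, on the polygons of a fan. -/
abbrev Outgoing (K : PolygonalComplex ι) (v : Plane) (c : Set ι) : Type _ :=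
  {φ : K.Flag // φ.vtx = v ∧ φ.f ∈ c ∧ φ.b = false}

omit hK ht in
theorem finite_outgoing (v : Plane) (c : Set ι) : Finite (K.Outgoing v c) :=
  Finite.of_injective (fun φ => φ.1.f) fun φ ψ h =>
    Subtype.ext (ext_of_vtx h (φ.2.2.2.trans ψ.2.2.2.symm) (φ.2.1.trans ψ.2.1.symm))

omit hK ht [Finite ι] in
theorem hv_injective {v : Plane} {c : Set ι} {φ ψ : K.Outgoing v c} (h : φ.1.hv = ψ.1.hv) :
    φ = ψ :=
  Subtype.ext (ext_of_vtx (Sum.inl_injective (congrArg HatVertex.owner h))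
    (φ.2.2.2.trans ψ.2.2.2.symm) (φ.2.1.trans ψ.2.1.symm))

omit hK ht [Finite ι] in
/-- The next polygon of a fan. -/
noncomputable def Outgoing.next {v : Plane} {c : Set ι} (hc : c ∈ K.fans v)
    (φ : K.Outgoing v c) : K.Outgoing v c :=
  ⟨φ.1.next, φ.1.next_vtx.trans φ.2.1, next_mem_fan (φ.2.1.symm ▸ hc) φ.2.2.1,
    φ.1.next_b.trans φ.2.2.2⟩

/-- Without outer edges, the step to the next polygon is an injective self-map of a finite set, so
every flag is periodic. -/
theorem isSimpleClosedPolygon_of_not_outer {v : Plane} {c : Set ι} (hc : c ∈ K.fans v)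
    (h : ∀ φ : K.Flag, φ.f ∈ c → φ.vtx = v → ¬ φ.Outer) :
    (HatCell.ofVertex v c hc : K.HatCell).IsSimpleClosedPolygon t := by
  obtain ⟨g, hg⟩ := nonempty_of_fan hc
  obtain ⟨φ₀, rfl, hv, hb⟩ := exists_flag (mem_vertices_of_fan hc hg) false
  set y : K.Outgoing v c := ⟨φ₀, hv, hg, hb⟩ with hy
  have hno : ∀ φ : K.Outgoing v c, ¬ φ.1.Outer := fun φ => h _ φ.2.2.1 φ.2.1
  have hinj : Function.Injective (Outgoing.next hc) := fun φ ψ hφψ =>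
    Subtype.ext (next_injective (hno φ) (hno ψ) (congrArg Subtype.val hφψ))
  have hfin := finite_outgoing (K := K) v c
  have hper := hinj.mem_periodicPts y
  refine isSimpleClosedPolygon_of_orbit hK ht (ν := fun φ : K.Outgoing v c => φ.1.hv) hper
    (fun h' => next_ne (hno y) (congrArg Subtype.val h'))
    (fun h' => next_next_ne (hno y) (hno (Outgoing.next hc y)) (congrArg Subtype.val h'))
    (fun _ _ => hv_injective) (fun φ => ?_) fun ε hε => ?_
  · exact (mem_facets_ofVertex hK hc).2 ⟨φ.1, φ.2.2.1, φ.2.1, next_facet hK (hno φ)⟩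
  · obtain ⟨φ, hφ, hv, rfl⟩ := (mem_facets_ofVertex hK hc).1 hε
    have key : ∀ k, ((Outgoing.next hc)^[k] y).1.cross hK =
        s(((Outgoing.next hc)^[k] y).1.hv, ((Outgoing.next hc)^[k + 1] y).1.hv) := by
      intro k
      rw [Function.iterate_succ_apply']
      exact (next_facet hK (hno _)).symm
    have hprev : ∀ k ψ, ((Outgoing.next hc)^[k] y).1.mate.Twin ψ →
        ∃ j, ψ = ((Outgoing.next hc)^[j] y).1 := by
      intro k ψ hψ
      obtain ⟨j, hj⟩ := exists_iterate_succ hper k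
      refine ⟨j, next_injective (not_outer.2 ⟨_, hψ.symm⟩) (hno _) ?_⟩
      rw [hψ.symm.next_eq, mate_mate, ← hj]
      rfl
    have hfl := fan_flags hc (O := {χ | ∃ k, χ = ((Outgoing.next hc)^[k] y).1})
      (by
        rintro _ ⟨k, rfl⟩
        exact ⟨((Outgoing.next hc)^[k] y).2.1, ((Outgoing.next hc)^[k] y).2.2.1⟩)
      ⟨_, 0, rfl⟩
      (by
        rintro _ ⟨k, rfl⟩ ψ hψ
        refine ⟨k + 1, ?_⟩
        rw [Function.iterate_succ_apply', ← hψ.next_eq, Outgoing.next])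
      (by
        rintro _ ⟨k, rfl⟩ ψ hψ
        exact hprev k ψ hψ) hφ hv
    rcases hfl with ⟨k, hk⟩ | ⟨k, hk⟩
    · exact ⟨k, hk ▸ key k⟩
    · obtain ⟨ψ, hψ⟩ := not_outer.1 (h φ hφ hv)
      have hψ' := hψ
      rw [← φ.mate_mate, hk] at hψ'
      obtain ⟨j, rfl⟩ := hprev k ψ hψ'
      exact ⟨j, (hψ.cross_eq hK).symm.trans (key j)⟩

open Classical in
omit hK ht [Finite ι] in
/-- The next polygon of a fan, where the fan is closed up by a hole or the outside. -/
noncomputable def Outgoing.closedNext {v : Plane} {c : Set ι} (hc : c ∈ K.fans v)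
    (φ₀ : K.Outgoing v c) : Option (K.Outgoing v c) → Option (K.Outgoing v c)
  | none => some φ₀
  | some φ => if φ.1.Outer then none else some (Outgoing.next hc φ)

omit hK ht in
-- If `none` never recurred, two other members of its orbit would agree by finiteness. Injectivity
-- traces such a repetition back to a predecessor of the first polygon `φ₀`, which does not exist,
-- as the edge before `φ₀` is outer.
theorem closedNext_periodic {v : Plane} {c : Set ι} (hc : c ∈ K.fans v) {φ₀ : K.Outgoing v c}
    (h0 : φ₀.1.mate.Outer) : none ∈ Function.periodicPts (Outgoing.closedNext hc φ₀) := by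
  set σ := Outgoing.closedNext hc φ₀ with hσ
  by_contra hcon
  have hcon : ∀ k, σ^[k + 1] none ≠ none := fun k hk => hcon ⟨k + 1, k.succ_pos, hk⟩
  have hsome : ∀ φ χ, σ (some φ) = some χ → ¬ φ.1.Outer ∧ Outgoing.next hc φ = χ := by
    intro φ χ h
    by_cases ho : φ.1.Outer
    · simp [hσ, Outgoing.closedNext, ho] at h
    · simp only [hσ, Outgoing.closedNext, ho, if_false, Option.some.injEq] at h
      exact ⟨ho, h⟩
  have key : ∀ i j, i < j → σ^[i] none ≠ σ^[j] none := by
    intro i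
    induction i with
    | zero =>
      intro j hj
      obtain ⟨j, rfl⟩ : ∃ k, j = k + 1 := ⟨j - 1, by omega⟩
      exact (hcon j).symm
    | succ i ih =>
      intro j hj h
      obtain ⟨j, rfl⟩ : ∃ k, j = k + 1 + 1 := ⟨j - 2, by omega⟩
      obtain ⟨χ, hχ⟩ := Option.ne_none_iff_exists'.1 (hcon i)
      obtain ⟨ψ, hψ⟩ := Option.ne_none_iff_exists'.1 (hcon j)
      have h2 := h.symm.trans hχ
      rw [Function.iterate_succ_apply', hψ] at h2
      obtain ⟨e1, e2⟩ := hsome _ _ h2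
      rw [Function.iterate_succ_apply'] at hχ
      cases hi : σ^[i] none with
      | none =>
        rw [hi] at hχ
        obtain rfl : φ₀ = χ := Option.some_injective _ hχ
        have h4 := not_outer_mate_next e1
        rw [show ψ.1.next = φ₀.1 from congrArg Subtype.val e2] at h4
        exact h4 h0
      | some φ =>
        rw [hi] at hχ
        obtain ⟨e3, e4⟩ := hsome _ _ hχ
        refine ih (j + 1) (by omega) ?_
        rw [hi, hψ]
        exact congrArg some
          (Subtype.ext (next_injective e3 e1 (congrArg Subtype.val (e4.trans e2.symm))))
  have hfin := finite_outgoing (K := K) v c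
  obtain ⟨i, j, hij, hne⟩ : ∃ i j, σ^[i] none = σ^[j] none ∧ i ≠ j := by
    simpa [Function.Injective] using not_injective_infinite_finite (σ^[·] none)
  rcases lt_or_gt_of_ne hne with h | h
  · exact key _ _ h hij
  · exact key _ _ h hij.symm

omit hK ht in
/-- A fan with an edge that lies on one polygon only has a first polygon. -/
theorem exists_first {v : Plane} {c : Set ι} (hc : c ∈ K.fans v)
    (h : ∃ φ : K.Flag, φ.Outer ∧ φ.f ∈ c ∧ φ.vtx = v) :
    ∃ φ : K.Outgoing v c, φ.1.mate.Outer := by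
  by_contra! hcon
  -- If every outgoing flag has a predecessor, taking predecessors is injective on a finite set,
  -- hence surjective. Then every outgoing flag is a predecessor, and none is outer.
  have hprev : ∀ φ : K.Outgoing v c, ∃ ψ : K.Outgoing v c, ¬ ψ.1.Outer ∧ ψ.1.next = φ.1 := by
    intro φ
    obtain ⟨ψ, hψ⟩ := not_outer.1 (hcon φ)
    have hv : φ.1.mate.vtx = v := (mate_vtx _).trans φ.2.1
    refine ⟨⟨ψ, hψ.2.1.symm.trans hv, mem_fan_of_twin (hv.symm ▸ hc) hψ
      ((mate_f _).symm ▸ φ.2.2.1), ?_⟩, not_outer.2 ⟨_, hψ.symm⟩, ?_⟩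
    · rw [hψ.b_eq, mate_b, φ.2.2.2]; rfl
    · rw [hψ.symm.next_eq, mate_mate]
  choose p hp using hprev
  have hinj : Function.Injective p := by
    intro φ ψ hφψ
    have h1 := (hp φ).2
    rw [hφψ, (hp ψ).2] at h1
    exact Subtype.ext h1.symm
  have hfin := finite_outgoing (K := K) v c
  have hsurj := Finite.surjective_of_injective hinj
  obtain ⟨φ, ho, hf, hv⟩ := h
  cases hb : φ.b with
  | false =>
    obtain ⟨χ, hχ⟩ := hsurj ⟨φ, hv, hf, hb⟩
    have := (hp χ).1
    rw [hχ] at this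
    exact this ho
  | true =>
    refine hcon ⟨φ.mate, (mate_vtx _).trans hv, (mate_f _).symm ▸ hf, ?_⟩ ?_
    · rw [mate_b, hb]; rfl
    · rwa [mate_mate]

/-- The cycle starts at the unmoved copy `z` of `v`, encoded by `none`, enters the first polygon,
and returns to `z` at the last one. It closes because all outer edges at `v` have the same far copy.
-/
theorem isSimpleClosedPolygon_of_outer {v : Plane} {c : Set ι} (hc : c ∈ K.fans v)
    {φ₀ : K.Outgoing v c} (h0 : φ₀.1.mate.Outer) :
    (HatCell.ofVertex v c hc : K.HatCell).IsSimpleClosedPolygon t := by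
  set σ := Outgoing.closedNext hc φ₀ with hσ
  have hper := closedNext_periodic hc h0
  set z := φ₀.1.mate.opp hK with hz
  have hzv : φ₀.1.mate.vtx = v := (mate_vtx _).trans φ₀.2.1
  have hopp : ∀ φ : K.Flag, φ.Outer → φ.vtx = v → φ.opp hK = z := fun φ ho hv =>
    ho.opp_eq_opp hK h0 (hv.trans hzv.symm)
  set ν : Option (K.Outgoing v c) → K.HatVertex := fun o => o.elim z fun φ => φ.1.hv with hν
  have hz' : ∀ φ : K.Outgoing v c, φ.1.hv ≠ z := by
    intro φ h
    obtain ⟨C, hC, -⟩ := h0.opp hK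
    have := congrArg HatVertex.owner h
    rw [hC] at this
    exact Sum.inl_ne_inr this
  have hfirst : s(ν none, ν (σ none)) = φ₀.1.mate.cross hK := by
    rw [cross, hv_mate, Sym2.eq_swap]
    rfl
  have σ_outer : ∀ φ : K.Outgoing v c, φ.1.Outer → σ (some φ) = none := fun φ ho => by
    simp only [hσ, Outgoing.closedNext, ho, if_true]
  have σ_next : ∀ φ : K.Outgoing v c, ¬ φ.1.Outer → σ (some φ) = some (Outgoing.next hc φ) :=
    fun φ ho => by simp only [hσ, Outgoing.closedNext, ho, if_false]
  have hsome : ∀ φ : K.Outgoing v c, s(ν (some φ), ν (σ (some φ))) = φ.1.cross hK := by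
    intro φ
    by_cases ho : φ.1.Outer
    · rw [σ_outer φ ho, cross, hopp _ ho φ.2.1]; rfl
    · rw [σ_next φ ho]
      exact next_facet hK ho
  have ho0 : ¬ φ₀.1.Outer := fun ho => not_outer_mate hK ho h0
  have hprev : ∀ (φ : K.Outgoing v c) k, some φ = σ^[k] none → ∀ ψ, φ.1.mate.Twin ψ →
      ∃ χ : K.Outgoing v c, χ.1 = ψ ∧ ∃ j, some χ = σ^[j] none := by
    intro φ k hk ψ hψ
    obtain ⟨j, hj⟩ := exists_iterate_succ hper k
    rw [← hσ, ← hk] at hj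
    cases hj' : σ^[j] none with
    | none =>
      rw [hj'] at hj
      obtain rfl : φ₀ = φ := Option.some_injective _ hj
      exact absurd hψ (h0 ψ)
    | some χ =>
      rw [hj'] at hj
      refine ⟨χ, ?_, j, hj'.symm⟩
      by_cases ho : χ.1.Outer
      · rw [σ_outer χ ho] at hj
        exact absurd hj (Option.some_ne_none _).symm
      · rw [σ_next χ ho] at hj
        refine next_injective ho (not_outer.2 ⟨_, hψ.symm⟩) ?_
        rw [hψ.symm.next_eq, mate_mate, ← Option.some_injective _ hj]
        rfl
  refine isSimpleClosedPolygon_of_orbit hK ht (ν := ν) hper (Option.some_ne_none _)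
    ?_ ?_ (fun o => ?_) fun ε hε => ?_
  · change σ (some φ₀) ≠ none
    rw [σ_next _ ho0]
    exact Option.some_ne_none _
  · rintro (_ | φ) (_ | ψ) h
    · rfl
    · exact absurd h.symm (hz' ψ)
    · exact absurd h (hz' φ)
    · exact congrArg some (hv_injective h)
  · cases o with
    | none =>
      exact (mem_facets_ofVertex hK hc).2 ⟨_, (mate_f _).symm ▸ φ₀.2.2.1, hzv, hfirst⟩
    | some φ => exact (mem_facets_ofVertex hK hc).2 ⟨φ.1, φ.2.2.1, φ.2.1, hsome φ⟩
  · obtain ⟨φ, hφ, hv, rfl⟩ := (mem_facets_ofVertex hK hc).1 hε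
    have key : ∀ (χ : K.Outgoing v c) k, some χ = σ^[k] none →
        χ.1.cross hK = s(ν (σ^[k] none), ν (σ^[k + 1] none)) := by
      intro χ k hk
      rw [Function.iterate_succ_apply', ← hk]
      exact (hsome χ).symm
    have hfl := fan_flags hc
      (O := {χ | ∃ χ' : K.Outgoing v c, χ'.1 = χ ∧ ∃ k, some χ' = σ^[k] none})
      (by
        rintro _ ⟨χ, rfl, -⟩
        exact ⟨χ.2.1, χ.2.2.1⟩)
      ⟨_, φ₀, rfl, 1, rfl⟩
      (by
        rintro _ ⟨χ, rfl, k, hk⟩ ψ hψ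
        refine ⟨Outgoing.next hc χ, hψ.next_eq, k + 1, ?_⟩
        rw [Function.iterate_succ_apply', ← hk, σ_next _ (not_outer.2 ⟨_, hψ⟩)])
      (by
        rintro _ ⟨χ, rfl, k, hk⟩ ψ hψ
        exact hprev χ k hk ψ hψ) hφ hv
    rcases hfl with ⟨χ, rfl, k, hk⟩ | ⟨χ, hχ, k, hk⟩
    · exact ⟨k, key χ k hk⟩
    -- If the edge before a polygon of the orbit is outer, the step into this polygon must start at
    -- `none`, so the polygon is the first one.
    · by_cases ho : φ.Outer
      · obtain ⟨j, hj⟩ := exists_iterate_succ hper k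
        rw [← hσ, ← hk] at hj
        refine ⟨j, ?_⟩
        cases hj' : σ^[j] none with
        | none =>
          rw [hj'] at hj
          obtain rfl : φ₀ = χ := Option.some_injective _ hj
          rw [Function.iterate_succ_apply', hj', hfirst, hχ, mate_mate]
        | some χ' =>
          exfalso
          rw [hj'] at hj
          by_cases ho' : χ'.1.Outer
          · rw [σ_outer χ' ho'] at hj
            exact absurd hj (Option.some_ne_none _).symm
          · rw [σ_next χ' ho'] at hj
            have h4 := not_outer_mate_next ho'
            rw [show χ'.1.next = χ.1 from congrArg Subtype.val (Option.some_injective _ hj), hχ,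
              mate_mate] at h4
            exact h4 ho
      · obtain ⟨ψ, hψ⟩ := not_outer.1 ho
        have hψ' := hψ
        rw [← φ.mate_mate, ← hχ] at hψ'
        obtain ⟨χ', rfl, j, hj⟩ := hprev χ k hk ψ hψ'
        exact ⟨j, (hψ.cross_eq hK).symm.trans (key χ' j hj)⟩

theorem isSimpleClosedPolygon_ofVertex {v : Plane} {c : Set ι} (hc : c ∈ K.fans v) :
    (HatCell.ofVertex v c hc : K.HatCell).IsSimpleClosedPolygon t := by
  by_cases h : ∃ φ : K.Flag, φ.Outer ∧ φ.f ∈ c ∧ φ.vtx = v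
  · obtain ⟨φ₀, h0⟩ := exists_first hc h
    exact isSimpleClosedPolygon_of_outer hK ht hc h0
  · exact isSimpleClosedPolygon_of_not_outer hK ht hc fun φ hf hv ho => h ⟨φ, ho, hf, hv⟩

omit hK [Finite ι] in
theorem isSimpleClosedPolygon_ofFace (f : ι) :
    (HatCell.ofFace f : K.HatCell).IsSimpleClosedPolygon t := by
  refine ⟨(K.face f).n, HatVertex.ofFace f, ?_, (ht f).2 _ ⟨(ht f).pos.le, le_rfl⟩⟩
  ext ε
  exact ⟨fun ⟨i, h⟩ => ⟨i, h.symm⟩, fun ⟨i, h⟩ => ⟨i, h.symm⟩⟩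

end

end PolygonalComplex

end EulerTransform

namespace EulerTransform
variable {ι : Type*}

/-! ### Convex trapezia -/

/-- A bounded set whose frontier lies in a curve lies in the region enclosed by the curve. -/
theorem subset_fill_of_frontier_subset {J Q : Set Plane} (hb : Bornology.IsBounded Q)
    (hQ : frontier Q ⊆ J) : Q ⊆ fill J := by
  intro x hx
  by_cases hxJ : x ∈ J
  · exact subset_fill J hxJ
  rw [mem_fill_iff_of_notMem hxJ]
  refine hb.subset fun y hy => ?_
  by_contra hyQ
  have hfr : ∀ z ∈ connectedComponentIn Jᶜ x, z ∉ frontier Q := fun z hz hz' =>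
    connectedComponentIn_subset _ _ hz (hQ hz')
  have hxc := mem_connectedComponentIn (F := Jᶜ) hxJ
  -- A connected set that avoids the frontier of `Q` cannot meet both the interior and the exterior
  -- of `Q`.
  obtain ⟨z, -, hz, hz'⟩ := isPreconnected_connectedComponentIn (interior Q) (closure Q)ᶜ
    isOpen_interior isClosed_closure.isOpen_compl
    (fun z hz => by
      by_cases h : z ∈ closure Q
      · exact Or.inl (by_contra fun h' => hfr z hz ⟨h, h'⟩)
      · exact Or.inr h)
    ⟨x, hxc, by_contra fun h' => hfr x hxc ⟨subset_closure hx, h'⟩⟩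
    ⟨y, hy, fun h => hfr y hy ⟨h, fun h' => hyQ (interior_subset h')⟩⟩
  exact hz' (subset_closure (interior_subset hz))

theorem boundary_four (a b c d : Plane) :
    (⟨![a, b, c, d]⟩ : Polygon Plane 4).boundary ℝ =
      segment ℝ a b ∪ segment ℝ b c ∪ segment ℝ c d ∪ segment ℝ d a := by
  ext x
  rw [mem_boundary]
  constructor
  · rintro ⟨i, hi⟩
    fin_cases i
    exacts [Or.inl (Or.inl (Or.inl hi)), Or.inl (Or.inl (Or.inr hi)), Or.inl (Or.inr hi),
      Or.inr hi]
  · rintro (((h | h) | h) | h)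
    exacts [⟨0, h⟩, ⟨1, h⟩, ⟨2, h⟩, ⟨3, h⟩]

/-- A 4-gon with two parallel sides of the same direction bounds a convex region. -/
theorem convex_region_of_parallel {u n a b c d : Plane} (hf : IsFrame u n) {α β : ℝ} (hα : 0 < α)
    (hβ : 0 < β) (hb : b = a + α • u) (hc : c = d + β • u) (hd : inner ℝ n (d - a) ≠ (0 : ℝ)) :
    Convex ℝ (region (⟨![a, b, c, d]⟩ : Polygon Plane 4)) := by
  obtain ⟨w, rfl⟩ : ∃ w, d = a + w := ⟨d - a, by abel⟩
  rw [add_sub_cancel_left] at hd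
  set δ : ℝ := inner ℝ n w with hδ
  -- Oblique coordinates x = a + r w + σ u, with w leading from a to d. In them the 4-gon becomes 0
  -- ≤ r ≤ 1 and 0 ≤ σ ≤ (1 − r) α + r β, which is visibly convex.
  set r : Plane → ℝ := fun x => inner ℝ n (x - a) / δ with hr
  set σ : Plane → ℝ := fun x => inner ℝ u (x - a) - r x * inner ℝ u w with hσ
  have hrc : Continuous r := by simp only [hr]; fun_prop
  have hσc : Continuous σ := by simp only [hσ]; fun_prop
  have hpoint : ∀ x, x = a + r x • w + σ x • u := by
    intro x
    have h1 := hf.nd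
    have h2 := hf.dd
    have h3 : x - a = r x • w + σ x • u := by
      refine hf.ext ?_ ?_
      · rw [inner_add_right, inner_smul_right, inner_smul_right, h2, hσ]
        ring
      · rw [inner_add_right, inner_smul_right, inner_smul_right, h1, ← hδ, hr]
        dsimp only
        field_simp
        ring
    rw [add_assoc, ← h3]; abel
  have hr' : ∀ ρ s : ℝ, r (a + ρ • w + s • u) = ρ := by
    intro ρ s
    have : a + ρ • w + s • u - a = ρ • w + s • u := by abel
    simp only [hr]
    rw [this, inner_add_right, inner_smul_right, inner_smul_right, hf.nd, ← hδ]
    field_simp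
    ring
  have hσ' : ∀ ρ s : ℝ, σ (a + ρ • w + s • u) = s := by
    intro ρ s
    have : a + ρ • w + s • u - a = ρ • w + s • u := by abel
    simp only [hσ]
    rw [hr', this, inner_add_right, inner_smul_right, inner_smul_right, hf.dd]
    ring
  have hcombo : ∀ x y (p q : ℝ), p + q = 1 →
      p • x + q • y = a + (p * r x + q * r y) • w + (p * σ x + q * σ y) • u := by
    intro x y p q hpq
    conv_lhs => rw [hpoint x, hpoint y]
    obtain rfl : p = 1 - q := by linarith
    module
  set Q : Set Plane := {x | 0 ≤ r x ∧ r x ≤ 1 ∧ 0 ≤ σ x ∧ σ x ≤ (1 - r x) * α + r x * β} with hQ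
  set J := (⟨![a, b, c, a + w]⟩ : Polygon Plane 4).boundary ℝ with hJ
  have hJQ : J ⊆ Q := by
    rw [hJ, boundary_four]
    have ha : a = a + (0 : ℝ) • w + (0 : ℝ) • u := by module
    have hb' : b = a + (0 : ℝ) • w + α • u := by rw [hb]; module
    have hc' : c = a + (1 : ℝ) • w + β • u := by rw [hc]; module
    have hd' : a + w = a + (1 : ℝ) • w + (0 : ℝ) • u := by module
    have key : ∀ x y, x ∈ Q → y ∈ Q → segment ℝ x y ⊆ Q := by
      rintro x y ⟨x1, x2, x3, x4⟩ ⟨y1, y2, y3, y4⟩ _ ⟨p, q, hp, hq, hpq, rfl⟩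
      rw [hcombo x y p q hpq, hQ, mem_ofPred_eq, hr', hσ']
      obtain rfl : p = 1 - q := by linarith
      refine ⟨by positivity, by nlinarith, by positivity, ?_⟩
      nlinarith [mul_le_mul_of_nonneg_left x4 hp, mul_le_mul_of_nonneg_left y4 hq]
    have hQ' : ∀ ρ s : ℝ, 0 ≤ ρ → ρ ≤ 1 → 0 ≤ s → s ≤ (1 - ρ) * α + ρ * β →
        a + ρ • w + s • u ∈ Q := by
      intro ρ s h1 h2 h3 h4
      rw [hQ, mem_ofPred_eq, hr', hσ']
      exact ⟨h1, h2, h3, h4⟩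
    have qa : a ∈ Q := by
      rw [ha]; exact hQ' _ _ le_rfl zero_le_one le_rfl (by linarith)
    have qb : b ∈ Q := by
      rw [hb']; exact hQ' _ _ le_rfl zero_le_one hα.le (by linarith)
    have qc : c ∈ Q := by
      rw [hc']; exact hQ' _ _ zero_le_one le_rfl hβ.le (by linarith)
    have qd : a + w ∈ Q := by
      rw [hd']; exact hQ' _ _ zero_le_one le_rfl le_rfl (by linarith)
    exact union_subset (union_subset (union_subset (key _ _ qa qb) (key _ _ qb qc))
      (key _ _ qc qd)) (key _ _ qd qa)
  have hconv : Convex ℝ Q := by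
    rintro x ⟨x1, x2, x3, x4⟩ y ⟨y1, y2, y3, y4⟩ p q hp hq hpq
    rw [hcombo x y p q hpq, hQ, mem_ofPred_eq, hr', hσ']
    obtain rfl : p = 1 - q := by linarith
    refine ⟨by positivity, by nlinarith, by positivity, ?_⟩
    nlinarith [mul_le_mul_of_nonneg_left x4 hp, mul_le_mul_of_nonneg_left y4 hq]
  have hbd : Bornology.IsBounded Q := by
    have hcpt : IsCompact ((fun z : ℝ × ℝ => a + z.1 • w + z.2 • u) ''
        (Icc 0 1 ×ˢ Icc 0 (α + β))) :=
      (isCompact_Icc.prod isCompact_Icc).image (by fun_prop)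
    refine hcpt.isBounded.subset ?_
    rintro x ⟨x1, x2, x3, x4⟩
    refine ⟨(r x, σ x), ⟨⟨x1, x2⟩, x3, ?_⟩, (hpoint x).symm⟩
    nlinarith
  have hcl : IsClosed Q := by
    have h1 := isClosed_le (continuous_const (y := (0 : ℝ))) hrc
    have h2 := isClosed_le hrc (continuous_const (y := (1 : ℝ)))
    have h3 := isClosed_le (continuous_const (y := (0 : ℝ))) hσc
    have h4 := isClosed_le hσc
      (((continuous_const.sub hrc).mul continuous_const).add (hrc.mul continuous_const) :
        Continuous fun x => (1 - r x) * α + r x * β)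
    exact h1.inter (h2.inter (h3.inter h4))
  have hfr : frontier Q ⊆ J := by
    intro x hx
    rw [hcl.frontier_eq] at hx
    obtain ⟨⟨x1, x2, x3, x4⟩, hx⟩ := hx
    rw [hJ, boundary_four]
    have hx0 := hpoint x
    rcases eq_or_lt_of_le x1 with h1 | h1
    · refine Or.inl (Or.inl (Or.inl ?_))
      rw [← h1] at x4 hx0
      refine ⟨1 - σ x / α, σ x / α, ?_, by positivity, by ring, ?_⟩
      · rw [sub_nonneg, div_le_one hα]; linarith
      · conv_rhs => rw [hx0]
        rw [hb, smul_add, smul_smul, div_mul_cancel₀ _ hα.ne']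
        module
    rcases eq_or_lt_of_le x2 with h2 | h2
    · refine Or.inl (Or.inr ?_)
      rw [h2] at x4 hx0
      refine ⟨σ x / β, 1 - σ x / β, by positivity, ?_, by ring, ?_⟩
      · rw [sub_nonneg, div_le_one hβ]; linarith
      · conv_rhs => rw [hx0]
        rw [hc, smul_add, smul_smul, div_mul_cancel₀ _ hβ.ne']
        module
    rcases eq_or_lt_of_le x3 with h3 | h3
    · refine Or.inr ⟨r x, 1 - r x, h1.le, by linarith, by ring, ?_⟩
      rw [← h3] at hx0
      conv_rhs => rw [hx0]
      module
    rcases eq_or_lt_of_le x4 with h4 | h4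
    · refine Or.inl (Or.inl (Or.inr ⟨1 - r x, r x, by linarith, h1.le, by ring, ?_⟩))
      rw [h4] at hx0
      conv_rhs => rw [hx0]
      rw [hb, hc]
      module
    · exfalso
      refine hx (mem_interior_iff_mem_nhds.2 ?_)
      have e4 : ∀ᶠ y in 𝓝 x, σ y < (1 - r y) * α + r y * β :=
        (hσc.tendsto x).eventually_lt
          ((((continuous_const.sub hrc).mul continuous_const).add (hrc.mul continuous_const) :
            Continuous fun x => (1 - r x) * α + r x * β).tendsto x) h4
      filter_upwards [(hrc.tendsto x).eventually (lt_mem_nhds h1),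
        (hrc.tendsto x).eventually (gt_mem_nhds h2),
        (hσc.tendsto x).eventually (lt_mem_nhds h3), e4] with y y1 y2 y3 y4
      exact ⟨y1.le, y2.le, y3.le, y4.le⟩
  have haQ : a ∈ J := by
    rw [hJ, boundary_four]
    exact Or.inr (right_mem_segment _ _ _)
  -- The region lies in `Q` because `Q` is star-shaped and contains the curve, and it contains `Q`
  -- because `Q` is bounded with its frontier on the curve.
  have : region (⟨![a, b, c, a + w]⟩ : Polygon Plane 4) = Q :=
    Subset.antisymm (fill_subset_of_starConvex (hconv (hJQ haQ)) (hJQ haQ) hJQ)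
      (subset_fill_of_frontier_subset hbd hfr)
  rw [this]
  exact hconv

/-! ### The cells of edges are trapezia -/

namespace PolygonalComplex

variable {K : PolygonalComplex ι}

open EulerTransform.PolygonalComplex.Flag

theorem Flag.Outer.h_opp [Finite ι] (hK : K.IsEulerInput) {φ : K.Flag} (h : φ.Outer)
    (t : ι → ℝ) : φ.h ((φ.opp hK).pos t) = 0 := by
  rw [h.opp_pos, h_vtx]

theorem Flag.vtx_flip_eq (φ : K.Flag) : φ.flip.vtx = φ.vtx + φ.len • φ.dir := by
  have := φ.simple.offset_corner_not φ.i φ.b 0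
  simp only [offset_zero, zero_mul, sub_zero] at this
  exact this

theorem Flag.q_flip_eq (t : ι → ℝ) (φ : K.Flag) :
    φ.flip.q t = φ.q t + (φ.len - t φ.f * (φ.κ + φ.flip.κ)) • φ.dir :=
  φ.simple.offset_corner_not φ.i φ.b (t φ.f)

section

variable {t : ι → ℝ} [Finite ι] (hK : K.IsEulerInput)
  (ht : ∀ f, IsMiteredOffset (K.face f) (t f))

include hK ht

/-- The copy of an edge on the other side has the same direction, and lies on the other side. -/
theorem Flag.exists_opp_flip_eq (φ : K.Flag) : ∃ β : ℝ, 0 < β ∧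
    (φ.flip.opp hK).pos t = (φ.opp hK).pos t + β • φ.dir ∧
    φ.h ((φ.opp hK).pos t) ≤ 0 := by
  by_cases ho : φ.Outer
  · refine ⟨φ.len, φ.len_pos, ?_, (ho.h_opp hK t).le⟩
    rw [ho.opp_pos, ho.flip.opp_pos, vtx_flip_eq]
  · obtain ⟨ψ, hψ⟩ := not_outer.1 ho
    refine ⟨ψ.len - t ψ.f * (ψ.κ + ψ.flip.κ), ψ.offset_len_pos ht, ?_, ?_⟩
    · rw [hψ.opp_eq hK, hψ.flip.opp_eq hK, hv_pos, hv_pos, ← hψ.dir_eq]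
      exact ψ.q_flip_eq t
    · rw [hψ.opp_eq hK, hv_pos]
      have h1 := (ψ.q_eq ht).1
      rw [hψ.h_eq] at h1
      linarith [(ht ψ.f).pos]

omit ht in
theorem facets_ofEdge {e : Sym2 Plane} (he : e ∈ K.edges) {φ : K.Flag} (hφ : φ.edge = e) :
    (HatCell.ofEdge e he : K.HatCell).facets =
      {s(φ.hv, φ.flip.hv), s(φ.flip.hv, φ.flip.opp hK), s(φ.flip.opp hK, φ.opp hK),
        s(φ.opp hK, φ.hv)} := by
  ext ε
  rw [mem_facets_ofEdge hK he hφ, Sym2.eq_swap (a := φ.flip.opp hK),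
    Sym2.eq_swap (a := φ.opp hK) (b := φ.hv)]
  simp only [mem_insert_iff, mem_singleton_iff, top, bot, cross]
  tauto

theorem facets_ofEdge_eq_range {e : Sym2 Plane} (he : e ∈ K.edges) {φ : K.Flag}
    (hφ : φ.edge = e) {w : Fin 4 → K.HatVertex}
    (hw : w = ![φ.hv, φ.flip.hv, φ.flip.opp hK, φ.opp hK]) :
    (HatCell.ofEdge e he : K.HatCell).facets = Set.range (fun i => s(w i, w (finRotate 4 i))) ∧
      IsSimple (⟨fun i => (w i).pos t⟩ : Polygon Plane 4) := by
  have hrange : (HatCell.ofEdge e he : K.HatCell).facets =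
      Set.range (fun i => s(w i, w (finRotate 4 i))) := by
    rw [facets_ofEdge hK he hφ, hw]
    ext ε
    constructor
    · rintro (rfl | rfl | rfl | rfl)
      exacts [⟨0, rfl⟩, ⟨1, rfl⟩, ⟨2, rfl⟩, ⟨3, rfl⟩]
    · rintro ⟨i, rfl⟩
      fin_cases i
      exacts [Or.inl rfl, Or.inr (Or.inl rfl), Or.inr (Or.inr (Or.inl rfl)),
        Or.inr (Or.inr (Or.inr rfl))]
  have hbase := φ.vtx_flip_ne
  have e1 : φ.hv ≠ φ.flip.hv := fun h => hbase (congrArg HatVertex.base h).symm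
  have e2 : φ.hv ≠ φ.flip.opp hK := fun h => hbase (by
    have := congrArg HatVertex.base h
    rw [opp_base] at this
    exact this.symm)
  have e3 : φ.hv ≠ φ.opp hK := fun h => φ.opp_owner_ne hK (congrArg HatVertex.owner h).symm
  have e4 : φ.flip.hv ≠ φ.flip.opp hK := fun h =>
    φ.flip.opp_owner_ne hK (congrArg HatVertex.owner h).symm
  have e5 : φ.flip.hv ≠ φ.opp hK := fun h => hbase (by
    have := congrArg HatVertex.base h
    rw [opp_base] at this
    exact this)
  have e6 : φ.flip.opp hK ≠ φ.opp hK := fun h => hbase (by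
    have := congrArg HatVertex.base h
    rw [opp_base, opp_base] at this
    exact this)
  refine ⟨hrange, isSimple_of_cycle hK ht (by norm_num) ?_ (c := .ofEdge e he) fun i => ?_⟩
  · rw [hw]
    intro i j hij
    fin_cases i <;> fin_cases j
    exacts [rfl, absurd hij e1, absurd hij e2, absurd hij e3, absurd hij.symm e1, rfl,
      absurd hij e4, absurd hij e5, absurd hij.symm e2, absurd hij.symm e4, rfl, absurd hij e6,
      absurd hij.symm e3, absurd hij.symm e5, absurd hij.symm e6, rfl]
  · rw [hrange]
    exact ⟨i, rfl⟩

theorem isSimpleClosedPolygon (c : K.HatCell) : c.IsSimpleClosedPolygon t := by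
  cases c with
  | ofFace f => exact isSimpleClosedPolygon_ofFace ht f
  | ofEdge e he =>
    obtain ⟨φ, hφ⟩ := exists_of_edges he
    exact ⟨4, _, facets_ofEdge_eq_range hK ht he hφ rfl⟩
  | ofVertex v c hc => exact isSimpleClosedPolygon_ofVertex hK ht hc

/-- Both copies of the edge are positive multiples of `φ.dir`; one has height `t φ.f` > 0 over the
line of the edge and the other has height at most 0. -/
theorem isConvexTrapezium {e : Sym2 Plane} (he : e ∈ K.edges) {φ : K.Flag} (hφ : φ.edge = e) :
    IsConvexTrapezium (φ.hv.pos t) (φ.flip.hv.pos t) ((φ.flip.opp hK).pos t)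
      ((φ.opp hK).pos t) := by
  obtain ⟨β, hβ, h1, h2⟩ := φ.exists_opp_flip_eq hK ht
  have hα := φ.offset_len_pos ht
  set α := φ.len - t φ.f * (φ.κ + φ.flip.κ) with hα'
  have h3 : φ.flip.hv.pos t = φ.hv.pos t + α • φ.dir := φ.q_flip_eq t
  refine ⟨?_, convex_region_of_parallel φ.frame hα hβ h3 h1 ?_, α / β, by positivity, ?_⟩
  · have := (facets_ofEdge_eq_range hK ht he hφ rfl).2
    convert this using 2
    funext i
    fin_cases i <;> rfl
  · have e1 := φ.h_eq ((φ.opp hK).pos t)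
    have e2 := φ.h_eq (φ.hv.pos t)
    have e3 : φ.h (φ.hv.pos t) = t φ.f := (φ.q_eq ht).1
    have e4 := (ht φ.f).pos
    rw [← sub_sub_sub_cancel_right _ _ φ.vtx, inner_sub_right, ← e1, ← e2, e3]
    linarith
  · rw [h1, h3, add_sub_cancel_left, add_sub_cancel_left, smul_smul, div_mul_cancel₀ _ hβ.ne']

end

end PolygonalComplex

end EulerTransform

theorem mainTheorem3 {ι : Type*} [Finite ι] (K : PolygonalComplex ι) (hK : K.IsEulerInput)
    (t : ι → ℝ) (ht : ∀ f, IsMiteredOffset (K.face f) (t f)) :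
    -- the 1-skeleton is planar, and its straight-line realization is a plane drawing
    IsPlanar K.hatGraph ∧
    IsStraightPlaneDrawing K.hatGraph (PolygonalComplex.HatVertex.pos t) ∧
    -- each cell is a simple closed polygon
    (∀ c : K.HatCell, c.IsSimpleClosedPolygon t) ∧
    -- any two cells intersect at most in a common vertex or a common edge
    (∀ c d : K.HatCell, c ≠ d → c.MeetProperly t d) ∧
    -- the offset polygons are pairwise disjoint
    (∀ f g : ι, f ≠ g → Disjoint ((PolygonalComplex.HatCell.ofFace f : K.HatCell).region t)
      ((PolygonalComplex.HatCell.ofFace g : K.HatCell).region t)) ∧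
    -- the cells of edges are convex trapezia
    (∀ (e : Sym2 Plane) (he : e ∈ K.edges), ∃ a b c d : K.HatVertex,
      (PolygonalComplex.HatCell.ofEdge e he).facets = {s(a, b), s(b, c), s(c, d), s(d, a)} ∧
      IsConvexTrapezium (a.pos t) (b.pos t) (c.pos t) (d.pos t)) ∧
    -- the cells of distinct vertices are disjoint
    (∀ (u v : Plane) (c d : Set ι) (hc : c ∈ K.fans u) (hd : d ∈ K.fans v), u ≠ v →
      Disjoint ((PolygonalComplex.HatCell.ofVertex u c hc).region t)
        ((PolygonalComplex.HatCell.ofVertex v d hd).region t)) := by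
  refine ⟨(PolygonalComplex.isStraightPlaneDrawing hK ht).isPlanar,
    PolygonalComplex.isStraightPlaneDrawing hK ht,
    PolygonalComplex.isSimpleClosedPolygon hK ht,
    fun _ _ => PolygonalComplex.meetProperly hK ht,
    fun _ _ => PolygonalComplex.disjoint_ofFace ht, fun e he => ?_,
    fun _ _ _ _ => PolygonalComplex.disjoint_ofVertex hK ht⟩
  obtain ⟨φ, hφ⟩ := PolygonalComplex.Flag.exists_of_edges he
  exact ⟨_, _, _, _, PolygonalComplex.facets_ofEdge hK he hφ,
    PolygonalComplex.isConvexTrapezium hK ht he hφ⟩
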